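/- **Theorem (numerical precession of the implicit midpoint rule).** Consider the Kepler problem $\ddot x = f(x) := -x/|x|^3$ in $\mathbb{R}^2\setminus\{0\}$, with Lagrangian $\mathcal L(x,\dot x) = \frac12|\dot x|^2 + \frac1{|x|}$, and let $\gamma$ be a solution whose orbit is an ellipse with one focus at the origin, with semimajor axis $a$ and semiminor axis $b$, $0<b<a$. Let $T$ be its period and $\mathbb L = x_1\dot x_2-\dot x_1x_2$ its angular momentum. Consider two methods with step size $h$, each with its modified Lagrangian of second order accuracy: * the implicit midpoint rule $\frac{x_{k+1}-2x_k+x_{k-1}}{h^2} = \frac12 f\big(\frac{x_k+x_{k+1}}2\big)+\frac12 f\big(\frac{x_{k-1}+x_k}2\big)$, with $$\mathcal L^{MP}_h = \frac12|\dot x|^2+\frac1{|x|}+\frac{h^2}{24}\Big(\frac1{|x|^4}+\frac{|\dot x|^2}{|x|^3}-3\frac{\langle x,\dot x\rangle^2}{|x|^5}\Big);$$ * the Störmer–Verlet method $\frac{x_{k+1}-2x_k+x_{k-1}}{h^2}=f(x_k)$, with $$\mathcal L^{SV}_h = \frac12|\dot x|^2+\frac1{|x|}+\frac{h^2}{24}\Big(\frac1{|x|^4}-2\frac{|\dot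 x|^2}{|x|^3}+6\frac{\langle x,\dot x\rangle^2}{|x|^5}\Big).$$ For a curve $x$, let $\Delta\omega$ be the change from time $0$ to time $T$ (the period of the unperturbed orbit) of the continuously followed angle of the Laplace–Runge–Lenz vector $|\dot x|^2x-\langle x,\dot x\rangle\dot x-x/|x|$. We say that a method has numerical precession rate $\rho h^2+O(h^4)$, in terms of its modified Lagrangian $\mathcal L_h$, if the following two conditions hold. 1. *The Euler–Lagrange equation of $\mathcal L_h$ describes the numerical solutions up to $O(h^4)$.* For every $K>0$ there are $C,h_0>0$ such that for $0<h<h_0$ and every $x_1$ with $|x_1-\gamma(h)|\le Kh^3$, a numerical solution $x_0=\gamma(0),x_1,x_2,\dots$ up to time $T$ exists, and each such numerical solution satisfies $|x_k-X(kh)|\le Ch^4$ for $0\le kh\le T$, for some solution $X$ on $[0,T]$ of the Euler–Lagrange equation of $\mathcal L_h$ with $|X(0)-\gamma(0)|\le Ch^2$ and $|\dot X(0)-\dot\gamma(0)|\le Ch^2$. (Numerical solutions are taken with $|x_{k+1}-x_k|\le\frac12|x_k|$, which excludes spurious solutions of the implicit equation whose midpoint nearly hits the origin.) 2. *Precession rate.*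 For every $K>0$ there are $C,h_0>0$ such that for $0<h<h_0$ and all $(y,w)$ with $|y-\gamma(0)|\le Kh^2$ and $|w-\dot\gamma(0)|\le Kh^2$, the Euler–Lagrange equation of $\mathcal L_h$ has a solution on $[0,T]$ with initial position $y$ and initial velocity $w$, and along every such solution the Laplace–Runge–Lenz vector does not vanish and $|\Delta\omega-\rho h^2|\le Ch^4$. Then the implicit midpoint rule has numerical precession rate $$\operatorname{sgn}(\mathbb L)\,\frac{\pi}{12}\Big(15\frac{a^3}{b^6}-3\frac a{b^4}\Big)h^2+O(h^4),$$ and its coefficient of $h^2$ is exactly $-2$ times the coefficient $\rho_{SV}$ in the numerical precession rate $\rho_{SV}h^2+O(h^4)$ of the Störmer–Verlet method. -/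

import Mathlib

noncomputable section

namespace Kepler

open Set

/-- The Euclidean plane. -/
abbrev Plane := EuclideanSpace ℝ (Fin 2)

/-! ### Lagrangian mechanics in the punctured plane -/

/-- `(X, V)` is a motion on the time set `J` of the Lagrangian `L(x, ẋ)`, in the plane without the
origin: `Ẋ = V`, and the Euler-Lagrange equation `d/dt (∂L/∂ẋ) = ∂L/∂x` holds. -/
def IsMotion (L : Plane → Plane → ℝ) (J : Set ℝ) (X V : ℝ → Plane) : Prop :=
  ∀ t ∈ J, X t ≠ 0 ∧ HasDerivWithinAt X (V t) J t ∧
    HasDerivWithinAt (fun s => gradient (fun w => L (X s) w) (V s))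
      (gradient (fun y => L y (V t)) (X t)) J t

/-- The Lagrangian of the Kepler problem. -/
def lagrangian (x v : Plane) : ℝ := ‖v‖ ^ 2 / 2 + 1 / ‖x‖

/-- The modified Lagrangian, of second order accuracy, of the implicit midpoint rule. -/
def midpointLagrangian (h : ℝ) (x v : Plane) : ℝ :=
  ‖v‖ ^ 2 / 2 + 1 / ‖x‖ + h ^ 2 / 24 *
    (1 / ‖x‖ ^ 4 + ‖v‖ ^ 2 / ‖x‖ ^ 3 - 3 * inner ℝ x v ^ 2 / ‖x‖ ^ 5)

/-- The modified Lagrangian, of second order accuracy, of the Störmer-Verlet method. -/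
def verletLagrangian (h : ℝ) (x v : Plane) : ℝ :=
  ‖v‖ ^ 2 / 2 + 1 / ‖x‖ + h ^ 2 / 24 *
    (1 / ‖x‖ ^ 4 - 2 * (‖v‖ ^ 2 / ‖x‖ ^ 3) + 6 * inner ℝ x v ^ 2 / ‖x‖ ^ 5)

/-- The angular momentum `x₁ ẋ₂ - ẋ₁ x₂`. -/
def angularMomentum (x v : Plane) : ℝ := x 0 * v 1 - v 0 * x 1

/-- The Laplace-Runge-Lenz vector `|ẋ|² x - ⟨x, ẋ⟩ ẋ - x / |x|`. -/
def lrl (x v : Plane) : Plane := ‖v‖ ^ 2 • x - inner ℝ x v • v - ‖x‖⁻¹ • x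

/-! ### Orbits -/

/-- `S` is the ellipse with foci `F₁`, `F₂`, semimajor axis `a` and semiminor axis `b`. -/
def IsEllipse (S : Set Plane) (F₁ F₂ : Plane) (a b : ℝ) : Prop :=
  0 < a ∧ 0 < b ∧ (dist F₁ F₂ / 2) ^ 2 + b ^ 2 = a ^ 2 ∧
    S = {p | dist p F₁ + dist p F₂ = 2 * a}

/-- `T` is the (smallest positive) period of `γ`. -/
def IsPeriod (γ : ℝ → Plane) (T : ℝ) : Prop :=
  IsLeast {t | 0 < t ∧ Function.Periodic γ t} T

/-- The vector `Z t` does not vanish for `0 ≤ t ≤ T`, and its angle with the first coordinate axis,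
followed continuously, changes by `Δ` from time `0` to time `T`. -/
def HasAngleChange (Z : ℝ → Plane) (T Δ : ℝ) : Prop :=
  ∃ ω : ℝ → ℝ, ContinuousOn ω (Icc 0 T) ∧ ω T - ω 0 = Δ ∧
    ∀ t ∈ Icc 0 T, Z t ≠ 0 ∧ Z t = ‖Z t‖ • !₂[Real.cos (ω t), Real.sin (ω t)]

/-! ### The numerical methods -/

/-- The force `f(x) = - x / |x|³`. -/
def force (x : Plane) : Plane := -((‖x‖ ^ 3)⁻¹ • x)

/-- Right hand side of the midpoint rule, as a function of `x_{k-1}`, `x_k`, `x_{k+1}`. -/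
def midpointForce (xm x xp : Plane) : Plane :=
  (1 / 2 : ℝ) • force ((1 / 2 : ℝ) • (x + xp)) + (1 / 2 : ℝ) • force ((1 / 2 : ℝ) • (xm + x))

/-- Right hand side of the Störmer-Verlet method, as a function of `x_{k-1}`, `x_k`, `x_{k+1}`. -/
def verletForce (_ x _ : Plane) : Plane := force x

/-- `x₀, x₁, …` is a numerical solution with step size `h`, up to time `T`, of the method
`(x_{k+1} - 2 x_k + x_{k-1}) / h² = Φ (x_{k-1}, x_k, x_{k+1})`. The bound on the steps selects the
relevant solution `x_{k+1}` of an implicit equation: the midpoint rule also has spurious ones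
`x_{k+1} ≈ - x_k`, for which the midpoint nearly hits the singularity at the origin. -/
def IsNumericalSolution (Φ : Plane → Plane → Plane → Plane) (h T : ℝ) (x : ℕ → Plane) : Prop :=
  (∀ k : ℕ, (k + 2 : ℝ) * h ≤ T →
    (h ^ 2)⁻¹ • (x (k + 2) - (2 : ℝ) • x (k + 1) + x k) = Φ (x k) (x (k + 1)) (x (k + 2))) ∧
  ∀ k : ℕ, (k + 1 : ℝ) * h ≤ T → ‖x (k + 1) - x k‖ ≤ ‖x k‖ / 2

/-- Along the Kepler motion `(γ, γ')` and up to time `T`, the Euler-Lagrange equation of `L h`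
is the modified equation of the method `Φ` up to `O(h⁴)`: numerical solutions, started on the orbit
with `x₀ = γ(0)` and `x₁ = γ(h) + O(h³)`, exist for small `h` and agree, up to `O(h⁴)`, with a
motion of the Lagrangian `L h` with initial data `O(h²)`-close to those of `γ`. -/
def IsModifiedLagrangian (Φ : Plane → Plane → Plane → Plane) (L : ℝ → Plane → Plane → ℝ)
    (γ γ' : ℝ → Plane) (T : ℝ) : Prop :=
  ∀ K > 0, ∃ C > 0, ∃ h₀ > 0, ∀ h ∈ Ioo 0 h₀,
    (∀ x₁ : Plane, ‖x₁ - γ h‖ ≤ K * h ^ 3 →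
      ∃ x, IsNumericalSolution Φ h T x ∧ x 0 = γ 0 ∧ x 1 = x₁) ∧
    ∀ x, IsNumericalSolution Φ h T x → x 0 = γ 0 → ‖x 1 - γ h‖ ≤ K * h ^ 3 →
      ∃ X V, IsMotion (L h) (Icc 0 T) X V ∧
        ‖X 0 - γ 0‖ ≤ C * h ^ 2 ∧ ‖V 0 - γ' 0‖ ≤ C * h ^ 2 ∧
        ∀ k : ℕ, k * h ≤ T → ‖x k - X (k * h)‖ ≤ C * h ^ 4

/-- The precession rate of the perturbed Kepler problem with Lagrangian `L h` is `ρ h² + O(h⁴)`: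
for small `h` the motions of `L h` with initial data `O(h²)`-close to those of the Kepler motion
`(γ, γ')` exist on the time interval `[0, T]`, and along each of them the angle of the
Laplace-Runge-Lenz vector changes by `ρ h² + O(h⁴)` from time `0` to time `T`, where `T` is to be
the period of the unperturbed motion `γ`. -/
def HasPrecessionRate (L : ℝ → Plane → Plane → ℝ) (γ γ' : ℝ → Plane) (T ρ : ℝ) : Prop :=
  ∀ K > 0, ∃ C > 0, ∃ h₀ > 0, ∀ h ∈ Ioo 0 h₀, ∀ y w : Plane,
    ‖y - γ 0‖ ≤ K * h ^ 2 → ‖w - γ' 0‖ ≤ K * h ^ 2 →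
    (∃ X V, IsMotion (L h) (Icc 0 T) X V ∧ X 0 = y ∧ V 0 = w) ∧
    ∀ X V, IsMotion (L h) (Icc 0 T) X V → X 0 = y → V 0 = w →
      ∃ Δ, HasAngleChange (fun t => lrl (X t) (V t)) T Δ ∧ |Δ - ρ * h ^ 2| ≤ C * h ^ 4

/-- The numerical precession rate of the method `Φ` is `ρ h² + O(h⁴)`: it is the precession rate
of the perturbed Kepler problem `L h` that describes the numerical solutions up to `O(h⁴)`. -/
def HasNumericalPrecessionRate (Φ : Plane → Plane → Plane → Plane) (L : ℝ → Plane → Plane → ℝ)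
    (γ γ' : ℝ → Plane) (T ρ : ℝ) : Prop :=
  IsModifiedLagrangian Φ L γ γ' T ∧ HasPrecessionRate L γ γ' T ρ

end Kepler

end

/-!
After inverting its mass operator, the Euler-Lagrange equation of either modified Lagrangian reads
`x'' = f(x) + ε P(ε, x, x')`, where `ε = h²` and `P` is smooth. With `ε` as a further state variable
this is one smooth autonomous system, so its motions from data `O(h²)`-close to those of `γ` exist
on `[0, T]` and stay `O(h²)`-close to `γ`.

Both methods are symmetric in time, so only even powers of `h` occur when a motion of the modified
equation is inserted into the difference equation, and the modified Lagrangian is made so that the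
residual is `O(h⁶)`. Stability of the two-step recursion turns this into an error `O(h⁴)`, provided
that the motion starts from the first two numerical positions; its initial velocity is found by a
simplified Newton iteration.

The Laplace-Runge-Lenz vector is conserved by the Kepler problem. Along a motion of the modified
equation its angle therefore changes at a rate `ε · p(ε, x, x')`, and `Δω` agrees up to `O(h⁴)`
with `h²` times the integral of `p(0, γ, γ')` over one period. Conservation of energy and angular
momentum turns this integrand into a polynomial in `1 / |γ|`. The integrals of the powers of `1 /
|γ|` satisfy a recursion, found by differentiating `⟨γ, γ'⟩ / |γ|ⁿ`, and the first of them is the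
angle `2π` swept out by `γ` divided by `|L|`. The result is proportional to `1 + σ`, where `σ = 1`
for the midpoint rule and `σ = -2` for the Störmer-Verlet method, whence the factor `-2`.
-/

noncomputable section

namespace Kepler

open Set Metric Topology Filter
open scoped ContDiff NNReal RealInnerProductSpace

theorem exists_norm_le_of_isCompact {S F : Type*} [TopologicalSpace S] [SeminormedAddCommGroup F]
    {K : Set S} {u : S → F} (hK : IsCompact K) (hu : ContinuousOn u K) :
    ∃ C > 0, ∀ x ∈ K, ‖u x‖ ≤ C := by
  obtain ⟨C, hC⟩ := hK.exists_bound_of_continuousOn hu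
  exact ⟨max 1 C, by positivity, fun x hx => (hC x hx).trans (le_max_right 1 C)⟩

theorem exists_norm_sub_le_of_isCompact {S F : Type*} [NormedAddCommGroup S] [NormedSpace ℝ S]
    [NormedAddCommGroup F] [NormedSpace ℝ F] {U K : Set S} {u : S → F} (hU : IsOpen U)
    (hK : IsCompact K) (hKU : K ⊆ U) (hu : ContDiffOn ℝ 1 u U) :
    ∃ C > 0, ∀ x ∈ K, ∀ y ∈ K, ‖u x - u y‖ ≤ C * ‖x - y‖ := by
  have hloc : LocallyLipschitzOn K u := fun x hx => by
    obtain ⟨C, t, ht, hC⟩ := (hu.contDiffAt (hU.mem_nhds (hKU hx))).exists_lipschitzOnWith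
    exact ⟨C, t, mem_nhdsWithin_of_mem_nhds ht, hC⟩
  obtain ⟨C, hC⟩ := hloc.exists_lipschitzOnWith_of_compact hK
  rw [lipschitzOnWith_iff_norm_sub_le] at hC
  refine ⟨max 1 C, by positivity, fun x hx y hy => (hC hx hy).trans ?_⟩
  gcongr
  exact le_max_right _ _

/-! ### Derivatives along a vector field -/

section LieDerivative

variable {S F : Type*} [NormedAddCommGroup S] [NormedSpace ℝ S]
  [NormedAddCommGroup F] [NormedSpace ℝ F] {U : Set S} {W : S → S} {u v : S → F}
  {c : S → ℝ}

/-- The Lie derivative of the function `u` along the vector field `W`: the rate of change of `u`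
along the integral curves of `W`. -/
def lieDeriv (W : S → S) (u : S → F) (x : S) : F := fderiv ℝ u x (W x)

theorem hasDerivAt_comp_integralCurve {s : ℝ → S} {t : ℝ} (hu : DifferentiableAt ℝ u (s t))
    (hs : HasDerivAt s (W (s t)) t) : HasDerivAt (fun τ => u (s τ)) (lieDeriv W u (s t)) t :=
  hu.hasFDerivAt.comp_hasDerivAt t hs

theorem lieDeriv_eq_of_hasDerivAt_line {x : S} {u' : F} (hu : DifferentiableAt ℝ u x)
    (h : HasDerivAt (fun τ : ℝ => u (x + τ • W x)) u' 0) : lieDeriv W u x = u' :=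
  (HasLineDerivAt.lineDeriv h).symm.trans hu.lineDeriv_eq_fderiv |>.symm

theorem lieDeriv_eqOn (hU : IsOpen U) (h : EqOn u v U) : EqOn (lieDeriv W u) (lieDeriv W v) U :=
  fun x hx => by
    simp only [lieDeriv, (h.eventuallyEq_of_mem (hU.mem_nhds hx)).fderiv_eq]

theorem contDiffOn_lieDeriv (hU : IsOpen U) (hW : ContDiffOn ℝ ∞ W U) (hu : ContDiffOn ℝ ∞ u U) :
    ContDiffOn ℝ ∞ (lieDeriv W u) U :=
  (hu.fderiv_of_isOpen hU (by simp)).clm_apply hW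

theorem contDiffOn_iterate_lieDeriv (hU : IsOpen U) (hW : ContDiffOn ℝ ∞ W U)
    (hu : ContDiffOn ℝ ∞ u U) (k : ℕ) : ContDiffOn ℝ ∞ ((lieDeriv W)^[k] u) U := by
  induction k with
  | zero => exact hu
  | succ k ih =>
    rw [Function.iterate_succ_apply']
    exact contDiffOn_lieDeriv hU hW ih

theorem iterate_lieDeriv_add (hU : IsOpen U) (hW : ContDiffOn ℝ ∞ W U) (hu : ContDiffOn ℝ ∞ u U)
    (hv : ContDiffOn ℝ ∞ v U) (k : ℕ) :
    EqOn ((lieDeriv W)^[k] (fun x => u x + v x))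
      (fun x => (lieDeriv W)^[k] u x + (lieDeriv W)^[k] v x) U := by
  induction k with
  | zero => exact eqOn_refl _ _
  | succ k ih =>
    simp only [Function.iterate_succ_apply']
    refine (lieDeriv_eqOn hU ih).trans fun x hx => ?_
    have hdiff : ∀ {w : S → F}, ContDiffOn ℝ ∞ w U →
        DifferentiableAt ℝ ((lieDeriv W)^[k] w) x := fun hw =>
      ((contDiffOn_iterate_lieDeriv hU hW hw k).contDiffAt (hU.mem_nhds hx)).differentiableAt
        (by simp)
    simp only [lieDeriv, fderiv_fun_add (hdiff hu) (hdiff hv), _root_.add_apply]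

theorem iterate_lieDeriv_smul (hU : IsOpen U) (hW : ContDiffOn ℝ ∞ W U) (hc : Differentiable ℝ c)
    (hcW : ∀ x ∈ U, lieDeriv W c x = 0) (hu : ContDiffOn ℝ ∞ u U) (k : ℕ) :
    EqOn ((lieDeriv W)^[k] (fun x => c x • u x)) (fun x => c x • (lieDeriv W)^[k] u x) U := by
  induction k with
  | zero => exact eqOn_refl _ _
  | succ k ih =>
    simp only [Function.iterate_succ_apply']
    refine (lieDeriv_eqOn hU ih).trans fun x hx => ?_
    have hdiff := ((contDiffOn_iterate_lieDeriv hU hW hu k).contDiffAt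
      (hU.mem_nhds hx)).differentiableAt (by simp)
    have hcx : fderiv ℝ c x (W x) = 0 := hcW x hx
    simp only [lieDeriv, fderiv_fun_smul (hc x) hdiff, _root_.add_apply, _root_.smul_apply,
      ContinuousLinearMap.smulRight_apply, hcx, zero_smul, add_zero]

end LieDerivative

/-! ### Symmetric Taylor expansions -/

section SymmetricTaylor

variable {F : Type*} [NormedAddCommGroup F] [NormedSpace ℝ F]

theorem norm_le_of_deriv_le {φ φ' : ℝ → F} {h C : ℝ} (hφ : ∀ s ∈ Icc 0 h, HasDerivAt φ (φ' s) s)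
    (h0 : φ 0 = 0) (hC : ∀ s ∈ Icc 0 h, ‖φ' s‖ ≤ C) : ∀ s ∈ Icc 0 h, ‖φ s‖ ≤ C * h := by
  intro s hs
  have hmean := norm_image_sub_le_of_norm_deriv_le_segment' (a := 0) (b := h) (C := C)
    (fun x hx => (hφ x hx).hasDerivWithinAt) (fun x hx => hC x ⟨hx.1, hx.2.le⟩) s hs
  have hC0 : 0 ≤ C := (norm_nonneg _).trans (hC s hs)
  rw [h0, sub_zero, sub_zero] at hmean
  exact hmean.trans (by gcongr; exact hs.2)

theorem norm_le_of_deriv2_le {φ φ' φ'' : ℝ → F} {h C : ℝ}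
    (hφ : ∀ s ∈ Icc 0 h, HasDerivAt φ (φ' s) s) (hφ' : ∀ s ∈ Icc 0 h, HasDerivAt φ' (φ'' s) s)
    (h0 : φ 0 = 0) (h0' : φ' 0 = 0) (hC : ∀ s ∈ Icc 0 h, ‖φ'' s‖ ≤ C) :
    ∀ s ∈ Icc 0 h, ‖φ s‖ ≤ C * h ^ 2 := by
  intro s hs
  have := norm_le_of_deriv_le hφ h0 (norm_le_of_deriv_le hφ' h0' hC) s hs
  rwa [mul_assoc, ← sq] at this

theorem hasDerivAt_comp_neg {y : ℝ → F} {y' : F} {s : ℝ} (hy : HasDerivAt y y' (-s)) :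
    HasDerivAt (fun τ => y (-τ)) (-y') s := by
  have := hy.scomp s (hasDerivAt_neg s)
  rwa [neg_one_smul] at this

theorem norm_add_neg_sub_le_of_deriv2 {y₀ y₁ y₂ p p' p'' : ℝ → F} {h C : ℝ}
    (h0 : ∀ s ∈ Icc (-h) h, HasDerivAt y₀ (y₁ s) s)
    (h1 : ∀ s ∈ Icc (-h) h, HasDerivAt y₁ (y₂ s) s)
    (hp : ∀ s, HasDerivAt p (p' s) s) (hp' : ∀ s, HasDerivAt p' (p'' s) s)
    (hp0 : p 0 = (2 : ℝ) • y₀ 0) (hp0' : p' 0 = 0)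
    (hC : ∀ s ∈ Icc 0 h, ‖y₂ s + y₂ (-s) - p'' s‖ ≤ C) :
    ∀ s ∈ Icc 0 h, ‖y₀ s + y₀ (-s) - p s‖ ≤ C * h ^ 2 := by
  have hmem : ∀ s ∈ Icc 0 h, s ∈ Icc (-h) h ∧ -s ∈ Icc (-h) h := fun s hs =>
    ⟨⟨by linarith [hs.1, hs.2], hs.2⟩, ⟨by linarith [hs.1, hs.2], by linarith [hs.1, hs.2]⟩⟩
  refine norm_le_of_deriv2_le (φ' := fun s => y₁ s - y₁ (-s) - p' s) (fun s hs => ?_)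
    (fun s hs => ?_) ?_ (by simp [hp0']) hC
  · exact (((h0 s (hmem s hs).1).fun_add (hasDerivAt_comp_neg (h0 (-s) (hmem s hs).2))).fun_sub
      (hp s)).congr_deriv (by abel)
  · exact (((h1 s (hmem s hs).1).fun_sub (hasDerivAt_comp_neg (h1 (-s) (hmem s hs).2))).fun_sub
      (hp' s)).congr_deriv (by abel)
  · simp [hp0, two_smul]

theorem hasDerivAt_pow_succ_div_factorial_smul (k : ℕ) (c : F) (s : ℝ) :
    HasDerivAt (fun s : ℝ => (s ^ (k + 1) / (k + 1).factorial) • c)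
      ((s ^ k / k.factorial) • c) s := by
  have hpow := ((hasDerivAt_pow (k + 1) s).div_const ((k + 1).factorial : ℝ)).smul_const c
  refine hpow.congr_deriv ?_
  rw [Nat.factorial_succ]
  push_cast
  rw [mul_div_mul_left _ _ (by positivity)]

theorem norm_add_neg_sub_taylor_le (n : ℕ) {y : ℕ → ℝ → F} {h C : ℝ}
    (hy : ∀ k < 2 * n, ∀ s ∈ Icc (-h) h, HasDerivAt (y k) (y (k + 1) s) s)
    (hC : ∀ s ∈ Icc (-h) h, ‖y (2 * n) s‖ ≤ C) : ∀ s ∈ Icc 0 h,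
      ‖y 0 s + y 0 (-s) - (2 : ℝ) • ∑ j ∈ Finset.range n,
        (s ^ (2 * j) / (2 * j).factorial) • y (2 * j) 0‖ ≤ 2 * C * h ^ (2 * n) := by
  induction n generalizing y with
  | zero =>
    intro s hs
    have hs' : s ∈ Icc (-h) h ∧ -s ∈ Icc (-h) h := by
      constructor <;> constructor <;> linarith [hs.1, hs.2]
    have := norm_add_le_of_le (hC s hs'.1) (hC (-s) hs'.2)
    simpa [two_mul] using this
  | succ n ih =>
    have hrest := ih (y := fun k => y (k + 2)) (fun k hk => hy (k + 2) (by omega)) hC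
    intro s hs
    have hrec := norm_add_neg_sub_le_of_deriv2 (y₀ := y 0) (y₁ := y 1) (y₂ := y 2)
      (p := fun s => (2 : ℝ) • ∑ j ∈ Finset.range (n + 1),
        (s ^ (2 * j) / (2 * j).factorial) • y (2 * j) 0)
      (p' := fun s => (2 : ℝ) • ∑ j ∈ Finset.range n,
        (s ^ (2 * j + 1) / (2 * j + 1).factorial) • y (2 * j + 2) 0)
      (p'' := fun s => (2 : ℝ) • ∑ j ∈ Finset.range n,
        (s ^ (2 * j) / (2 * j).factorial) • y (2 * j + 2) 0)
      (hy 0 (by omega)) (hy 1 (by omega)) (fun s => ?_) (fun s => ?_) ?_ (by simp) hrest s hs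
    · exact hrec.trans_eq (by ring)
    · simp only [Finset.sum_range_succ' _ n, mul_zero, pow_zero]
      exact ((HasDerivAt.fun_sum fun j _ =>
        hasDerivAt_pow_succ_div_factorial_smul (2 * j + 1) _ s).add_const _).fun_const_smul 2
    · exact (HasDerivAt.fun_sum fun j _ =>
        hasDerivAt_pow_succ_div_factorial_smul (2 * j) _ s).fun_const_smul 2
    · simp [Finset.sum_range_succ' _ n]

theorem exists_symm_taylor_bound {S : Type*} [NormedAddCommGroup S] [NormedSpace ℝ S]
    {U K : Set S} {W : S → S} {u : S → F} (hU : IsOpen U) (hK : IsCompact K) (hKU : K ⊆ U)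
    (hW : ContDiffOn ℝ ∞ W U) (hu : ContDiffOn ℝ ∞ u U) (n : ℕ) :
    ∃ C > 0, ∀ h ≥ 0, ∀ s : ℝ → S,
      (∀ τ ∈ Icc (-h) h, s τ ∈ K ∧ HasDerivAt s (W (s τ)) τ) →
      ‖u (s h) + u (s (-h)) - (2 : ℝ) • ∑ j ∈ Finset.range n,
        (h ^ (2 * j) / (2 * j).factorial) • (lieDeriv W)^[2 * j] u (s 0)‖ ≤ C * h ^ (2 * n) := by
  have hsmooth := contDiffOn_iterate_lieDeriv hU hW hu
  obtain ⟨C, hC0, hC⟩ :=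
    exists_norm_le_of_isCompact hK ((hsmooth (2 * n)).continuousOn.mono hKU)
  refine ⟨2 * C, by positivity, fun h hh s hs => ?_⟩
  refine norm_add_neg_sub_taylor_le n (y := fun k τ => (lieDeriv W)^[k] u (s τ))
    (fun k _ τ hτ => ?_) (fun τ hτ => hC _ (hs τ hτ).1) h ⟨hh, le_rfl⟩
  have hdiff := ((hsmooth k).contDiffAt (hU.mem_nhds (hKU (hs τ hτ).1))).differentiableAt (by simp)
  simpa only [Function.iterate_succ_apply'] using hasDerivAt_comp_integralCurve hdiff (hs τ hτ).2

end SymmetricTaylor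

/-! ### The flow along a reference curve -/

section Flow

variable {S : Type*} [NormedAddCommGroup S] [NormedSpace ℝ S] {W : S → S} {T : ℝ}

theorem exists_integralCurve {Λ : ℝ≥0} (hΛ : LipschitzWith Λ W) {M : ℝ} [CompleteSpace S]
    (hM : ∀ x, ‖W x‖ ≤ M) (hT : 0 ≤ T) (x : S) :
    ∃ s : ℝ → S, s 0 = x ∧ ∀ t ∈ Icc 0 T, HasDerivAt s (W (s t)) t := by
  have hM0 : 0 ≤ M := (norm_nonneg _).trans (hM x)
  have hPL : IsPicardLindelof (fun _ => W) (tmin := -1) (tmax := T + 1)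
      ⟨0, by norm_num, by linarith⟩ x (M.toNNReal * (T + 1).toNNReal) 0 M.toNNReal Λ := by
    refine IsPicardLindelof.of_time_independent (fun y _ => ?_) hΛ.lipschitzOnWith ?_
    · rw [Real.coe_toNNReal _ hM0]
      exact hM y
    · have hmax : max (T + 1 - 0) (0 - -1) = T + 1 := by
        rw [max_eq_left] <;> linarith
      rw [hmax, NNReal.coe_mul, NNReal.coe_zero, sub_zero, Real.coe_toNNReal (T + 1) (by linarith)]
  obtain ⟨s, hs0, hs⟩ := hPL.exists_eq_forall_mem_Icc_hasDerivWithinAt₀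
  exact ⟨s, hs0, fun t ht => (hs t ⟨by linarith [ht.1], by linarith [ht.2]⟩).hasDerivAt
    (Icc_mem_nhds (by linarith [ht.1]) (by linarith [ht.2]))⟩

theorem dist_integralCurve_le {Λ : ℝ≥0} (hΛ : LipschitzWith Λ W) {f g : ℝ → S}
    (hf : ∀ t ∈ Icc 0 T, HasDerivAt f (W (f t)) t) (hg : ∀ t ∈ Icc 0 T, HasDerivAt g (W (g t)) t) :
    ∀ t ∈ Icc 0 T, dist (f t) (g t) ≤ Real.exp (Λ * T) * dist (f 0) (g 0) := by
  intro t ht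
  have hgronwall := dist_le_of_trajectories_ODE (v := fun _ => W) (fun _ => hΛ)
    (fun t ht => (hf t ht).continuousAt.continuousWithinAt)
    (fun t ht => (hf t ⟨ht.1, ht.2.le⟩).hasDerivWithinAt)
    (fun t ht => (hg t ht).continuousAt.continuousWithinAt)
    (fun t ht => (hg t ⟨ht.1, ht.2.le⟩).hasDerivWithinAt) (le_refl _) t ht
  rw [mul_comm]
  refine hgronwall.trans ?_
  gcongr
  linarith [ht.2]

/-- `Φ x` is, for `x` close to `c 0`, the integral curve of `W` from `x` on the time interval
`[0, T]`; it stays close to the reference curve `c`. The set `K` is a neighbourhood of the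
reference curve of radius at least `δ`, and `A` is the expansion constant of the flow. -/
structure IsFlowAlong (W : S → S) (c : ℝ → S) (T : ℝ) (K : Set S) (δ A : ℝ) (Φ : S → ℝ → S) :
    Prop where
  mem_of_dist_le : ∀ t ∈ Icc 0 T, ∀ x, dist x (c t) ≤ δ → x ∈ K
  apply_zero : ∀ x, Φ x 0 = x
  hasDerivAt : ∀ x, A * dist x (c 0) ≤ δ → ∀ t ∈ Icc 0 T, HasDerivAt (Φ x) (W (Φ x t)) t
  dist_curve_le : ∀ x, ∀ t ∈ Icc 0 T, dist (Φ x t) (c t) ≤ A * dist x (c 0)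
  dist_le : ∀ x y, ∀ t ∈ Icc 0 T, dist (Φ x t) (Φ y t) ≤ A * dist x y

theorem IsFlowAlong.mem {c : ℝ → S} {K : Set S} {δ A : ℝ} {Φ : S → ℝ → S}
    (hΦ : IsFlowAlong W c T K δ A Φ) {x : S} (hx : A * dist x (c 0) ≤ δ) {t : ℝ}
    (ht : t ∈ Icc 0 T) : Φ x t ∈ K :=
  hΦ.mem_of_dist_le t ht _ ((hΦ.dist_curve_le x t ht).trans hx)

variable [FiniteDimensional ℝ S]

theorem exists_contDiff_hasCompactSupport_eqOn {U K : Set S} (hU : IsOpen U) (hK : IsCompact K)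
    (hKU : K ⊆ U) (hW : ContDiffOn ℝ ∞ W U) :
    ∃ W' : S → S, ContDiff ℝ ∞ W' ∧ HasCompactSupport W' ∧ EqOn W' W K := by
  obtain ⟨K', hK', hKK', hK'U⟩ := exists_compact_between hK hU hKU
  obtain ⟨χ, hχ1, hχ0, -⟩ := exists_contMDiffMap_one_nhds_of_subset_interior
    (modelWithCornersSelf ℝ S) (n := ⊤) hK.isClosed hKK'
  have hχ : ContDiff ℝ ∞ χ := χ.contMDiff.contDiff
  have hzero : ∀ x ∉ K', χ x • W x = 0 := fun x hx => by simp [hχ0 x hx]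
  refine ⟨fun x => χ x • W x, ?_, HasCompactSupport.intro hK' hzero, fun x hx => ?_⟩
  · rw [contDiff_iff_contDiffAt]
    intro x
    by_cases hx : x ∈ K'
    · exact hχ.contDiffAt.smul (hW.contDiffAt (hU.mem_nhds (hK'U hx)))
    · refine (contDiffAt_const (c := (0 : S))).congr_of_eventuallyEq ?_
      filter_upwards [hK'.isClosed.isOpen_compl.mem_nhds hx] with y hy using hzero y hy
  · simp [hχ1.self_of_nhdsSet x hx]

theorem exists_isFlowAlong {U : Set S} (hU : IsOpen U) (hW : ContDiffOn ℝ ∞ W U) {c : ℝ → S}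
    (hT : 0 ≤ T) (hc : ∀ t ∈ Icc 0 T, c t ∈ U ∧ HasDerivAt c (W (c t)) t) :
    ∃ K ⊆ U, IsCompact K ∧ ∃ δ > 0, ∃ A ≥ 1, ∃ Φ : S → ℝ → S, IsFlowAlong W c T K δ A Φ := by
  have hcomp : IsCompact (c '' Icc 0 T) := isCompact_Icc.image_of_continuousOn
    fun t ht => (hc t ht).2.continuousAt.continuousWithinAt
  obtain ⟨δ, hδ, hδU⟩ := hcomp.exists_cthickening_subset_open hU
    (by rintro _ ⟨t, ht, rfl⟩; exact (hc t ht).1)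
  have hmem : ∀ t ∈ Icc 0 T, ∀ x, dist x (c t) ≤ δ → x ∈ cthickening δ (c '' Icc 0 T) :=
    fun t ht x hx => mem_cthickening_of_dist_le x (c t) δ _ (mem_image_of_mem c ht) hx
  obtain ⟨W', hW', hW'supp, hWW'⟩ :=
    exists_contDiff_hasCompactSupport_eqOn hU hcomp.cthickening hδU hW
  obtain ⟨Λ, hΛ⟩ := hW'.lipschitzWith_of_hasCompactSupport hW'supp (by simp)
  obtain ⟨M, hM⟩ := hW'supp.exists_bound_of_continuous hW'.continuous
  choose Φ hΦ0 hΦ using exists_integralCurve hΛ hM hT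
  have hc' : ∀ t ∈ Icc 0 T, HasDerivAt c (W' (c t)) t := fun t ht => by
    rw [hWW' (hmem t ht _ (by simp [hδ.le]))]
    exact (hc t ht).2
  have hdist : ∀ x, ∀ t ∈ Icc 0 T, dist (Φ x t) (c t) ≤ Real.exp (Λ * T) * dist x (c 0) :=
    fun x t ht => by simpa only [hΦ0] using dist_integralCurve_le hΛ (hΦ x) hc' t ht
  refine ⟨_, hδU, hcomp.cthickening, δ, hδ, Real.exp (Λ * T), Real.one_le_exp (by positivity), Φ,
    hmem, hΦ0, fun x hx t ht => ?_, hdist, fun x y t ht => ?_⟩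
  · rw [← hWW' (hmem t ht _ ((hdist x t ht).trans hx))]
    exact hΦ x t ht
  · simpa only [hΦ0] using dist_integralCurve_le hΛ (hΦ x) (hΦ y) t ht

end Flow

/-! ### Modified Lagrangians of the Kepler problem -/

/-- The tidal operator at `x`, that is, the Hessian of the potential `-1 / |x|`: minus the
derivative of the force. -/
def tidal (x : Plane) : Plane →L[ℝ] Plane :=
  (‖x‖ ^ 3)⁻¹ • ContinuousLinearMap.id ℝ Plane -
    (3 * (‖x‖ ^ 5)⁻¹) • (innerSL ℝ x).smulRight x

/-- The rate of change of `tidal x v`, for constant `v`, when `x` moves with velocity `v`. -/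
def tidalDot (x v : Plane) : Plane :=
  -(6 * ⟪x, v⟫ * (‖x‖ ^ 5)⁻¹) • v +
    (15 * ⟪x, v⟫ ^ 2 * (‖x‖ ^ 7)⁻¹ - 3 * ‖v‖ ^ 2 * (‖x‖ ^ 5)⁻¹) • x

/-- A family of perturbations of the Kepler Lagrangian: `h = 0` is the Kepler problem, `σ = 1` the
modified Lagrangian of the midpoint rule and `σ = -2` that of the Störmer-Verlet method. -/
def modLagrangian (σ h : ℝ) (x v : Plane) : ℝ :=
  lagrangian x v + h ^ 2 / 24 * (‖force x‖ ^ 2 + σ * ⟪v, tidal x v⟫)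

theorem tidal_apply (x w : Plane) :
    tidal x w = (‖x‖ ^ 3)⁻¹ • w - (3 * ⟪x, w⟫ * (‖x‖ ^ 5)⁻¹) • x := by
  simp only [tidal, _root_.sub_apply, _root_.smul_apply, ContinuousLinearMap.id_apply,
    ContinuousLinearMap.smulRight_apply, innerSL_apply_apply, smul_smul]
  congr 2
  ring

theorem inner_tidal (x v w : Plane) :
    ⟪v, tidal x w⟫ = ⟪v, w⟫ * (‖x‖ ^ 3)⁻¹ - 3 * (⟪x, v⟫ * ⟪x, w⟫ * (‖x‖ ^ 5)⁻¹) := by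
  rw [tidal_apply, inner_sub_right, inner_smul_right, inner_smul_right, real_inner_comm x v]
  ring

theorem tidal_force {x : Plane} (hx : x ≠ 0) : tidal x (force x) = (2 * (‖x‖ ^ 6)⁻¹) • x := by
  have hr : ‖x‖ ≠ 0 := norm_ne_zero_iff.mpr hx
  rw [tidal_apply, force, inner_neg_right, inner_smul_right, real_inner_self_eq_norm_sq]
  match_scalars
  field_simp
  norm_num

theorem norm_force_sq (x : Plane) : ‖force x‖ ^ 2 = (‖x‖ ^ 4)⁻¹ := by
  rcases eq_or_ne x 0 with rfl | hx
  · simp [force]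
  · have hr : ‖x‖ ≠ 0 := norm_ne_zero_iff.mpr hx
    rw [force, norm_neg, norm_smul, norm_inv, norm_pow, norm_norm]
    field_simp

theorem lagrangian_eq_modLagrangian (σ : ℝ) : lagrangian = modLagrangian σ 0 := by
  ext x v
  simp [modLagrangian]

theorem midpointLagrangian_eq_modLagrangian : midpointLagrangian = modLagrangian 1 := by
  ext h x v
  rw [midpointLagrangian, modLagrangian, lagrangian, norm_force_sq, inner_tidal,
    real_inner_self_eq_norm_sq]
  ring

theorem verletLagrangian_eq_modLagrangian : verletLagrangian = modLagrangian (-2) := by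
  ext h x v
  rw [verletLagrangian, modLagrangian, lagrangian, norm_force_sq, inner_tidal,
    real_inner_self_eq_norm_sq]
  ring

/-- The mass operator `∂²L/∂v²` of the modified Lagrangian, where `ε` is the square of the step
size. -/
def mass (σ ε : ℝ) (x : Plane) : Plane →L[ℝ] Plane := 1 + (ε * σ / 12) • tidal x

theorem mass_apply (σ ε : ℝ) (x v : Plane) : mass σ ε x v = v + (ε * σ / 12) • tidal x v := rfl

theorem mass_zero (σ : ℝ) (x : Plane) : mass σ 0 x = 1 := by
  ext1 v
  rw [mass_apply, zero_mul, zero_div, zero_smul, add_zero, one_apply_eq_self]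

/-- The gradient of the modified Lagrangian with respect to the position. -/
def positionGradient (σ ε : ℝ) (x v : Plane) : Plane :=
  force x + (ε / 24) • (σ • tidalDot x v - (2 : ℝ) • tidal x (force x))

section NormPow

variable {E : Type*} [NormedAddCommGroup E] [InnerProductSpace ℝ E]

theorem hasFDerivAt_norm {x : E} (hx : x ≠ 0) :
    HasFDerivAt (fun y : E => ‖y‖) (‖x‖⁻¹ • innerSL ℝ x) x := by
  have hsq := (hasStrictFDerivAt_norm_sq x).hasFDerivAt.sqrt (by simpa using hx)
  simp only [Real.sqrt_sq (norm_nonneg _)] at hsq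
  refine hsq.congr_fderiv ?_
  rw [← Nat.cast_smul_eq_nsmul ℝ, smul_smul]
  congr 1
  push_cast
  field_simp

theorem hasFDerivAt_norm_pow_inv (n : ℕ) {x : E} (hx : x ≠ 0) :
    HasFDerivAt (fun y : E => (‖y‖ ^ n)⁻¹) ((-(n * (‖x‖ ^ (n + 2))⁻¹)) • innerSL ℝ x) x := by
  have hr : ‖x‖ ≠ 0 := norm_ne_zero_iff.mpr hx
  refine (((hasDerivAt_pow n ‖x‖).fun_inv (pow_ne_zero _ hr)).comp_hasFDerivAt x
    (hasFDerivAt_norm hx)).congr_fderiv ?_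
  rw [smul_smul]
  congr 1
  rcases n with _ | n
  · simp
  · simp only [Nat.add_sub_cancel]
    field_simp
    ring

theorem hasDerivWithinAt_norm_pow_inv (n : ℕ) {X : ℝ → E} {v : E} {J : Set ℝ} {t : ℝ}
    (hX : HasDerivWithinAt X v J t) (h0 : X t ≠ 0) :
    HasDerivWithinAt (fun s => (‖X s‖ ^ n)⁻¹) (-(n * (‖X t‖ ^ (n + 2))⁻¹) * ⟪X t, v⟫) J t :=
  ((hasFDerivAt_norm_pow_inv n h0).comp_hasDerivWithinAt t hX).congr_deriv (by simp)

end NormPow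

theorem hasGradientAt_modLagrangian_velocity (σ h : ℝ) (x v : Plane) :
    HasGradientAt (fun w => modLagrangian σ h x w) (mass σ (h ^ 2) x v) v := by
  rw [hasGradientAt_iff_hasFDerivAt]
  have hkin := (hasStrictFDerivAt_norm_sq v).hasFDerivAt.const_mul (1 / 2 : ℝ)
  have htidal := ((hasFDerivAt_id v).inner ℝ (tidal x).hasFDerivAt).const_mul (h ^ 2 / 24 * σ)
  refine (((hkin.fun_add htidal).add_const (1 / ‖x‖ + h ^ 2 / 24 * ‖force x‖ ^ 2)).congr_fderiv
    ?_).congr_of_eventuallyEq (.of_forall fun w => ?_)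
  · ext w
    have hsymm : ⟪v, tidal x w⟫ = ⟪w, tidal x v⟫ := by
      rw [inner_tidal, inner_tidal, real_inner_comm w v]
      ring
    simp [mass_apply, real_inner_comm _ (tidal x v), hsymm]
    ring
  · simp only [modLagrangian, lagrangian, id]
    ring

theorem hasGradientAt_modLagrangian_position (σ h : ℝ) {x : Plane} (hx : x ≠ 0) (v : Plane) :
    HasGradientAt (fun y => modLagrangian σ h y v) (positionGradient σ (h ^ 2) x v) x := by
  rw [hasGradientAt_iff_hasFDerivAt]
  have hinner : HasFDerivAt (fun y : Plane => ⟪y, v⟫ ^ 2) ((2 * ⟪x, v⟫) • innerSL ℝ v) x := by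
    simp only [real_inner_comm v]
    simpa using (innerSL ℝ v).hasFDerivAt.pow 2
  have htidal := ((hasFDerivAt_norm_pow_inv 3 hx).const_mul (‖v‖ ^ 2)).fun_sub
    ((hinner.mul (hasFDerivAt_norm_pow_inv 5 hx)).const_mul 3)
  refine (((hasFDerivAt_norm_pow_inv 1 hx).fun_add (((hasFDerivAt_norm_pow_inv 4 hx).fun_add
    (htidal.const_mul σ)).const_mul (h ^ 2 / 24))).add_const (‖v‖ ^ 2 / 2)
    |>.congr_fderiv ?_).congr_of_eventuallyEq (.of_forall fun y => ?_)
  · ext w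
    rw [positionGradient, tidal_force hx]
    simp [tidalDot, force]
    ring
  · simp only [modLagrangian, lagrangian, norm_force_sq, inner_tidal, real_inner_self_eq_norm_sq,
      Pi.mul_apply]
    ring

section Curves

variable {J : Set ℝ} {t : ℝ} {X V : ℝ → Plane} {A : Plane}

theorem hasDerivWithinAt_force (hX : HasDerivWithinAt X A J t) (h0 : X t ≠ 0) :
    HasDerivWithinAt (fun s => force (X s)) (-tidal (X t) A) J t := by
  refine ((hasDerivWithinAt_norm_pow_inv 3 hX h0).fun_smul hX).neg.congr_deriv ?_
  rw [tidal_apply]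
  push_cast
  module

theorem hasDerivWithinAt_tidal (hX : HasDerivWithinAt X (V t) J t)
    (hV : HasDerivWithinAt V A J t) (h0 : X t ≠ 0) :
    HasDerivWithinAt (fun s => tidal (X s) (V s)) (tidalDot (X t) (V t) + tidal (X t) A) J t := by
  simp only [tidal_apply]
  refine (((hasDerivWithinAt_norm_pow_inv 3 hX h0).fun_smul hV).fun_sub
    ((((hX.inner ℝ hV).const_mul 3).fun_mul (hasDerivWithinAt_norm_pow_inv 5 hX h0)).fun_smul
      hX)).congr_deriv ?_
  simp only [tidalDot, real_inner_self_eq_norm_sq]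
  push_cast
  match_scalars <;> ring

theorem hasDerivWithinAt_mass (σ ε : ℝ) (hX : HasDerivWithinAt X (V t) J t)
    (hV : HasDerivWithinAt V A J t) (h0 : X t ≠ 0) :
    HasDerivWithinAt (fun s => mass σ ε (X s) (V s))
      (mass σ ε (X t) A + (ε * σ / 12) • tidalDot (X t) (V t)) J t := by
  simp only [mass_apply]
  refine (hV.fun_add ((hasDerivWithinAt_tidal hX hV h0).const_smul (ε * σ / 12))).congr_deriv ?_
  module

end Curves

theorem isMotion_modLagrangian_iff {σ h : ℝ} {J : Set ℝ} {X V : ℝ → Plane} :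
    IsMotion (modLagrangian σ h) J X V ↔ ∀ t ∈ J, X t ≠ 0 ∧ HasDerivWithinAt X (V t) J t ∧
      HasDerivWithinAt (fun s => mass σ (h ^ 2) (X s) (V s))
        (positionGradient σ (h ^ 2) (X t) (V t)) J t := by
  refine forall₂_congr fun t _ => and_congr_right fun h0 => and_congr_right fun _ => ?_
  simp only [(hasGradientAt_modLagrangian_velocity σ h _ _).gradient,
    (hasGradientAt_modLagrangian_position σ h h0 (V t)).gradient]

/-! ### The Euler-Lagrange equation in normal form -/

/-- The acceleration of the modified problem minus the Kepler force, divided by `ε`, to leading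
order. -/
def leadingPerturbation (σ : ℝ) (x v : Plane) : Plane :=
  -((σ / 24) • tidalDot x v + ((1 + σ) / 12) • tidal x (force x))

/-- The acceleration of the modified problem minus the Kepler force, divided by `ε`. The inverse
is junk where the mass operator degenerates. -/
def perturbation (σ ε : ℝ) (x v : Plane) : Plane :=
  Ring.inverse (mass σ ε x) (leadingPerturbation σ x v)

/-- The acceleration given by the Euler-Lagrange equation of the modified Lagrangian. -/
def acceleration (σ ε : ℝ) (x v : Plane) : Plane := force x + ε • perturbation σ ε x v

theorem perturbation_zero (σ : ℝ) : perturbation σ 0 = leadingPerturbation σ := by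
  ext1 x
  ext1 v
  rw [perturbation, mass_zero, Ring.inverse_one, one_apply_eq_self]

theorem mass_perturbation {σ ε : ℝ} {x : Plane} (hM : IsUnit (mass σ ε x)) (v : Plane) :
    mass σ ε x (perturbation σ ε x v) = leadingPerturbation σ x v := by
  rw [perturbation, ← mul_apply_eq_comp, Ring.mul_inverse_cancel _ hM,
    one_apply_eq_self]

theorem mass_acceleration {σ ε : ℝ} {x : Plane} (hM : IsUnit (mass σ ε x)) (v : Plane) :
    mass σ ε x (acceleration σ ε x v) + (ε * σ / 12) • tidalDot x v =
      positionGradient σ ε x v := by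
  rw [acceleration, map_add, map_smul, mass_perturbation hM, mass_apply, leadingPerturbation,
    positionGradient]
  module

theorem leadingPerturbation_eq (σ : ℝ) {x : Plane} (hx : x ≠ 0) (v : Plane) :
    leadingPerturbation σ x v =
      ((1 / 24 : ℝ) * (-(4 + 4 * σ) * (‖x‖ ^ 6)⁻¹ +
        σ * (3 * ‖v‖ ^ 2 * (‖x‖ ^ 5)⁻¹ - 15 * ⟪x, v⟫ ^ 2 * (‖x‖ ^ 7)⁻¹))) • x +
      ((1 / 24 : ℝ) * (σ * (6 * ⟪x, v⟫ * (‖x‖ ^ 5)⁻¹))) • v := by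
  rw [leadingPerturbation, tidal_force hx, tidalDot]
  module

theorem isMotion_of_hasDerivWithinAt {σ h : ℝ} {J : Set ℝ} {X V : ℝ → Plane}
    (h0 : ∀ t ∈ J, X t ≠ 0) (hM : ∀ t ∈ J, IsUnit (mass σ (h ^ 2) (X t)))
    (hX : ∀ t ∈ J, HasDerivWithinAt X (V t) J t)
    (hV : ∀ t ∈ J, HasDerivWithinAt V (acceleration σ (h ^ 2) (X t) (V t)) J t) :
    IsMotion (modLagrangian σ h) J X V :=
  isMotion_modLagrangian_iff.mpr fun t ht => ⟨h0 t ht, hX t ht,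
    (hasDerivWithinAt_mass σ (h ^ 2) (hX t ht) (hV t ht) (h0 t ht)).congr_deriv
      (mass_acceleration (hM t ht) (V t))⟩

/-! ### The Euler-Lagrange equation as a smooth autonomous system -/

/-- The states `(ε, x, v)` of the autonomous system: square of the step size, position and
velocity. -/
abbrev State := ℝ × Plane × Plane

/-- The states at which the Euler-Lagrange equation is regular and the Laplace-Runge-Lenz vector
does not vanish. -/
def regular (σ : ℝ) : Set State :=
  {s | s.2.1 ≠ 0 ∧ IsUnit (mass σ s.1 s.2.1) ∧ lrl s.2.1 s.2.2 ≠ 0}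

/-- The Euler-Lagrange equation as an autonomous vector field. -/
def field (σ : ℝ) (s : State) : State := (0, s.2.2, acceleration σ s.1 s.2.1 s.2.2)

section Smoothness

variable {E : Type*} [NormedAddCommGroup E] [NormedSpace ℝ E] {e : E → ℝ} {x v : E → Plane} {z : E}

theorem contDiffAt_norm_pow_inv (n : ℕ) (hx : ContDiffAt ℝ ∞ x z) (h0 : x z ≠ 0) :
    ContDiffAt ℝ ∞ (fun y => (‖x y‖ ^ n)⁻¹) z :=
  ((hx.norm ℝ h0).pow n).inv (pow_ne_zero _ (norm_ne_zero_iff.mpr h0))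

theorem contDiffAt_force (hx : ContDiffAt ℝ ∞ x z) (h0 : x z ≠ 0) :
    ContDiffAt ℝ ∞ (fun y => force (x y)) z :=
  ((contDiffAt_norm_pow_inv 3 hx h0).smul hx).neg

theorem contDiffAt_tidal (hx : ContDiffAt ℝ ∞ x z) (h0 : x z ≠ 0) :
    ContDiffAt ℝ ∞ (fun y => tidal (x y)) z :=
  ((contDiffAt_norm_pow_inv 3 hx h0).smul contDiffAt_const).sub
    ((contDiffAt_const.mul (contDiffAt_norm_pow_inv 5 hx h0)).smul
      (((innerSL ℝ).contDiff.contDiffAt.comp z hx).smulRight hx))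

theorem contDiffAt_tidalDot (hx : ContDiffAt ℝ ∞ x z) (hv : ContDiffAt ℝ ∞ v z) (h0 : x z ≠ 0) :
    ContDiffAt ℝ ∞ (fun y => tidalDot (x y) (v y)) z := by
  have := contDiffAt_norm_pow_inv 5 hx h0
  have := contDiffAt_norm_pow_inv 7 hx h0
  have := hx.inner ℝ hv
  have := hv.norm_sq ℝ
  unfold tidalDot
  fun_prop

theorem contDiffAt_mass (σ : ℝ) (he : ContDiffAt ℝ ∞ e z) (hx : ContDiffAt ℝ ∞ x z)
    (h0 : x z ≠ 0) : ContDiffAt ℝ ∞ (fun y => mass σ (e y) (x y)) z :=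
  contDiffAt_const.add (((he.mul contDiffAt_const).div_const 12).smul (contDiffAt_tidal hx h0))

theorem contDiffAt_inverse_mass {σ : ℝ} (he : ContDiffAt ℝ ∞ e z) (hx : ContDiffAt ℝ ∞ x z)
    (h0 : x z ≠ 0) (hM : IsUnit (mass σ (e z) (x z))) :
    ContDiffAt ℝ ∞ (fun y => Ring.inverse (mass σ (e y) (x y))) z := by
  obtain ⟨M, hM⟩ := hM
  have hinv := contDiffAt_ringInverse ℝ M (n := ∞)
  rw [hM] at hinv
  exact hinv.comp z (contDiffAt_mass σ he hx h0)

theorem contDiffAt_leadingPerturbation (σ : ℝ) (hx : ContDiffAt ℝ ∞ x z)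
    (hv : ContDiffAt ℝ ∞ v z) (h0 : x z ≠ 0) :
    ContDiffAt ℝ ∞ (fun y => leadingPerturbation σ (x y) (v y)) z := by
  have := contDiffAt_tidalDot hx hv h0
  have := (contDiffAt_tidal hx h0).clm_apply (contDiffAt_force hx h0)
  unfold leadingPerturbation
  fun_prop

theorem contDiffAt_perturbation {σ : ℝ} (he : ContDiffAt ℝ ∞ e z) (hx : ContDiffAt ℝ ∞ x z)
    (hv : ContDiffAt ℝ ∞ v z) (h0 : x z ≠ 0) (hM : IsUnit (mass σ (e z) (x z))) :
    ContDiffAt ℝ ∞ (fun y => perturbation σ (e y) (x y) (v y)) z :=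
  (contDiffAt_inverse_mass he hx h0 hM).clm_apply (contDiffAt_leadingPerturbation σ hx hv h0)

theorem contDiffAt_lrl (hx : ContDiffAt ℝ ∞ x z) (hv : ContDiffAt ℝ ∞ v z) (h0 : x z ≠ 0) :
    ContDiffAt ℝ ∞ (fun y => lrl (x y) (v y)) z :=
  (((hv.norm_sq ℝ).smul hx).sub ((hx.inner ℝ hv).smul hv)).sub
    (((hx.norm ℝ h0).inv (norm_ne_zero_iff.mpr h0)).smul hx)

end Smoothness

theorem contDiff_position : ContDiff ℝ ∞ (fun s : State => s.2.1) :=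
  contDiff_fst.comp contDiff_snd

theorem contDiff_velocity : ContDiff ℝ ∞ (fun s : State => s.2.2) :=
  contDiff_snd.comp contDiff_snd

theorem eventually_isUnit_mass {σ ε : ℝ} {x : Plane} (hx : x ≠ 0) (hM : IsUnit (mass σ ε x)) :
    ∀ᶠ s : ℝ × Plane in 𝓝 (ε, x), IsUnit (mass σ s.1 s.2) :=
  (contDiffAt_mass (z := (ε, x)) σ contDiffAt_fst contDiffAt_snd hx).continuousAt.eventually
    (Units.isOpen.mem_nhds hM)

theorem isOpen_regular (σ : ℝ) : IsOpen (regular σ) := by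
  rw [isOpen_iff_mem_nhds]
  rintro s ⟨h0, hM, hlrl⟩
  have hx := contDiff_position.contDiffAt (x := s)
  have hfst : ContinuousAt (fun s : State => (s.1, s.2.1)) s := by fun_prop
  filter_upwards [hx.continuousAt.eventually_ne h0, hfst.eventually (eventually_isUnit_mass h0 hM),
    (contDiffAt_lrl hx contDiff_velocity.contDiffAt h0).continuousAt.eventually_ne hlrl]
    with y hy0 hyM hylrl using ⟨hy0, hyM, hylrl⟩

theorem contDiffOn_perturbation (σ : ℝ) :
    ContDiffOn ℝ ∞ (fun s : State => perturbation σ s.1 s.2.1 s.2.2) (regular σ) := fun _ hs =>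
  (contDiffAt_perturbation contDiffAt_fst contDiff_position.contDiffAt
    contDiff_velocity.contDiffAt hs.1 hs.2.1).contDiffWithinAt

theorem contDiffOn_field (σ : ℝ) : ContDiffOn ℝ ∞ (field σ) (regular σ) :=
  contDiffOn_const.prodMk (contDiff_velocity.contDiffOn.prodMk
    (ContDiffOn.add (fun _ hs =>
        (contDiffAt_force contDiff_position.contDiffAt hs.1).contDiffWithinAt)
      (contDiff_fst.contDiffOn.smul (contDiffOn_perturbation σ))))

/-! ### Motions as integral curves -/

theorem IsMotion.hasDerivWithinAt_velocity {σ h : ℝ} {J : Set ℝ} {X V : ℝ → Plane}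
    (hm : IsMotion (modLagrangian σ h) J X V) {t : ℝ} (ht : t ∈ J) (hJ : UniqueDiffWithinAt ℝ J t)
    (hM : IsUnit (mass σ (h ^ 2) (X t))) :
    HasDerivWithinAt V (acceleration σ (h ^ 2) (X t) (V t)) J t := by
  obtain ⟨h0, hX, hP⟩ := isMotion_modLagrangian_iff.mp hm t ht
  have hinv : ∀ {x : Plane}, IsUnit (mass σ (h ^ 2) x) → ∀ v,
      v = Ring.inverse (mass σ (h ^ 2) x) (mass σ (h ^ 2) x v) := fun hM v => by
    rw [← mul_apply_eq_comp, Ring.inverse_mul_cancel _ hM, one_apply_eq_self]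
  have hev : V =ᶠ[𝓝[J] t]
      fun s => Ring.inverse (mass σ (h ^ 2) (X s)) (mass σ (h ^ 2) (X s) (V s)) := by
    filter_upwards [(continuousWithinAt_const.prodMk hX.continuousWithinAt).eventually
      (eventually_isUnit_mass h0 hM)] with s hs using hinv hs (V s)
  have hdiff : DifferentiableWithinAt ℝ V J t := by
    have hInv := (contDiffAt_inverse_mass (σ := σ) contDiffAt_const contDiffAt_id h0
      hM).differentiableAt (by simp) |>.comp_differentiableWithinAt t hX.differentiableWithinAt
    exact (hInv.clm_apply hP.differentiableWithinAt).congr_of_eventuallyEq hev (hinv hM (V t))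
  have hV := hdiff.hasDerivWithinAt
  have hmass := hJ.eq_deriv _ (hasDerivWithinAt_mass σ (h ^ 2) hX hV h0) hP
  rw [← mass_acceleration hM, add_left_inj] at hmass
  rwa [hinv hM (derivWithin V J t), hmass, ← hinv hM] at hV

theorem eventuallyEq_nhdsGE_of_hasDerivWithinAt {S : Type*} [NormedAddCommGroup S]
    [NormedSpace ℝ S] {W : S → S} {f g : ℝ → S} {x : ℝ} (hW : ContDiffAt ℝ 1 W (f x))
    (hf : ∀ᶠ t in 𝓝[≥] x, HasDerivWithinAt f (W (f t)) (Ici x) t)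
    (hg : ∀ᶠ t in 𝓝[≥] x, HasDerivWithinAt g (W (g t)) (Ici x) t) (hfg : f x = g x) :
    f =ᶠ[𝓝[≥] x] g := by
  obtain ⟨Λ, N, hN, hΛ⟩ := hW.exists_lipschitzOnWith
  have hfN := (hf.self_of_nhdsWithin self_mem_Ici).continuousWithinAt.eventually hN
  have hgN := (hg.self_of_nhdsWithin self_mem_Ici).continuousWithinAt.eventually (hfg ▸ hN)
  obtain ⟨z, hxz, hz⟩ := mem_nhdsGE_iff_exists_Icc_subset.mp
    ((hf.and hfN).and (hg.and hgN))
  have heq := ODE_solution_unique_of_mem_Icc_right (v := fun _ => W) (s := fun _ => N) (f := f)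
    (g := g) (a := x) (b := z) (fun _ _ => hΛ)
    (fun t ht => (hz ht).1.1.continuousWithinAt.mono Icc_subset_Ici_self)
    (fun t ht => (hz (Ico_subset_Icc_self ht)).1.1.mono (Ici_subset_Ici.mpr ht.1))
    (fun t ht => (hz (Ico_subset_Icc_self ht)).1.2)
    (fun t ht => (hz ht).2.1.continuousWithinAt.mono Icc_subset_Ici_self)
    (fun t ht => (hz (Ico_subset_Icc_self ht)).2.1.mono (Ici_subset_Ici.mpr ht.1))
    (fun t ht => (hz (Ico_subset_Icc_self ht)).2.2) hfg
  exact heq.eventuallyEq_of_mem (Icc_mem_nhdsGE hxz)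

section Uniqueness

variable {σ h T : ℝ} {X V : ℝ → Plane} {s : ℝ → State}

theorem IsMotion.hasDerivWithinAt_state (hm : IsMotion (modLagrangian σ h) (Icc 0 T) X V)
    {t : ℝ} (ht : t ∈ Icc 0 T) (hT : 0 < T) (hM : IsUnit (mass σ (h ^ 2) (X t))) :
    HasDerivWithinAt (fun t => (h ^ 2, X t, V t)) (field σ (h ^ 2, X t, V t)) (Icc 0 T) t :=
  (hasDerivWithinAt_const _ _ _).prodMk ((hm t ht).2.1.prodMk
    (hm.hasDerivWithinAt_velocity ht (uniqueDiffOn_Icc hT t ht) hM))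

theorem IsMotion.isClosed_eq_integralCurve (hm : IsMotion (modLagrangian σ h) (Icc 0 T) X V)
    (hT : 0 < T) (hs : ∀ t ∈ Icc 0 T, s t ∈ regular σ ∧ HasDerivAt s (field σ (s t)) t) :
    IsClosed ({t | s t = (h ^ 2, X t, V t)} ∩ Icc 0 T) := by
  refine isClosed_of_closure_subset fun t ht => ?_
  have htT : t ∈ Icc 0 T := isClosed_Icc.closure_subset_iff.mpr inter_subset_right ht
  have hfreq : ∃ᶠ τ in 𝓝[Icc 0 T] t, s τ = (h ^ 2, X τ, V τ) :=
    frequently_nhdsWithin_iff.mpr (mem_closure_iff_frequently.mp ht)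
  have hsc : ContinuousWithinAt s (Icc 0 T) t := (hs t htT).2.continuousAt.continuousWithinAt
  -- The velocity is only known to be continuous once the mass operator is invertible.
  have hpos : ((s t).1, (s t).2.1) = (h ^ 2, X t) :=
    tendsto_nhds_unique_of_frequently_eq (hsc.fst.prodMk hsc.snd.fst)
      (continuousWithinAt_const.prodMk (hm t htT).2.1.continuousWithinAt)
      (hfreq.mono fun τ hτ => by rw [hτ])
  have hM : IsUnit (mass σ (h ^ 2) (X t)) := by
    obtain ⟨hε, hx⟩ := Prod.mk.inj hpos
    exact hε ▸ hx ▸ (hs t htT).1.2.1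
  exact ⟨tendsto_nhds_unique_of_frequently_eq hsc
    (hm.hasDerivWithinAt_state htT hT hM).continuousWithinAt hfreq, htT⟩

theorem IsMotion.eqOn_integralCurve (hm : IsMotion (modLagrangian σ h) (Icc 0 T) X V)
    (hT : 0 < T) (hs : ∀ t ∈ Icc 0 T, s t ∈ regular σ ∧ HasDerivAt s (field σ (s t)) t)
    (h0 : s 0 = (h ^ 2, X 0, V 0)) : ∀ t ∈ Icc 0 T, s t = (h ^ 2, X t, V t) := by
  refine fun t ht => (hm.isClosed_eq_integralCurve hT hs).Icc_subset_of_forall_exists_gt h0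
    ?_ ht
  rintro x ⟨hsx, hx⟩ y hxy
  have hxT := Ico_subset_Icc_self hx
  have hreg := (hs x hxT).1
  have hM : IsUnit (mass σ (h ^ 2) (X x)) := (hsx ▸ hreg).2.1
  have hIcc : ∀ᶠ τ in 𝓝[≥] x, τ ∈ Icc 0 T ∧ Icc 0 T ∈ 𝓝[Ici x] τ := by
    filter_upwards [Ico_mem_nhdsGE hx.2] with τ hτ
    exact ⟨⟨hx.1.trans hτ.1, hτ.2.le⟩, mem_of_superset
      (inter_mem_nhdsWithin (Ici x) (Iic_mem_nhds hτ.2)) (Icc_subset_Icc_left hx.1)⟩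
  have hXc := (hm x hxT).2.1.continuousWithinAt.mono_of_mem_nhdsWithin
    (hIcc.self_of_nhdsWithin self_mem_Ici).2
  have hMev := (continuousWithinAt_const.prodMk hXc).eventually
    (eventually_isUnit_mass (hm x hxT).1 hM)
  have heq := eventuallyEq_nhdsGE_of_hasDerivWithinAt (W := field σ)
    (((contDiffOn_field σ).contDiffAt ((isOpen_regular σ).mem_nhds hreg)).of_le (by simp))
    (hIcc.mono fun τ hτ => (hs τ hτ.1).2.hasDerivWithinAt)
    ((hIcc.and hMev).mono fun τ hτ =>
      (hm.hasDerivWithinAt_state hτ.1.1 hT hτ.2).mono_of_mem_nhdsWithin hτ.1.2) hsx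
  exact (((heq.filter_mono (nhdsWithin_mono x Ioi_subset_Ici_self)).and
    (Ioc_mem_nhdsGT hxy)).exists)

end Uniqueness

/-! ### Plane geometry and the Laplace-Runge-Lenz vector -/

theorem inner_plane (x y : Plane) : ⟪x, y⟫ = x 0 * y 0 + x 1 * y 1 := by
  simp [PiLp.inner_apply, Fin.sum_univ_two, mul_comm]

theorem norm_sq_plane (x : Plane) : ‖x‖ ^ 2 = x 0 ^ 2 + x 1 ^ 2 := by
  simp [EuclideanSpace.norm_sq_eq, Fin.sum_univ_two]

theorem plane_ext {x y : Plane} (h0 : x 0 = y 0) (h1 : x 1 = y 1) : x = y := by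
  ext i
  fin_cases i <;> assumption

theorem hasDerivAt_coord {X : ℝ → Plane} {v : Plane} {t : ℝ} (hX : HasDerivAt X v t) (i : Fin 2) :
    HasDerivAt (fun s => X s i) (v i) t :=
  (EuclideanSpace.proj (𝕜 := ℝ) i).hasFDerivAt.comp_hasDerivAt t hX

/-- The rate of change of the Laplace-Runge-Lenz vector under the perturbing acceleration `a`. -/
def lrlDot (x v a : Plane) : Plane := (2 * ⟪v, a⟫) • x - ⟪x, a⟫ • v - ⟪x, v⟫ • a

theorem lrlDot_smul (x v a : Plane) (c : ℝ) : lrlDot x v (c • a) = c • lrlDot x v a := by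
  simp only [lrlDot, inner_smul_right]
  module

theorem hasDerivAt_lrl {X V : ℝ → Plane} {a : Plane} {t : ℝ} (h0 : X t ≠ 0)
    (hX : HasDerivAt X (V t) t) (hV : HasDerivAt V (force (X t) + a) t) :
    HasDerivAt (fun s => lrl (X s) (V s)) (lrlDot (X t) (V t) a) t := by
  have hr : ‖X t‖ ≠ 0 := norm_ne_zero_iff.mpr h0
  have hinv := hasDerivWithinAt_norm_pow_inv 1 hX.hasDerivWithinAt h0 (J := univ)
  simp only [pow_one, hasDerivWithinAt_univ] at hinv
  refine (((hV.norm_sq.fun_smul hX).fun_sub ((hX.inner ℝ hV).fun_smul hV)).fun_sub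
    (hinv.fun_smul hX)).congr_deriv ?_
  have hcube : ‖X t‖ ^ 2 * (‖X t‖ ^ 3)⁻¹ = ‖X t‖⁻¹ := by field_simp
  simp only [lrlDot, force, inner_add_right, inner_neg_right, inner_smul_right,
    real_inner_self_eq_norm_sq, real_inner_comm (X t) (V t), Nat.cast_one, Nat.reduceAdd]
  match_scalars
  · linear_combination hcube
  · ring
  · ring

theorem hasDerivAt_angularMomentum {X V : ℝ → Plane} {a : Plane} {t : ℝ}
    (hX : HasDerivAt X (V t) t) (hV : HasDerivAt V a t) :
    HasDerivAt (fun s => angularMomentum (X s) (V s)) (angularMomentum (X t) a) t := by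
  refine (((hasDerivAt_coord hX 0).fun_mul (hasDerivAt_coord hV 1)).fun_sub
    ((hasDerivAt_coord hV 0).fun_mul (hasDerivAt_coord hX 1))).congr_deriv ?_
  rw [angularMomentum]
  ring

theorem angularMomentum_force (x : Plane) : angularMomentum x (force x) = 0 := by
  simp only [angularMomentum, force, PiLp.neg_apply, PiLp.smul_apply, smul_eq_mul]
  ring

theorem angularMomentum_sq (x v : Plane) :
    angularMomentum x v ^ 2 = ‖x‖ ^ 2 * ‖v‖ ^ 2 - ⟪x, v⟫ ^ 2 := by
  rw [norm_sq_plane, norm_sq_plane, inner_plane, angularMomentum]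
  ring

theorem angularMomentum_smul_right (x v : Plane) (c : ℝ) :
    angularMomentum x (c • v) = c * angularMomentum x v := by
  simp only [angularMomentum, PiLp.smul_apply, smul_eq_mul]
  ring

theorem lrl_apply_zero (x v : Plane) : lrl x v 0 = angularMomentum x v * v 1 - ‖x‖⁻¹ * x 0 := by
  simp only [lrl, norm_sq_plane v, inner_plane x v, angularMomentum, PiLp.sub_apply,
    PiLp.smul_apply, smul_eq_mul]
  ring

theorem lrl_apply_one (x v : Plane) : lrl x v 1 = -(angularMomentum x v * v 0) - ‖x‖⁻¹ * x 1 := by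
  simp only [lrl, norm_sq_plane v, inner_plane x v, angularMomentum, PiLp.sub_apply,
    PiLp.smul_apply, smul_eq_mul]
  ring

theorem inner_lrl (x v : Plane) : ⟪lrl x v, x⟫ = angularMomentum x v ^ 2 - ‖x‖ := by
  rw [angularMomentum_sq, lrl, inner_sub_left, inner_sub_left, real_inner_smul_left,
    real_inner_smul_left, real_inner_smul_left, real_inner_self_eq_norm_sq, real_inner_comm x v]
  field_simp

/-- The energy of the Kepler problem. -/
def energy (x v : Plane) : ℝ := ‖v‖ ^ 2 / 2 - ‖x‖⁻¹

theorem norm_lrl_sq {x : Plane} (hx : x ≠ 0) (v : Plane) :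
    ‖lrl x v‖ ^ 2 = 1 + 2 * angularMomentum x v ^ 2 * energy x v := by
  have hunit : ‖x‖⁻¹ ^ 2 * (x 0 ^ 2 + x 1 ^ 2) = 1 := by
    rw [← norm_sq_plane, ← mul_pow, inv_mul_cancel₀ (norm_ne_zero_iff.mpr hx), one_pow]
  have hl : angularMomentum x v = x 0 * v 1 - v 0 * x 1 := rfl
  rw [norm_sq_plane (lrl x v), lrl_apply_zero, lrl_apply_one, energy, norm_sq_plane v]
  linear_combination hunit + 2 * angularMomentum x v * ‖x‖⁻¹ * hl

theorem angularMomentum_lrl_lrlDot {x : Plane} (hx : x ≠ 0) (v : Plane) (p q : ℝ) :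
    angularMomentum (lrl x v) (lrlDot x v (p • x + q • v)) = angularMomentum x v *
      (p * (‖x‖ - angularMomentum x v ^ 2) + 2 * q * ⟪x, v⟫ * ‖x‖⁻¹) := by
  have hr : ‖x‖ ≠ 0 := norm_ne_zero_iff.mpr hx
  have hnorm : ‖x‖⁻¹ * (x 0 ^ 2 + x 1 ^ 2) = ‖x‖ := by
    rw [← norm_sq_plane]
    field_simp
  have hl : angularMomentum x v = x 0 * v 1 - v 0 * x 1 := rfl
  have hzero : lrlDot x v (p • x + q • v) 0 = 2 * q * angularMomentum x v * v 1 +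
      p * angularMomentum x v * x 1 := by
    simp only [lrlDot, inner_plane, PiLp.sub_apply, PiLp.add_apply, PiLp.smul_apply, smul_eq_mul,
      hl]
    ring
  have hone : lrlDot x v (p • x + q • v) 1 = -(2 * q * angularMomentum x v * v 0 +
      p * angularMomentum x v * x 0) := by
    simp only [lrlDot, inner_plane, PiLp.sub_apply, PiLp.add_apply, PiLp.smul_apply, smul_eq_mul,
      hl]
    ring
  rw [angularMomentum, lrl_apply_zero, lrl_apply_one, hzero, hone, inner_plane]
  linear_combination (angularMomentum x v * p) * hnorm + p * angularMomentum x v ^ 2 * hl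

/-! ### Polar angles -/

/-- The unit vector at angle `θ` from the first coordinate axis. -/
def polar (θ : ℝ) : Plane := !₂[Real.cos θ, Real.sin θ]

/-- The rate of change of the polar angle of a point `x` that moves with velocity `v`. -/
def angularVelocity (x v : Plane) : ℝ := angularMomentum x v / ‖x‖ ^ 2

theorem norm_polar (θ : ℝ) : ‖polar θ‖ = 1 := by
  rw [← sq_eq_sq₀ (norm_nonneg _) zero_le_one, norm_sq_plane, one_pow]
  exact Real.cos_sq_add_sin_sq θ

theorem inner_polar (x : Plane) (θ : ℝ) :
    ⟪x, polar θ⟫ = x 0 * Real.cos θ + x 1 * Real.sin θ :=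
  inner_plane x (polar θ)

theorem coe_angle_eq_of_polar_eq {θ₁ θ₂ : ℝ} (h : polar θ₁ = polar θ₂) :
    (θ₁ : Real.Angle) = θ₂ :=
  Real.Angle.cos_sin_inj (congrArg (fun x : Plane => x 0) h) (congrArg (fun x : Plane => x 1) h)

theorem polar_eq_of_coe_angle_eq {θ₁ θ₂ : ℝ} (h : (θ₁ : Real.Angle) = θ₂) :
    polar θ₁ = polar θ₂ := by
  rw [polar, polar, ← Real.Angle.cos_coe, ← Real.Angle.sin_coe, h, Real.Angle.cos_coe,
    Real.Angle.sin_coe]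

theorem exists_eq_norm_smul_polar (x : Plane) : ∃ θ : ℝ, x = ‖x‖ • polar θ := by
  let z : ℂ := ⟨x 0, x 1⟩
  have hnorm : ‖z‖ = ‖x‖ := by
    rw [← sq_eq_sq₀ (norm_nonneg _) (norm_nonneg _), norm_sq_plane, Complex.sq_norm,
      Complex.normSq_apply, pow_two, pow_two]
  refine ⟨z.arg, plane_ext ?_ ?_⟩
  · simpa [polar, hnorm] using (Complex.norm_mul_cos_arg z).symm
  · simpa [polar, hnorm] using (Complex.norm_mul_sin_arg z).symm

section Angle

variable {Z Z' : ℝ → Plane} {φ : ℝ → ℝ} {T : ℝ}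

theorem hasDerivAt_norm_inv_mul_inner_polar {t : ℝ} (h0 : Z t ≠ 0) (hZ : HasDerivAt Z (Z' t) t)
    (hφ : HasDerivAt φ (angularVelocity (Z t) (Z' t)) t) :
    HasDerivAt (fun s => ‖Z s‖⁻¹ * ⟪Z s, polar (φ s)⟫) 0 t := by
  have hr : ‖Z t‖ ≠ 0 := norm_ne_zero_iff.mpr h0
  have hinv := hasDerivWithinAt_norm_pow_inv 1 hZ.hasDerivWithinAt h0 (J := univ)
  simp only [pow_one, hasDerivWithinAt_univ] at hinv
  simp only [inner_polar]
  refine (hinv.fun_mul (((hasDerivAt_coord hZ 0).fun_mul hφ.cos).fun_add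
    ((hasDerivAt_coord hZ 1).fun_mul hφ.sin))).congr_deriv ?_
  rw [angularVelocity, angularMomentum, inner_plane]
  field_simp
  rw [norm_sq_plane]
  ring

theorem eq_norm_smul_polar_of_hasDerivAt (hZ : ∀ t ∈ Icc 0 T, Z t ≠ 0 ∧ HasDerivAt Z (Z' t) t)
    (hφ : ∀ t ∈ Icc 0 T, HasDerivAt φ (angularVelocity (Z t) (Z' t)) t)
    (hφ0 : Z 0 = ‖Z 0‖ • polar (φ 0)) : ∀ t ∈ Icc 0 T, Z t = ‖Z t‖ • polar (φ t) := by
  intro t ht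
  have hd : ∀ s ∈ Icc 0 T, HasDerivAt (fun s => ‖Z s‖⁻¹ * ⟪Z s, polar (φ s)⟫) 0 s := fun s hs =>
    hasDerivAt_norm_inv_mul_inner_polar (hZ s hs).1 (hZ s hs).2 (hφ s hs)
  have hconst : ‖Z t‖⁻¹ * ⟪Z t, polar (φ t)⟫ = ‖Z 0‖⁻¹ * ⟪Z 0, polar (φ 0)⟫ :=
    constant_of_has_deriv_right_zero (fun s hs => (hd s hs).continuousAt.continuousWithinAt)
      (fun s hs => (hd s ⟨hs.1, hs.2.le⟩).hasDerivWithinAt) t ht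
  have hr : ‖Z t‖ ≠ 0 := norm_ne_zero_iff.mpr (hZ t ht).1
  have hr0 : ‖Z 0‖ ≠ 0 := norm_ne_zero_iff.mpr (hZ 0 ⟨le_rfl, ht.1.trans ht.2⟩).1
  have hstart : ‖Z 0‖⁻¹ * ⟪Z 0, polar (φ 0)⟫ = 1 := by
    rw [hφ0, real_inner_smul_left, real_inner_self_eq_norm_sq, norm_smul, norm_norm, norm_polar]
    field_simp
  have hinner : ⟪Z t, polar (φ t)⟫ = ‖Z t‖ * ‖polar (φ t)‖ := by
    rw [hstart] at hconst
    rw [norm_polar]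
    field_simp at hconst ⊢
    exact hconst
  simpa only [norm_polar, one_smul] using inner_eq_norm_mul_iff_real.mp hinner

theorem exists_hasDerivAt_of_continuousOn {f : ℝ → ℝ} (hT : 0 ≤ T)
    (hf : ContinuousOn f (Icc 0 T)) : ∃ F : ℝ → ℝ, ∀ t ∈ Icc 0 T, HasDerivAt F (f t) t := by
  have hc : Continuous (IccExtend hT ((Icc 0 T).domRestrict f)) :=
    (continuousOn_iff_continuous_domRestrict.mp hf).Icc_extend'
  refine ⟨fun t => ∫ τ in (0 : ℝ)..t, IccExtend hT ((Icc 0 T).domRestrict f) τ, fun t ht => ?_⟩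
  exact (hc.integral_hasStrictDerivAt 0 t).hasDerivAt.congr_deriv
    (by simp [IccExtend_of_mem, domRestrict_apply, ht])

theorem continuousOn_angularVelocity (hZ : ∀ t ∈ Icc 0 T, Z t ≠ 0 ∧ HasDerivAt Z (Z' t) t)
    (hZ' : ContinuousOn Z' (Icc 0 T)) :
    ContinuousOn (fun t => angularVelocity (Z t) (Z' t)) (Icc 0 T) := by
  have hZc : ContinuousOn Z (Icc 0 T) := fun t ht => (hZ t ht).2.continuousAt.continuousWithinAt
  have hcoord : ∀ {f : ℝ → Plane}, ContinuousOn f (Icc 0 T) →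
      ∀ i, ContinuousOn (fun t => f t i) (Icc 0 T) := fun hf i =>
    (EuclideanSpace.proj (𝕜 := ℝ) i).continuous.comp_continuousOn hf
  exact (((hcoord hZc 0).mul (hcoord hZ' 1)).sub ((hcoord hZ' 0).mul (hcoord hZc 1))).div
    (hZc.norm.pow 2) fun t ht => pow_ne_zero 2 (norm_ne_zero_iff.mpr (hZ t ht).1)

theorem exists_angle (hT : 0 ≤ T) (hZ : ∀ t ∈ Icc 0 T, Z t ≠ 0 ∧ HasDerivAt Z (Z' t) t)
    (hZ' : ContinuousOn Z' (Icc 0 T)) :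
    ∃ φ : ℝ → ℝ, (∀ t ∈ Icc 0 T, HasDerivAt φ (angularVelocity (Z t) (Z' t)) t) ∧
      (∀ t ∈ Icc 0 T, Z t = ‖Z t‖ • polar (φ t)) ∧
      φ T - φ 0 = ∫ t in 0..T, angularVelocity (Z t) (Z' t) := by
  have hc := continuousOn_angularVelocity hZ hZ'
  obtain ⟨F, hF⟩ := exists_hasDerivAt_of_continuousOn hT hc
  obtain ⟨θ, hθ⟩ := exists_eq_norm_smul_polar (Z 0)
  have hφ : ∀ t ∈ Icc 0 T, HasDerivAt (fun t => θ + (F t - F 0))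
      (angularVelocity (Z t) (Z' t)) t :=
    fun t ht => ((hF t ht).sub_const _).const_add _
  refine ⟨_, hφ, eq_norm_smul_polar_of_hasDerivAt hZ hφ (by simpa using hθ), ?_⟩
  rw [← uIcc_of_le hT] at hφ hc
  exact (intervalIntegral.integral_eq_sub_of_hasDerivAt hφ hc.intervalIntegrable).symm

theorem hasAngleChange_integral (hT : 0 ≤ T)
    (hZ : ∀ t ∈ Icc 0 T, Z t ≠ 0 ∧ HasDerivAt Z (Z' t) t) (hZ' : ContinuousOn Z' (Icc 0 T)) :
    HasAngleChange Z T (∫ t in 0..T, angularVelocity (Z t) (Z' t)) := by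
  obtain ⟨φ, hφ, hpolar, hintg⟩ := exists_angle hT hZ hZ'
  exact ⟨φ, fun t ht => (hφ t ht).continuousAt.continuousWithinAt, hintg,
    fun t ht => ⟨(hZ t ht).1, hpolar t ht⟩⟩

theorem sub_eq_two_pi_of_strictMonoOn (hT : 0 < T) (hφ : StrictMonoOn φ (Icc 0 T))
    (hc : ContinuousOn φ (Icc 0 T)) (hφT : (φ T : Real.Angle) = φ 0)
    (hne : ∀ t ∈ Ioo 0 T, (φ t : Real.Angle) ≠ φ 0) : φ T - φ 0 = 2 * Real.pi := by
  have hmem : (0 : ℝ) ∈ Icc 0 T := left_mem_Icc.mpr hT.le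
  have hlt : φ 0 < φ T := hφ hmem (right_mem_Icc.mpr hT.le) hT
  obtain ⟨k, hk⟩ := Real.Angle.angle_eq_iff_two_pi_dvd_sub.mp hφT
  have hk1 : (1 : ℝ) ≤ k := by
    have hk0 : (0 : ℝ) < k := by
      by_contra! hk0
      nlinarith [Real.pi_pos]
    exact_mod_cast Int.add_one_le_iff.mpr (by exact_mod_cast hk0 : 0 < k)
  obtain ⟨t, ht, hφt⟩ := intermediate_value_Icc hT.le hc
    (show φ 0 + 2 * Real.pi ∈ Icc (φ 0) (φ T) by
      constructor <;> nlinarith [Real.pi_pos])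
  have ht0 : 0 < t := (hφ.lt_iff_lt hmem ht).mp (by linarith [Real.pi_pos])
  have htT : t = T := ht.2.eq_of_not_lt fun htT => hne t ⟨ht0, htT⟩ (by simp [hφt])
  rw [← htT, hφt, add_sub_cancel_left]

end Angle

/-! ### Kepler motions -/

/-- `γ` is a global solution, with velocity `γ'`, of Newton's equation `γ'' = f(γ)`. -/
def IsKepler (γ γ' : ℝ → Plane) : Prop :=
  ∀ t, γ t ≠ 0 ∧ HasDerivAt γ (γ' t) t ∧ HasDerivAt γ' (force (γ t)) t

theorem acceleration_zero (σ : ℝ) (x v : Plane) : acceleration σ 0 x v = force x := by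
  simp [acceleration]

theorem IsMotion.isKepler {γ γ' : ℝ → Plane} (hγ : IsMotion lagrangian univ γ γ') :
    IsKepler γ γ' := by
  intro t
  obtain ⟨h0, hd, -⟩ := hγ t (mem_univ t)
  rw [lagrangian_eq_modLagrangian 0] at hγ
  have hd' := hγ.hasDerivWithinAt_velocity (mem_univ t) uniqueDiffWithinAt_univ
    (by simp [mass_zero])
  rw [hasDerivWithinAt_univ] at hd hd'
  exact ⟨h0, hd, by simpa [acceleration_zero] using hd'⟩

theorem norm_force_sub_le {ρ : ℝ} (hρ : 0 < ρ) {x y : Plane} (hx : ρ ≤ ‖x‖) (hy : ρ ≤ ‖y‖) :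
    ‖force x - force y‖ ≤ 4 / ρ ^ 3 * ‖x - y‖ := by
  have hx0 : 0 < ‖x‖ := hρ.trans_le hx
  have hy0 : 0 < ‖y‖ := hρ.trans_le hy
  have hsplit : force x - force y =
      (-(‖x‖ ^ 3)⁻¹) • (x - y) + ((‖y‖ ^ 3)⁻¹ - (‖x‖ ^ 3)⁻¹) • y := by
    simp only [force]
    module
  have hfirst : ‖(-(‖x‖ ^ 3)⁻¹) • (x - y)‖ ≤ (ρ ^ 3)⁻¹ * ‖x - y‖ := by
    rw [norm_smul, norm_neg, Real.norm_of_nonneg (by positivity)]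
    gcongr
  have hfactor : ((‖y‖ ^ 3)⁻¹ - (‖x‖ ^ 3)⁻¹) * ‖y‖ =
      (‖x‖ - ‖y‖) * (‖x‖⁻¹ * (‖y‖ ^ 2)⁻¹ + (‖x‖ ^ 2)⁻¹ * ‖y‖⁻¹ + (‖x‖ ^ 3)⁻¹) := by
    field_simp
    ring
  have hcoeff : ‖x‖⁻¹ * (‖y‖ ^ 2)⁻¹ + (‖x‖ ^ 2)⁻¹ * ‖y‖⁻¹ + (‖x‖ ^ 3)⁻¹ ≤ 3 * (ρ ^ 3)⁻¹ :=
    calc _ ≤ ρ⁻¹ * (ρ ^ 2)⁻¹ + (ρ ^ 2)⁻¹ * ρ⁻¹ + (ρ ^ 3)⁻¹ := by gcongr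
      _ = 3 * (ρ ^ 3)⁻¹ := by ring
  have hsecond : ‖((‖y‖ ^ 3)⁻¹ - (‖x‖ ^ 3)⁻¹) • y‖ ≤ ‖x - y‖ * (3 * (ρ ^ 3)⁻¹) := by
    rw [norm_smul, ← norm_norm y, ← norm_mul, norm_norm, hfactor, norm_mul]
    refine mul_le_mul (abs_norm_sub_norm_le x y) ?_ (norm_nonneg _) (norm_nonneg _)
    rwa [Real.norm_of_nonneg (by positivity)]
  rw [hsplit]
  exact (norm_add_le_of_le hfirst hsecond).trans_eq (by ring)

theorem lipschitzOnWith_force {ρ : ℝ} (hρ : 0 < ρ) :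
    LipschitzOnWith (4 / ρ ^ 3).toNNReal force {x | ρ ≤ ‖x‖} :=
  LipschitzOnWith.of_dist_le_mul fun x hx y hy => by
    rw [Real.coe_toNNReal _ (by positivity), dist_eq_norm, dist_eq_norm]
    exact norm_force_sub_le hρ hx hy

theorem exists_pos_mul_sub_inner_eq {E : Type*} [NormedAddCommGroup E] [InnerProductSpace ℝ E]
    {u F : E} (hu : ‖u‖ = 1) {a b : ℝ} (ha : 0 < a) (hb : 0 < b)
    (hF : (‖F‖ / 2) ^ 2 + b ^ 2 = a ^ 2) :
    ∃ r > 0, r * (2 * a - ⟪u, F⟫) = 2 * b ^ 2 ∧ ‖r • u‖ + ‖r • u - F‖ = 2 * a := by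
  have hFa : ‖F‖ < 2 * a := by nlinarith [norm_nonneg F, sq_pos_of_pos hb]
  have huF : |⟪u, F⟫| ≤ ‖F‖ := by simpa [hu] using abs_real_inner_le_norm u F
  obtain ⟨hlo, hhi⟩ := abs_le.mp huF
  have hpos : 0 < 2 * a - ⟪u, F⟫ := by linarith
  obtain ⟨r, hr⟩ : ∃ r, r * (2 * a - ⟪u, F⟫) = 2 * b ^ 2 := ⟨_, div_mul_cancel₀ _ hpos.ne'⟩
  have hr0 : 0 < r := pos_of_mul_pos_left (hr ▸ by positivity) hpos.le
  have hra : 0 ≤ 2 * a - r := by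
    refine nonneg_of_mul_nonneg_left (b := 2 * a - ⟪u, F⟫) ?_ hpos
    nlinarith [sq_le_sq' hlo hhi, sq_nonneg (2 * a - ⟪u, F⟫)]
  refine ⟨r, hr0, hr, ?_⟩
  have hsq : ‖r • u - F‖ ^ 2 = (2 * a - r) ^ 2 := by
    rw [norm_sub_sq_real, norm_smul, hu, real_inner_smul_left, Real.norm_of_nonneg hr0.le]
    linear_combination 2 * hr + 4 * hF
  rw [(sq_eq_sq₀ (norm_nonneg _) hra).mp hsq, norm_smul, hu, Real.norm_of_nonneg hr0.le]
  ring

section Orbit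

variable {γ γ' : ℝ → Plane} (hγ : IsKepler γ γ')
include hγ

theorem IsKepler.angularMomentum_eq (t : ℝ) :
    angularMomentum (γ t) (γ' t) = angularMomentum (γ 0) (γ' 0) := by
  have hd : ∀ t, HasDerivAt (fun s => angularMomentum (γ s) (γ' s)) 0 t := fun t =>
    (hasDerivAt_angularMomentum (hγ t).2.1 (hγ t).2.2).congr_deriv (angularMomentum_force _)
  exact is_const_of_deriv_eq_zero (fun t => (hd t).differentiableAt) (fun t => (hd t).deriv) t 0

theorem IsKepler.lrl_eq (t : ℝ) : lrl (γ t) (γ' t) = lrl (γ 0) (γ' 0) := by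
  have hd : ∀ t, HasDerivAt (fun s => lrl (γ s) (γ' s)) 0 t := fun t =>
    (hasDerivAt_lrl (a := 0) (hγ t).1 (hγ t).2.1 (by simpa using (hγ t).2.2)).congr_deriv
      (by simp [lrlDot])
  exact is_const_of_deriv_eq_zero (fun t => (hd t).differentiableAt) (fun t => (hd t).deriv) t 0

theorem IsKepler.energy_eq (t : ℝ) : energy (γ t) (γ' t) = energy (γ 0) (γ' 0) := by
  have hd : ∀ t, HasDerivAt (fun s => energy (γ s) (γ' s)) 0 t := fun t => by
    have hinv := hasDerivWithinAt_norm_pow_inv 1 (hγ t).2.1.hasDerivWithinAt (hγ t).1 (J := univ)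
    simp only [pow_one, hasDerivWithinAt_univ] at hinv
    refine (((hγ t).2.2.norm_sq.div_const 2).fun_sub hinv).congr_deriv ?_
    simp only [force, inner_neg_right, inner_smul_right, real_inner_comm (γ t) (γ' t),
      Nat.cast_one, Nat.reduceAdd]
    ring
  exact is_const_of_deriv_eq_zero (fun t => (hd t).differentiableAt) (fun t => (hd t).deriv) t 0

theorem IsKepler.norm_mul_one_add_inner {t : ℝ} {u : Plane} (hu : γ t = ‖γ t‖ • u) :
    ‖γ t‖ * (1 + ⟪lrl (γ 0) (γ' 0), u⟫) = angularMomentum (γ 0) (γ' 0) ^ 2 := by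
  have hconic := inner_lrl (γ t) (γ' t)
  rw [hγ.lrl_eq, hγ.angularMomentum_eq] at hconic
  have hsmul : ⟪lrl (γ 0) (γ' 0), γ t⟫ = ‖γ t‖ * ⟪lrl (γ 0) (γ' 0), u⟫ := by
    rw [← real_inner_smul_right, ← hu]
  linear_combination hconic - hsmul

theorem IsKepler.conic_of_isEllipse {F : Plane} {a b : ℝ} (hab : IsEllipse (range γ) 0 F a b)
    {u : Plane} (hu : ‖u‖ = 1) :
    2 * b ^ 2 * (1 + ⟪lrl (γ 0) (γ' 0), u⟫) =
      angularMomentum (γ 0) (γ' 0) ^ 2 * (2 * a - ⟪u, F⟫) := by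
  obtain ⟨ha, hb, hF, hS⟩ := hab
  rw [dist_zero_left] at hF
  obtain ⟨r, hr0, hr, hsum⟩ := exists_pos_mul_sub_inner_eq hu ha hb hF
  obtain ⟨t, ht⟩ : r • u ∈ range γ := by
    rw [hS]
    simpa [dist_eq_norm] using hsum
  have hnorm : ‖γ t‖ = r := by rw [ht, norm_smul, hu, mul_one, Real.norm_of_nonneg hr0.le]
  have hconic := hγ.norm_mul_one_add_inner (hnorm ▸ ht)
  rw [hnorm] at hconic
  rw [← hr, ← hconic]
  ring

theorem IsKepler.mul_angularMomentum_sq_of_isEllipse {F : Plane} {a b : ℝ}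
    (hab : IsEllipse (range γ) 0 F a b) : a * angularMomentum (γ 0) (γ' 0) ^ 2 = b ^ 2 := by
  have hpos := hγ.conic_of_isEllipse hab (norm_polar 0)
  have hneg := hγ.conic_of_isEllipse hab (u := -polar 0) (by rw [norm_neg, norm_polar])
  rw [inner_neg_left, inner_neg_right] at hneg
  linear_combination (-1 / 4) * hpos - (1 / 4) * hneg

theorem IsKepler.smul_lrl_of_isEllipse {F : Plane} {a b : ℝ}
    (hab : IsEllipse (range γ) 0 F a b) : (2 * a) • lrl (γ 0) (γ' 0) = -F := by
  set A := lrl (γ 0) (γ' 0)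
  have hunit : ∀ u : Plane, ‖u‖ = 1 → ⟪(2 * a) • A + F, u⟫ = 0 := by
    intro u hu
    have hpos := hγ.conic_of_isEllipse hab hu
    have hl := hγ.mul_angularMomentum_sq_of_isEllipse hab
    have hl0 : angularMomentum (γ 0) (γ' 0) ^ 2 ≠ 0 := by
      intro h0
      rw [h0, mul_zero] at hl
      exact (pow_pos hab.2.1 2).ne hl
    refine (mul_eq_zero.mp (?_ : angularMomentum (γ 0) (γ' 0) ^ 2 * _ = 0)).resolve_left hl0
    rw [inner_add_left, real_inner_smul_left, real_inner_comm u F]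
    linear_combination hpos + 2 * (1 + ⟪A, u⟫) * hl
  have hzero : (2 * a) • A + F = 0 := by
    by_contra hne
    have hn : ‖(2 * a) • A + F‖ ≠ 0 := norm_ne_zero_iff.mpr hne
    have h := hunit (‖(2 * a) • A + F‖⁻¹ • ((2 * a) • A + F)) (norm_smul_inv_norm hne)
    rw [real_inner_smul_right, real_inner_self_eq_norm_sq] at h
    exact mul_ne_zero (inv_ne_zero hn) (pow_ne_zero 2 hn) h
  exact eq_neg_of_add_eq_zero_left hzero

theorem IsKepler.sq_mul_norm_lrl_sq_of_isEllipse {F : Plane} {a b : ℝ}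
    (hab : IsEllipse (range γ) 0 F a b) :
    a ^ 2 * ‖lrl (γ 0) (γ' 0)‖ ^ 2 = a ^ 2 - b ^ 2 := by
  have hF := hab.2.2.1
  rw [dist_zero_left] at hF
  have hnorm := congrArg (fun p => ‖p‖ ^ 2) (hγ.smul_lrl_of_isEllipse hab)
  simp only [norm_smul, norm_neg, mul_pow, Real.norm_eq_abs, sq_abs] at hnorm
  linear_combination hnorm / 4 + hF

theorem IsKepler.div_le_norm (t : ℝ) :
    angularMomentum (γ 0) (γ' 0) ^ 2 / (1 + ‖lrl (γ 0) (γ' 0)‖) ≤ ‖γ t‖ := by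
  have hconic := inner_lrl (γ t) (γ' t)
  rw [hγ.lrl_eq, hγ.angularMomentum_eq] at hconic
  rw [div_le_iff₀ (by positivity)]
  linarith [real_inner_le_norm (lrl (γ 0) (γ' 0)) (γ t)]

theorem IsKepler.periodic_of_eq (hl : angularMomentum (γ 0) (γ' 0) ≠ 0) {t₁ : ℝ}
    (hpos : γ t₁ = γ 0) (hvel : γ' t₁ = γ' 0) : Function.Periodic γ t₁ := by
  set ρ := angularMomentum (γ 0) (γ' 0) ^ 2 / (1 + ‖lrl (γ 0) (γ' 0)‖)
  have hρ : 0 < ρ := by positivity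
  have hshift : (fun t => (γ (t + t₁), γ' (t + t₁))) = fun t => (γ t, γ' t) :=
    ODE_solution_unique_univ (v := fun _ (z : Plane × Plane) => (z.2, force z.1))
      (s := fun _ => {z | ρ ≤ ‖z.1‖}) (t₀ := 0)
      (fun _ => LipschitzWith.prod_snd.lipschitzOnWith.prodMk
        ((lipschitzOnWith_force hρ).comp LipschitzWith.prod_fst.lipschitzOnWith fun _ hz => hz))
      (fun t => ⟨((hγ (t + t₁)).2.1.comp_add_const t t₁).prodMk
        ((hγ (t + t₁)).2.2.comp_add_const t t₁), hγ.div_le_norm _⟩)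
      (fun t => ⟨(hγ t).2.1.prodMk (hγ t).2.2, hγ.div_le_norm t⟩) (by simp [hpos, hvel])
  exact fun t => congrArg Prod.fst (congrFun hshift t)

theorem IsKepler.velocity_eq_of_periodic {T : ℝ} (hT : Function.Periodic γ T) : γ' T = γ' 0 := by
  have hd : HasDerivAt γ (γ' T) 0 := by
    refine ((hγ (0 + T)).2.1.comp_add_const 0 T).congr_of_eventuallyEq
      (.of_forall fun t => (hT t).symm) |>.congr_deriv ?_
    rw [zero_add]
  exact hd.unique (hγ 0).2.1

theorem IsKepler.velocity_eq_of_eq (hl : angularMomentum (γ 0) (γ' 0) ≠ 0) {s t : ℝ}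
    (hst : γ s = γ t) : γ' s = γ' t := by
  have hlrl : lrl (γ s) (γ' s) = lrl (γ s) (γ' t) := by rw [hγ.lrl_eq s, hst, hγ.lrl_eq t]
  have hs := hγ.angularMomentum_eq s
  have ht : angularMomentum (γ s) (γ' t) = _ := hst ▸ hγ.angularMomentum_eq t
  have hzero := congrArg (fun x : Plane => x 0) hlrl
  have hone := congrArg (fun x : Plane => x 1) hlrl
  simp only [lrl_apply_zero, lrl_apply_one, hs, ht] at hzero hone
  refine plane_ext (mul_left_cancel₀ hl ?_) (mul_left_cancel₀ hl ?_) <;> linarith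

theorem IsKepler.eq_of_eq_norm_smul (hl : angularMomentum (γ 0) (γ' 0) ≠ 0) {s t : ℝ}
    {u : Plane} (hs : γ s = ‖γ s‖ • u) (ht : γ t = ‖γ t‖ • u) : γ s = γ t := by
  have hcs := hγ.norm_mul_one_add_inner hs
  have hct := hγ.norm_mul_one_add_inner ht
  have hnorm : ‖γ s‖ = ‖γ t‖ :=
    mul_right_cancel₀ (right_ne_zero_of_mul (hct ▸ pow_ne_zero 2 hl)) (hcs.trans hct.symm)
  rw [hs, hnorm, ← ht]

theorem IsKepler.angularVelocity_eq (t : ℝ) :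
    angularVelocity (γ t) (γ' t) = angularMomentum (γ 0) (γ' 0) * ‖γ t‖⁻¹ ^ 2 := by
  rw [angularVelocity, hγ.angularMomentum_eq, inv_pow, div_eq_mul_inv]

theorem IsKepler.coe_angle_ne_of_mem_Ioo (hl : angularMomentum (γ 0) (γ' 0) ≠ 0) {T : ℝ}
    (hT : IsPeriod γ T) {φ : ℝ → ℝ} (hφ : ∀ t ∈ Icc 0 T, γ t = ‖γ t‖ • polar (φ t)) :
    ∀ t ∈ Ioo 0 T, (φ t : Real.Angle) ≠ φ 0 := by
  intro t ht hφt
  have htγ : γ t = γ 0 := hγ.eq_of_eq_norm_smul hl (hφ t (Ioo_subset_Icc_self ht))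
    (polar_eq_of_coe_angle_eq hφt ▸ hφ 0 (left_mem_Icc.mpr hT.1.1.le))
  exact ht.2.not_ge (hT.2 ⟨ht.1, hγ.periodic_of_eq hl htγ (hγ.velocity_eq_of_eq hl htγ)⟩)

theorem IsKepler.integral_angularVelocity (hl : angularMomentum (γ 0) (γ' 0) ≠ 0) {T : ℝ}
    (hT : IsPeriod γ T) :
    ∫ t in 0..T, angularVelocity (γ t) (γ' t) =
      Real.sign (angularMomentum (γ 0) (γ' 0)) * (2 * Real.pi) := by
  obtain ⟨hT0, hper⟩ := hT.1
  have hTγ : γ T = γ 0 := by simpa using hper 0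
  obtain ⟨φ, hφ, hpolar, hintg⟩ := exists_angle hT0.le (fun t _ => ⟨(hγ t).1, (hγ t).2.1⟩)
    fun t _ => (hγ t).2.2.continuousAt.continuousWithinAt
  have hφT : (φ T : Real.Angle) = φ 0 := by
    have h := hpolar T (right_mem_Icc.mpr hT0.le)
    rw [hTγ, hpolar 0 (left_mem_Icc.mpr hT0.le), norm_smul, norm_norm, norm_polar, mul_one] at h
    exact (coe_angle_eq_of_polar_eq
      (smul_right_injective Plane (norm_ne_zero_iff.mpr (hγ 0).1) h)).symm
  have hne := hγ.coe_angle_ne_of_mem_Ioo hl hT hpolar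
  have hr : ∀ t, 0 < ‖γ t‖⁻¹ ^ 2 := fun t => by
    have := norm_pos_iff.mpr (hγ t).1
    positivity
  simp only [hγ.angularVelocity_eq] at hφ
  rw [← hintg]
  have hc : ContinuousOn φ (Icc 0 T) := fun t ht => (hφ t ht).continuousAt.continuousWithinAt
  rcases lt_or_gt_of_ne hl with hneg | hpos
  · have hmono : StrictMonoOn (fun t => -φ t) (Icc 0 T) := by
      refine strictMonoOn_of_hasDerivWithinAt_pos (convex_Icc 0 T) hc.neg
        (fun t ht => (hφ t (interior_subset ht)).neg.hasDerivWithinAt) fun t _ => ?_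
      nlinarith [mul_neg_of_neg_of_pos hneg (hr t)]
    have h2π := sub_eq_two_pi_of_strictMonoOn hT0 hmono hc.neg (by simp [hφT])
      (by simpa using hne)
    rw [Real.sign_of_neg hneg]
    linarith
  · have hmono : StrictMonoOn φ (Icc 0 T) :=
      strictMonoOn_of_hasDerivWithinAt_pos (convex_Icc 0 T) hc
        (fun t ht => (hφ t (interior_subset ht)).hasDerivWithinAt) fun t _ => mul_pos hpos (hr t)
    rw [sub_eq_two_pi_of_strictMonoOn hT0 hmono hc hφT hne, Real.sign_of_pos hpos, one_mul]

end Orbit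

/-! ### The precession of a perturbed elliptic orbit -/

/-- The angular velocity of the Laplace-Runge-Lenz vector under the acceleration
`acceleration σ ε`, divided by `ε`: this quotient extends smoothly to `ε = 0`. -/
def precessionSpeed (σ ε : ℝ) (x v : Plane) : ℝ :=
  angularVelocity (lrl x v) (lrlDot x v (perturbation σ ε x v))

theorem angularVelocity_lrlDot (σ ε : ℝ) (x v : Plane) :
    angularVelocity (lrl x v) (lrlDot x v (ε • perturbation σ ε x v)) =
      ε * precessionSpeed σ ε x v := by
  rw [precessionSpeed, angularVelocity, angularVelocity, lrlDot_smul, angularMomentum_smul_right,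
    mul_div_assoc]

theorem norm_sq_eq_energy (x v : Plane) : ‖v‖ ^ 2 = 2 * ‖x‖⁻¹ + 2 * energy x v := by
  rw [energy]
  ring

theorem inner_sq_mul_norm_inv_sq {x : Plane} (hx : x ≠ 0) (v : Plane) :
    ⟪x, v⟫ ^ 2 * ‖x‖⁻¹ ^ 2 =
      2 * ‖x‖⁻¹ + 2 * energy x v - angularMomentum x v ^ 2 * ‖x‖⁻¹ ^ 2 := by
  have hr : ‖x‖ * ‖x‖⁻¹ = 1 := mul_inv_cancel₀ (norm_ne_zero_iff.mpr hx)
  rw [angularMomentum_sq, ← norm_sq_eq_energy]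
  linear_combination (‖x‖ * ‖x‖⁻¹ + 1) * ‖v‖ ^ 2 * hr

theorem precessionSpeed_zero (σ : ℝ) {x : Plane} (hx : x ≠ 0) (v : Plane) :
    precessionSpeed σ 0 x v = angularMomentum x v / (24 * ‖lrl x v‖ ^ 2) *
      ((4 + 4 * σ) * (angularMomentum x v ^ 2 * ‖x‖⁻¹ ^ 6 - ‖x‖⁻¹ ^ 5) +
        σ * (27 * angularMomentum x v ^ 2 * ‖x‖⁻¹ ^ 6 +
          24 * energy x v * angularMomentum x v ^ 2 * ‖x‖⁻¹ ^ 5 -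
          15 * angularMomentum x v ^ 4 * ‖x‖⁻¹ ^ 7)) := by
  have hr : ‖x‖ * ‖x‖⁻¹ = 1 := mul_inv_cancel₀ (norm_ne_zero_iff.mpr hx)
  have hs := inner_sq_mul_norm_inv_sq hx v
  rw [precessionSpeed, angularVelocity, perturbation_zero, leadingPerturbation_eq σ hx,
    angularMomentum_lrl_lrlDot hx, norm_sq_eq_energy x v]
  simp only [← inv_pow]
  generalize ‖x‖⁻¹ = u at hr hs ⊢
  linear_combination (angularMomentum x v / (24 * ‖lrl x v‖ ^ 2)) *
    ((-(4 + 4 * σ) * u ^ 5 + σ * (3 * (2 * u + 2 * energy x v) * u ^ 4 -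
      15 * ⟪x, v⟫ ^ 2 * u ^ 6)) * hr + σ * (15 * angularMomentum x v ^ 2 * u ^ 5 - 3 * u ^ 4) * hs)

theorem moments_eq_of_recursion {l e E : ℝ} {I : ℕ → ℝ} (hl : l ≠ 0)
    (hE : E = 1 + 2 * l ^ 2 * e)
    (hI : ∀ n : ℕ, n * l ^ 2 * I (n + 2) = (2 * n - 1) * I (n + 1) + 2 * (n - 1) * e * I n) :
    I 5 = (3 * E + 2) * I 2 / (2 * l ^ 6) ∧
      I 6 = (3 * E ^ 2 + 24 * E + 8) * I 2 / (8 * l ^ 8) ∧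
      I 7 = (15 * E ^ 2 + 40 * E + 8) * I 2 / (8 * l ^ 10) := by
  have he : e = (E - 1) / (2 * l ^ 2) := by
    rw [eq_div_iff (by positivity)]
    linear_combination -hE
  have h3 := hI 1
  have h4 := hI 2
  have h5 := hI 3
  have h6 := hI 4
  have h7 := hI 5
  norm_num at h3 h4 h5 h6 h7
  have hI3 : I 3 = I 2 / l ^ 2 := by
    rw [eq_div_iff (by positivity)]
    linear_combination h3
  have hI4 : I 4 = (E + 2) * I 2 / (2 * l ^ 4) := by
    rw [he, hI3] at h4
    field_simp at h4 ⊢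
    linear_combination h4
  have hI5 : I 5 = (3 * E + 2) * I 2 / (2 * l ^ 6) := by
    rw [he, hI3, hI4] at h5
    field_simp at h5 ⊢
    linear_combination h5 / 3
  have hI6 : I 6 = (3 * E ^ 2 + 24 * E + 8) * I 2 / (8 * l ^ 8) := by
    rw [he, hI5, hI4] at h6
    field_simp at h6 ⊢
    linear_combination h6 / 2
  refine ⟨hI5, hI6, ?_⟩
  rw [he, hI5, hI6] at h7
  field_simp at h7 ⊢
  linear_combination h7 / 20

/-- The time integral of `‖γ‖⁻ⁿ` up to time `T`. -/
def inverseMoment (γ : ℝ → Plane) (T : ℝ) (n : ℕ) : ℝ :=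
  ∫ t in 0..T, ‖γ t‖⁻¹ ^ n

section Orbit

variable {γ γ' : ℝ → Plane} (hγ : IsKepler γ γ')
include hγ

theorem IsKepler.hasDerivAt_inner_mul_norm_pow_inv (n : ℕ) (t : ℝ) :
    HasDerivAt (fun t => ⟪γ t, γ' t⟫ * (‖γ t‖ ^ n)⁻¹)
      (n * angularMomentum (γ 0) (γ' 0) ^ 2 * ‖γ t‖⁻¹ ^ (n + 2) -
        (2 * n - 1) * ‖γ t‖⁻¹ ^ (n + 1) -
        2 * (n - 1) * energy (γ 0) (γ' 0) * ‖γ t‖⁻¹ ^ n) t := by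
  obtain ⟨h0, hpos, hvel⟩ := hγ t
  have hpow := hasDerivWithinAt_norm_pow_inv n hpos.hasDerivWithinAt h0 (J := univ)
  rw [hasDerivWithinAt_univ] at hpow
  have hforce : ⟪γ t, force (γ t)⟫ = -‖γ t‖⁻¹ := by
    rw [force, inner_neg_right, inner_smul_right, real_inner_self_eq_norm_sq]
    field_simp
  refine ((hpos.inner ℝ hvel).fun_mul hpow).congr_deriv ?_
  rw [hforce, real_inner_self_eq_norm_sq, norm_sq_eq_energy (γ t), ← hγ.angularMomentum_eq t,
    ← hγ.energy_eq t, ← inv_pow, ← inv_pow]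
  linear_combination -n * ‖γ t‖⁻¹ ^ n * inner_sq_mul_norm_inv_sq h0 (γ' t)

theorem IsKepler.continuous_norm_inv_pow (n : ℕ) : Continuous fun t => ‖γ t‖⁻¹ ^ n := by
  have hc : Continuous γ := continuous_iff_continuousAt.mpr fun t => (hγ t).2.1.continuousAt
  exact (hc.norm.inv₀ fun t => norm_ne_zero_iff.mpr (hγ t).1).pow n

theorem IsKepler.mul_inverseMoment {T : ℝ} (hT : Function.Periodic γ T) (n : ℕ) :
    n * angularMomentum (γ 0) (γ' 0) ^ 2 * inverseMoment γ T (n + 2) =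
      (2 * n - 1) * inverseMoment γ T (n + 1) +
        2 * (n - 1) * energy (γ 0) (γ' 0) * inverseMoment γ T n := by
  have hi : ∀ k, IntervalIntegrable (fun t => ‖γ t‖⁻¹ ^ k) MeasureTheory.volume 0 T := fun k =>
    (hγ.continuous_norm_inv_pow k).intervalIntegrable 0 T
  have hintg := intervalIntegral.integral_eq_sub_of_hasDerivAt (a := 0) (b := T)
    (fun t _ => hγ.hasDerivAt_inner_mul_norm_pow_inv n t)
    ((((hi _).const_mul _).sub ((hi _).const_mul _)).sub ((hi _).const_mul _))
  have hTγ : γ T = γ 0 := by simpa using hT 0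
  rw [intervalIntegral.integral_sub (((hi _).const_mul _).sub ((hi _).const_mul _))
      ((hi _).const_mul _), intervalIntegral.integral_sub ((hi _).const_mul _) ((hi _).const_mul _),
    intervalIntegral.integral_const_mul, intervalIntegral.integral_const_mul,
    intervalIntegral.integral_const_mul, hTγ, hγ.velocity_eq_of_periodic hT, sub_self] at hintg
  simp only [inverseMoment]
  linear_combination hintg

theorem IsKepler.integral_precessionSpeed (σ T : ℝ) :
    ∫ t in 0..T, precessionSpeed σ 0 (γ t) (γ' t) =
      angularMomentum (γ 0) (γ' 0) / (24 * ‖lrl (γ 0) (γ' 0)‖ ^ 2) *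
        ((4 + 4 * σ) * (angularMomentum (γ 0) (γ' 0) ^ 2 * inverseMoment γ T 6 -
            inverseMoment γ T 5) +
          σ * (27 * angularMomentum (γ 0) (γ' 0) ^ 2 * inverseMoment γ T 6 +
            24 * energy (γ 0) (γ' 0) * angularMomentum (γ 0) (γ' 0) ^ 2 *
              inverseMoment γ T 5 -
            15 * angularMomentum (γ 0) (γ' 0) ^ 4 * inverseMoment γ T 7)) := by
  have hi : ∀ k, IntervalIntegrable (fun t => ‖γ t‖⁻¹ ^ k) MeasureTheory.volume 0 T := fun k =>
    (hγ.continuous_norm_inv_pow k).intervalIntegrable 0 T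
  simp only [fun t => precessionSpeed_zero σ (hγ t).1 (γ' t), hγ.angularMomentum_eq, hγ.energy_eq,
    hγ.lrl_eq]
  rw [intervalIntegral.integral_const_mul, intervalIntegral.integral_add
      ((((hi 6).const_mul _).sub (hi 5)).const_mul _)
      (((((hi 6).const_mul _).add ((hi 5).const_mul _)).sub ((hi 7).const_mul _)).const_mul _),
    intervalIntegral.integral_const_mul, intervalIntegral.integral_const_mul,
    intervalIntegral.integral_sub ((hi 6).const_mul _) (hi 5),
    intervalIntegral.integral_sub (((hi 6).const_mul _).add ((hi 5).const_mul _))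
      ((hi 7).const_mul _),
    intervalIntegral.integral_add ((hi 6).const_mul _) ((hi 5).const_mul _)]
  simp only [intervalIntegral.integral_const_mul, inverseMoment]

theorem IsKepler.integral_precessionSpeed_eq (hl : angularMomentum (γ 0) (γ' 0) ≠ 0)
    (hA : lrl (γ 0) (γ' 0) ≠ 0) {T : ℝ} (hT : IsPeriod γ T) (σ : ℝ) :
    ∫ t in 0..T, precessionSpeed σ 0 (γ t) (γ' t) =
      Real.sign (angularMomentum (γ 0) (γ' 0)) * Real.pi * (1 + σ) *
        (4 + ‖lrl (γ 0) (γ' 0)‖ ^ 2) / (8 * angularMomentum (γ 0) (γ' 0) ^ 6) := by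
  have hturn : angularMomentum (γ 0) (γ' 0) * inverseMoment γ T 2 =
      Real.sign (angularMomentum (γ 0) (γ' 0)) * (2 * Real.pi) := by
    rw [← hγ.integral_angularVelocity hl hT, inverseMoment, ← intervalIntegral.integral_const_mul]
    simp only [hγ.angularVelocity_eq]
  have _ : ‖lrl (γ 0) (γ' 0)‖ ≠ 0 := norm_ne_zero_iff.mpr hA
  have henergy := norm_lrl_sq (hγ 0).1 (γ' 0)
  obtain ⟨h5, h6, h7⟩ := moments_eq_of_recursion hl henergy (hγ.mul_inverseMoment hT.1.2)
  have he : 24 * energy (γ 0) (γ' 0) * angularMomentum (γ 0) (γ' 0) ^ 2 =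
      12 * (‖lrl (γ 0) (γ' 0)‖ ^ 2 - 1) := by linarith
  calc _ = (1 + σ) * (4 + ‖lrl (γ 0) (γ' 0)‖ ^ 2) / (16 * angularMomentum (γ 0) (γ' 0) ^ 6) *
        (angularMomentum (γ 0) (γ' 0) * inverseMoment γ T 2) := by
        rw [hγ.integral_precessionSpeed, he, h5, h6, h7]
        field_simp
        ring
    _ = _ := by
        rw [hturn]
        field_simp
        ring

end Orbit

section IntegralCurve

variable {σ T : ℝ} {s : ℝ → State}

theorem hasDerivAt_components {s' : State} {t : ℝ} (hs : HasDerivAt s s' t) :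
    HasDerivAt (fun τ => (s τ).1) s'.1 t ∧ HasDerivAt (fun τ => (s τ).2.1) s'.2.1 t ∧
      HasDerivAt (fun τ => (s τ).2.2) s'.2.2 t :=
  have hsnd : HasDerivAt (fun τ => (s τ).2) s'.2 t :=
    (ContinuousLinearMap.snd ℝ ℝ (Plane × Plane)).hasFDerivAt.comp_hasDerivAt t hs
  ⟨(ContinuousLinearMap.fst ℝ ℝ (Plane × Plane)).hasFDerivAt.comp_hasDerivAt t hs,
    (ContinuousLinearMap.fst ℝ Plane Plane).hasFDerivAt.comp_hasDerivAt t hsnd,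
    (ContinuousLinearMap.snd ℝ Plane Plane).hasFDerivAt.comp_hasDerivAt t hsnd⟩

theorem fst_eq_of_hasDerivAt_field (hs : ∀ t ∈ Icc 0 T, HasDerivAt s (field σ (s t)) t) :
    ∀ t ∈ Icc 0 T, (s t).1 = (s 0).1 :=
  have hd : ∀ t ∈ Icc 0 T, HasDerivAt (fun τ => (s τ).1) 0 t := fun t ht =>
    (hasDerivAt_components (hs t ht)).1
  constant_of_has_deriv_right_zero (fun t ht => (hd t ht).continuousAt.continuousWithinAt)
    fun t ht => (hd t (Ico_subset_Icc_self ht)).hasDerivWithinAt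

theorem isMotion_of_hasDerivAt_field {h : ℝ}
    (hs : ∀ t ∈ Icc 0 T, s t ∈ regular σ ∧ HasDerivAt s (field σ (s t)) t) (h0 : (s 0).1 = h ^ 2) :
    IsMotion (modLagrangian σ h) (Icc 0 T) (fun t => (s t).2.1) (fun t => (s t).2.2) := by
  have hε : ∀ t ∈ Icc 0 T, (s t).1 = h ^ 2 := fun t ht =>
    (fst_eq_of_hasDerivAt_field (fun t ht => (hs t ht).2) t ht).trans h0
  refine isMotion_of_hasDerivWithinAt (fun t ht => (hs t ht).1.1)
    (fun t ht => hε t ht ▸ (hs t ht).1.2.1)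
    (fun t ht => (hasDerivAt_components (hs t ht).2).2.1.hasDerivWithinAt) fun t ht => ?_
  rw [← hε t ht]
  exact (hasDerivAt_components (hs t ht).2).2.2.hasDerivWithinAt

theorem contDiffOn_lrlDot_perturbation (σ : ℝ) :
    ContDiffOn ℝ ∞ (fun s : State => lrlDot s.2.1 s.2.2 (perturbation σ s.1 s.2.1 s.2.2))
      (regular σ) := by
  have hx := contDiff_position.contDiffOn (s := regular σ)
  have hv := contDiff_velocity.contDiffOn (s := regular σ)
  have ha := contDiffOn_perturbation σ
  exact (((contDiffOn_const.mul (hv.inner ℝ ha)).smul hx).sub ((hx.inner ℝ ha).smul hv)).sub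
    ((hx.inner ℝ hv).smul ha)

theorem contDiffOn_precessionSpeed (σ : ℝ) :
    ContDiffOn ℝ ∞ (fun s : State => precessionSpeed σ s.1 s.2.1 s.2.2) (regular σ) := by
  have hlrl : ContDiffOn ℝ ∞ (fun s : State => lrl s.2.1 s.2.2) (regular σ) := fun s hs =>
    (contDiffAt_lrl contDiff_position.contDiffAt contDiff_velocity.contDiffAt
      hs.1).contDiffWithinAt
  have hcoord : ∀ {f : State → Plane}, ContDiffOn ℝ ∞ f (regular σ) →
      ∀ i, ContDiffOn ℝ ∞ (fun s => f s i) (regular σ) := fun hf i =>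
    (EuclideanSpace.proj (𝕜 := ℝ) i).contDiff.comp_contDiffOn hf
  have hdot := contDiffOn_lrlDot_perturbation σ
  exact (((hcoord hlrl 0).mul (hcoord hdot 1)).sub ((hcoord hdot 0).mul (hcoord hlrl 1))).div
    (hlrl.norm_sq ℝ) fun s hs => pow_ne_zero 2 (norm_ne_zero_iff.mpr hs.2.2)

theorem hasAngleChange_lrl (hT : 0 ≤ T)
    (hs : ∀ t ∈ Icc 0 T, s t ∈ regular σ ∧ HasDerivAt s (field σ (s t)) t) :
    HasAngleChange (fun t => lrl (s t).2.1 (s t).2.2) T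
      ((s 0).1 * ∫ t in 0..T, precessionSpeed σ (s t).1 (s t).2.1 (s t).2.2) := by
  set Z' : ℝ → Plane := fun t =>
    lrlDot (s t).2.1 (s t).2.2 ((s t).1 • perturbation σ (s t).1 (s t).2.1 (s t).2.2) with hZ'
  have hsc : ContinuousOn s (Icc 0 T) := fun t ht => (hs t ht).2.continuousAt.continuousWithinAt
  have hZ'c : ContinuousOn Z' (Icc 0 T) := by
    simp only [hZ', lrlDot_smul]
    exact hsc.fst.smul ((contDiffOn_lrlDot_perturbation σ).continuousOn.comp hsc
      fun t ht => (hs t ht).1)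
  have hangle := hasAngleChange_integral hT (fun t ht => ⟨(hs t ht).1.2.2,
    hasDerivAt_lrl (hs t ht).1.1 (hasDerivAt_components (hs t ht).2).2.1
      (hasDerivAt_components (hs t ht).2).2.2⟩) hZ'c
  convert hangle using 1
  rw [← intervalIntegral.integral_const_mul]
  refine intervalIntegral.integral_congr fun t ht => ?_
  rw [uIcc_of_le hT] at ht
  rw [angularVelocity_lrlDot, fst_eq_of_hasDerivAt_field (fun t ht => (hs t ht).2) t ht]

end IntegralCurve

theorem precession_of_isFlowAlong {σ T : ℝ} (hT : 0 < T) {K : Set State} (hKU : K ⊆ regular σ)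
    {δ A : ℝ} {Φ : State → ℝ → State} {c : ℝ → State} (hΦ : IsFlowAlong (field σ) c T K δ A Φ)
    {h : ℝ} {y w : Plane} (hs : A * dist (h ^ 2, y, w) (c 0) ≤ δ) :
    (∃ X V, IsMotion (modLagrangian σ h) (Icc 0 T) X V ∧ X 0 = y ∧ V 0 = w) ∧
      ∀ X V, IsMotion (modLagrangian σ h) (Icc 0 T) X V → X 0 = y → V 0 = w →
        HasAngleChange (fun t => lrl (X t) (V t)) T (h ^ 2 * ∫ t in 0..T,
          precessionSpeed σ (Φ (h ^ 2, y, w) t).1 (Φ (h ^ 2, y, w) t).2.1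
            (Φ (h ^ 2, y, w) t).2.2) := by
  set s : ℝ → State := Φ (h ^ 2, y, w)
  have hs0 : s 0 = (h ^ 2, y, w) := hΦ.apply_zero _
  have hfield : ∀ t ∈ Icc 0 T, s t ∈ regular σ ∧ HasDerivAt s (field σ (s t)) t :=
    fun t ht => ⟨hKU (hΦ.mem hs ht), hΦ.hasDerivAt _ hs t ht⟩
  refine ⟨⟨_, _, isMotion_of_hasDerivAt_field hfield (by rw [hs0]), by rw [hs0], by rw [hs0]⟩, ?_⟩
  rintro X V hm rfl rfl
  obtain ⟨θ, hθ, hΔ, hlrl⟩ := hasAngleChange_lrl hT.le hfield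
  refine ⟨θ, hθ, by rw [hΔ, hs0], fun t ht => ?_⟩
  simpa only [hm.eqOn_integralCurve hT hfield hs0 t ht] using hlrl t ht

theorem norm_integral_comp_sub_le {S F : Type*} [SeminormedAddCommGroup S] [NormedAddCommGroup F]
    [NormedSpace ℝ F] {g : S → F} {K : Set S} {s c : ℝ → S} {C r T : ℝ} (hT : 0 ≤ T)
    (hg : ContinuousOn g K) (hgC : ∀ x ∈ K, ∀ y ∈ K, ‖g x - g y‖ ≤ C * ‖x - y‖) (hC : 0 ≤ C)
    (hs : ∀ t ∈ Icc 0 T, s t ∈ K ∧ ContinuousWithinAt s (Icc 0 T) t)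
    (hc : ∀ t ∈ Icc 0 T, c t ∈ K ∧ ContinuousWithinAt c (Icc 0 T) t)
    (hsc : ∀ t ∈ Icc 0 T, dist (s t) (c t) ≤ r) :
    ‖(∫ t in 0..T, g (s t)) - ∫ t in 0..T, g (c t)‖ ≤ C * r * T := by
  have hintg : ∀ {f : ℝ → S}, (∀ t ∈ Icc 0 T, f t ∈ K ∧ ContinuousWithinAt f (Icc 0 T) t) →
      IntervalIntegrable (fun t => g (f t)) MeasureTheory.volume 0 T := fun hf =>
    (hg.comp (fun t ht => (hf t ht).2) fun t ht => (hf t ht).1).intervalIntegrable_of_Icc hT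
  rw [← intervalIntegral.integral_sub (hintg hs) (hintg hc)]
  have hle := intervalIntegral.norm_integral_le_of_norm_le_const (a := 0) (b := T) (C := C * r)
    (f := fun t => g (s t) - g (c t)) fun t ht => by
      rw [uIoc_of_le hT] at ht
      have ht' := Ioc_subset_Icc_self ht
      refine (hgC _ (hs t ht').1 _ (hc t ht').1).trans ?_
      rw [← dist_eq_norm]
      exact mul_le_mul_of_nonneg_left (hsc t ht') hC
  rwa [sub_zero, abs_of_nonneg hT] at hle

section Orbit

variable {γ γ' : ℝ → Plane}

theorem dist_state_le {κ h : ℝ} (hκ : 0 < κ) {y w : Plane} (hy : ‖y - γ 0‖ ≤ κ * h ^ 2)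
    (hw : ‖w - γ' 0‖ ≤ κ * h ^ 2) :
    dist ((h ^ 2, y, w) : State) (0, γ 0, γ' 0) ≤ (κ + 1) * h ^ 2 := by
  rw [Prod.dist_eq, Prod.dist_eq, dist_zero_right, dist_eq_norm, dist_eq_norm,
    Real.norm_of_nonneg (sq_nonneg h)]
  have hκh : 0 ≤ κ * h ^ 2 := by positivity
  refine max_le ?_ (max_le ?_ ?_) <;> nlinarith [sq_nonneg h]

variable (hγ : IsKepler γ γ')
include hγ

theorem IsKepler.exists_isFlowAlong (hA : lrl (γ 0) (γ' 0) ≠ 0) {T : ℝ} (hT : 0 ≤ T) (σ : ℝ) :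
    ∃ K ⊆ regular σ, IsCompact K ∧ ∃ δ > 0, ∃ A ≥ 1, ∃ Φ : State → ℝ → State,
      IsFlowAlong (field σ) (fun t => (0, γ t, γ' t)) T K δ A Φ := by
  refine Kepler.exists_isFlowAlong (isOpen_regular σ) (contDiffOn_field σ) hT fun t _ =>
    ⟨⟨(hγ t).1, by simp [mass_zero], by simpa [hγ.lrl_eq t] using hA⟩, ?_⟩
  simp only [field, acceleration_zero]
  exact (hasDerivAt_const t (0 : ℝ)).prodMk ((hγ t).2.1.prodMk (hγ t).2.2)

theorem IsKepler.hasPrecessionRate (hl : angularMomentum (γ 0) (γ' 0) ≠ 0)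
    (hA : lrl (γ 0) (γ' 0) ≠ 0) {T : ℝ} (hT : IsPeriod γ T) (σ : ℝ) :
    HasPrecessionRate (modLagrangian σ) γ γ' T
      (Real.sign (angularMomentum (γ 0) (γ' 0)) * Real.pi * (1 + σ) *
        (4 + ‖lrl (γ 0) (γ' 0)‖ ^ 2) / (8 * angularMomentum (γ 0) (γ' 0) ^ 6)) := by
  rw [← hγ.integral_precessionSpeed_eq hl hA hT σ]
  have hT0 : 0 < T := hT.1.1
  obtain ⟨K, hKU, hK, δ, hδ, A, hA1, Φ, hΦ⟩ := hγ.exists_isFlowAlong hA hT0.le σ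
  have hspeed := contDiffOn_precessionSpeed σ
  obtain ⟨C, hC, hCK⟩ := exists_norm_sub_le_of_isCompact (isOpen_regular σ) hK hKU
    (hspeed.of_le (by simp))
  intro κ hκ
  have hB : 0 < A * (κ + 1) := by positivity
  refine ⟨C * (A * (κ + 1)) * T, by positivity, min 1 (δ / (A * (κ + 1))), by positivity,
    fun h hh y w hy hw => ?_⟩
  have hh1 : h ^ 2 ≤ h := by nlinarith [hh.1, hh.2, min_le_left 1 (δ / (A * (κ + 1)))]
  have hdist : A * dist (h ^ 2, y, w) (0, γ 0, γ' 0) ≤ A * (κ + 1) * h ^ 2 := by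
    rw [mul_assoc]
    exact mul_le_mul_of_nonneg_left (dist_state_le hκ hy hw) (by positivity)
  have hBδ : A * (κ + 1) * h ^ 2 ≤ δ := by
    rw [mul_comm, ← le_div_iff₀ hB]
    exact hh1.trans (hh.2.le.trans (min_le_right _ _))
  obtain ⟨hexists, hangle⟩ := precession_of_isFlowAlong hT0 hKU hΦ (hdist.trans hBδ)
  refine ⟨hexists, fun X V hm hX hV => ⟨_, hangle X V hm hX hV, ?_⟩⟩
  have hintg := norm_integral_comp_sub_le hT0.le (hspeed.continuousOn.mono hKU) hCK hC.le
    (fun t ht => ⟨hΦ.mem (hdist.trans hBδ) ht,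
      (hΦ.hasDerivAt _ (hdist.trans hBδ) t ht).continuousAt.continuousWithinAt⟩)
    (fun t ht => ⟨hΦ.mem_of_dist_le t ht _ (by simp [hδ.le]), (continuousWithinAt_const.prodMk
      ((hγ t).2.1.continuousAt.prodMk (hγ t).2.2.continuousAt).continuousWithinAt)⟩)
    (fun t ht => (hΦ.dist_curve_le _ t ht).trans hdist)
  rw [mul_comm, ← sub_mul, abs_mul, abs_of_nonneg (sq_nonneg h)]
  calc _ ≤ C * (A * (κ + 1) * h ^ 2) * T * h ^ 2 :=
        mul_le_mul_of_nonneg_right hintg (sq_nonneg h)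
    _ = _ := by ring

end Orbit

/-! ### Discrete trajectories -/

section DiscreteGronwall

/-- The constant by which a two-step recursion with Lipschitz constant `Λ` amplifies residuals up
to time `T`. -/
def stabilityFactor (Λ T : ℝ) : ℝ := (1 + 2 * T) * Real.exp ((1 + 8 * Λ) * T)

theorem one_le_stabilityFactor {Λ T : ℝ} (hΛ : 0 ≤ Λ) (hT : 0 ≤ T) : 1 ≤ stabilityFactor Λ T :=
  one_le_mul_of_one_le_of_one_le (by linarith) (Real.one_le_exp (by positivity))

theorem stabilityFactor_le_stabilityFactor {Λ T T' : ℝ} (hΛ : 0 ≤ Λ) (hT' : 0 ≤ T')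
    (hTT' : T' ≤ T) : stabilityFactor Λ T' ≤ stabilityFactor Λ T := by
  rw [stabilityFactor, stabilityFactor]
  gcongr
  linarith

theorem mul_stabilityFactor_add_le {Λ t h : ℝ} (hΛ : 0 ≤ Λ) (ht : 0 ≤ t) (hh : 0 ≤ h) :
    (1 + (1 + 8 * Λ) * h) * stabilityFactor Λ t + 2 * h ≤ stabilityFactor Λ (t + h) := by
  have hfactor : 0 ≤ stabilityFactor Λ t := zero_le_one.trans (one_le_stabilityFactor hΛ ht)
  have hexp : 1 + (1 + 8 * Λ) * h ≤ Real.exp ((1 + 8 * Λ) * h) := by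
    linarith [Real.add_one_le_exp ((1 + 8 * Λ) * h)]
  have hexp' : 1 ≤ Real.exp ((1 + 8 * Λ) * (t + h)) := Real.one_le_exp (by positivity)
  calc _ ≤ Real.exp ((1 + 8 * Λ) * h) * stabilityFactor Λ t +
        2 * h * Real.exp ((1 + 8 * Λ) * (t + h)) :=
      add_le_add (mul_le_mul_of_nonneg_right hexp hfactor)
        (le_mul_of_one_le_right (by positivity) hexp')
    _ = _ := by
      simp only [stabilityFactor, mul_add _ t, Real.exp_add]
      ring

/-- Here `u₀, u₁, u₂` are consecutive errors and `w`, `w'` their difference quotients. -/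
theorem add_le_of_two_step {h Λ δ u₀ u₁ u₂ w w' : ℝ} (h0 : 0 < h) (h1 : h ≤ 1) (hΛ0 : 0 ≤ Λ)
    (hΛ : h ^ 2 * Λ ≤ 1 / 2) (hδ : 0 ≤ δ) (hu : 0 ≤ u₀) (hw : 0 ≤ w)
    (hu₁ : u₁ ≤ u₀ + h * w) (hu₂ : u₂ ≤ u₁ + h * w')
    (hw' : w' ≤ w + h * (Λ * (u₀ + u₁ + u₂) + δ)) :
    u₁ + w' ≤ (1 + (1 + 8 * Λ) * h) * (u₀ + w) + 2 * (h * δ) := by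
  have hhw : h * w ≤ w := mul_le_of_le_one_left hw h1
  have himplicit : w' ≤ w + 3 * (h * Λ * (u₀ + w)) + h * δ + h ^ 2 * Λ * w' := by
    have := mul_le_mul_of_nonneg_left (show u₀ + u₁ + u₂ ≤ 3 * (u₀ + w) + h * w' by linarith)
      (mul_nonneg h0.le hΛ0)
    linarith
  set r := 3 * (h * Λ * (u₀ + w)) + h * δ
  have hr0 : 0 ≤ r := by positivity
  have hexplicit : w' ≤ w + r + h ^ 2 * Λ * (2 * (w + r)) := by
    have hz : 0 ≤ h ^ 2 * Λ := by positivity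
    have hw'2 : w' ≤ 2 * (w + r) := by
      by_contra! hlt
      nlinarith
    linarith [mul_le_mul_of_nonneg_left hw'2 hz]
  have hzw : h ^ 2 * Λ * w ≤ h * Λ * (u₀ + w) := by
    have := mul_le_mul_of_nonneg_left (show h * w ≤ u₀ + w by linarith) (mul_nonneg h0.le hΛ0)
    linarith
  have hzr : h ^ 2 * Λ * (2 * r) ≤ r := by linarith [mul_le_mul_of_nonneg_right hΛ hr0]
  nlinarith [mul_nonneg h0.le hu]

variable {E : Type*} [NormedAddCommGroup E] [NormedSpace ℝ E]

theorem norm_add_norm_div_le_of_second_difference_le {e : ℕ → E} {h Λ δ : ℝ} (h0 : 0 < h)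
    (h1 : h ≤ 1) (hΛ0 : 0 ≤ Λ) (hΛ : h ^ 2 * Λ ≤ 1 / 2) (hδ : 0 ≤ δ) {k : ℕ}
    (he : ‖e (k + 2) - (2 : ℝ) • e (k + 1) + e k‖ ≤
      h ^ 2 * (Λ * (‖e k‖ + ‖e (k + 1)‖ + ‖e (k + 2)‖) + δ)) :
    ‖e (k + 1)‖ + ‖e (k + 2) - e (k + 1)‖ / h ≤
      (1 + (1 + 8 * Λ) * h) * (‖e k‖ + ‖e (k + 1) - e k‖ / h) + 2 * (h * δ) := by
  have hnorm : ∀ j, ‖e (j + 1)‖ ≤ ‖e j‖ + h * (‖e (j + 1) - e j‖ / h) := fun j => by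
    rw [mul_div_cancel₀ _ h0.ne']
    simpa using norm_add_le (e j) (e (j + 1) - e j)
  refine add_le_of_two_step h0 h1 hΛ0 hΛ hδ (norm_nonneg _) (by positivity) (hnorm k)
    (hnorm (k + 1)) ?_
  have hsplit : e (k + 2) - e (k + 1) =
      (e (k + 1) - e k) + (e (k + 2) - (2 : ℝ) • e (k + 1) + e k) := by module
  rw [div_add' _ _ _ h0.ne', div_le_div_iff_of_pos_right h0, hsplit]
  linarith [norm_add_le (e (k + 1) - e k) (e (k + 2) - (2 : ℝ) • e (k + 1) + e k)]

/-- The restriction of the recursive estimate to errors of size at most `ρ` makes this applicable to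
recursions that are Lipschitz continuous only near a reference trajectory. -/
theorem norm_le_of_second_difference_le {e : ℕ → E} {h Λ δ ρ T : ℝ} (h0 : 0 < h) (h1 : h ≤ 1)
    (hΛ0 : 0 ≤ Λ) (hΛ : h ^ 2 * Λ ≤ 1 / 2) (hδ : 0 ≤ δ) (hρ : stabilityFactor Λ T * δ ≤ ρ)
    (he0 : e 0 = 0) (he1 : ‖e 1‖ ≤ h * δ)
    (he : ∀ k : ℕ, (k + 2) * h ≤ T → ‖e k‖ ≤ ρ → ‖e (k + 1)‖ ≤ ρ →
      ‖e (k + 2) - (2 : ℝ) • e (k + 1) + e k‖ ≤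
        h ^ 2 * (Λ * (‖e k‖ + ‖e (k + 1)‖ + ‖e (k + 2)‖) + δ)) {k : ℕ} (hk : k * h ≤ T) :
    ‖e k‖ ≤ stabilityFactor Λ T * δ := by
  set S : ℕ → ℝ := fun k => ‖e k‖ + ‖e (k + 1) - e k‖ / h with hS
  have heS : ∀ k, ‖e k‖ ≤ S k := fun k => le_add_of_nonneg_right (by positivity)
  have heS' : ∀ k, ‖e (k + 1)‖ ≤ S k := fun k => by
    have := le_div_self (norm_nonneg (e (k + 1) - e k)) h0 h1
    have := norm_add_le (e k) (e (k + 1) - e k)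
    rw [add_sub_cancel] at this
    linarith
  have hfactor : ∀ k : ℕ, k * h ≤ T → stabilityFactor Λ (k * h) * δ ≤ stabilityFactor Λ T * δ :=
    fun k hk => mul_le_mul_of_nonneg_right
      (stabilityFactor_le_stabilityFactor hΛ0 (by positivity) hk) hδ
  have hSk : ∀ k : ℕ, (k + 1) * h ≤ T → S k ≤ stabilityFactor Λ (k * h) * δ := by
    intro k
    induction k with
    | zero => simpa [hS, he0, stabilityFactor, div_le_iff₀ h0, mul_comm] using fun _ => he1
    | succ k ih =>
      intro hk
      push_cast at hk
      have hSρ := (ih (by linarith)).trans ((hfactor k (by linarith)).trans hρ)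
      have hstep := norm_add_norm_div_le_of_second_difference_le h0 h1 hΛ0 hΛ hδ
        (he k (by linarith) ((heS k).trans hSρ) ((heS' k).trans hSρ))
      have hgrowth := mul_le_mul_of_nonneg_right
        (mul_stabilityFactor_add_le hΛ0 (by positivity : 0 ≤ k * h) h0.le) hδ
      rw [Nat.cast_succ, add_mul (k : ℝ), one_mul]
      have := mul_le_mul_of_nonneg_left (ih (by linarith))
        (by positivity : 0 ≤ 1 + (1 + 8 * Λ) * h)
      linarith
  rcases k with _ | k
  · rw [he0, norm_zero]
    exact mul_nonneg (zero_le_one.trans (one_le_stabilityFactor hΛ0 (by simpa using hk))) hδ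
  · push_cast at hk
    exact (heS' k).trans ((hSk k hk).trans (hfactor k (by linarith)))

end DiscreteGronwall

section Method

/-- Consecutive positions that stay away from the origin and obey the step size restriction of
`IsNumericalSolution`. -/
def Admissible (ρ : ℝ) (xm x xp : Plane) : Prop :=
  ρ ≤ ‖xm‖ ∧ ρ ≤ ‖x‖ ∧ ‖x - xm‖ ≤ ‖xm‖ / 2 ∧ ‖xp - x‖ ≤ ‖x‖ / 2

/-- The right hand side `Φ` of a method is bounded and Lipschitz continuous on admissible positions,
with the same constant `Λ` for both bounds. -/
structure IsBoundedMethod (Φ : Plane → Plane → Plane → Plane) (ρ Λ : ℝ) : Prop where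
  nonneg : 0 ≤ Λ
  norm_le : ∀ {xm x xp}, Admissible ρ xm x xp → ‖Φ xm x xp‖ ≤ Λ
  norm_sub_le : ∀ {xm x xp ym y yp}, Admissible ρ xm x xp → Admissible ρ ym y yp →
    ‖Φ xm x xp - Φ ym y yp‖ ≤ Λ * (‖xm - ym‖ + ‖x - y‖ + ‖xp - yp‖)

/-- `xp` is an admissible continuation of `xm, x` by the method `Φ` with step size `h`. -/
def IsStep (Φ : Plane → Plane → Plane → Plane) (h : ℝ) (xm x xp : Plane) : Prop :=
  xp - (2 : ℝ) • x + xm = h ^ 2 • Φ xm x xp ∧ ‖xp - x‖ ≤ ‖x‖ / 2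

/-- `X` solves the difference equation of the method `Φ` up to residuals `h² δ`, has small steps,
and stays at distance at least `2ρ` from the origin, so that positions within `ρ` of it are
admissible. -/
structure IsApproxSolution (Φ : Plane → Plane → Plane → Plane) (h T ρ δ : ℝ) (X : ℕ → Plane) :
    Prop where
  le_norm : ∀ k : ℕ, k * h ≤ T → 2 * ρ ≤ ‖X k‖
  step_le : ∀ k : ℕ, (k + 1) * h ≤ T → ‖X (k + 1) - X k‖ ≤ ρ / 8
  residual_le : ∀ k : ℕ, (k + 2) * h ≤ T → ‖X (k + 2) - (2 : ℝ) • X (k + 1) + X k -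
    h ^ 2 • Φ (X k) (X (k + 1)) (X (k + 2))‖ ≤ h ^ 2 * δ

theorem norm_force_le {ρ : ℝ} (hρ : 0 < ρ) {x : Plane} (hx : ρ ≤ ‖x‖) :
    ‖force x‖ ≤ (ρ ^ 2)⁻¹ := by
  have hx0 : 0 < ‖x‖ := hρ.trans_le hx
  have hforce : ‖force x‖ = (‖x‖ ^ 2)⁻¹ := by
    rw [force, norm_neg, norm_smul, Real.norm_of_nonneg (by positivity)]
    field_simp
  rw [hforce]
  gcongr

theorem isBoundedMethod_verletForce {ρ : ℝ} (hρ : 0 < ρ) :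
    IsBoundedMethod verletForce ρ (4 / ρ ^ 3 + (ρ ^ 2)⁻¹) where
  nonneg := by positivity
  norm_le h := (norm_force_le hρ h.2.1).trans (le_add_of_nonneg_left (by positivity))
  norm_sub_le {xm x xp ym y yp} hx hy := by
    refine (norm_force_sub_le hρ hx.2.1 hy.2.1).trans ?_
    gcongr
    · exact le_add_of_nonneg_right (by positivity)
    · linarith [norm_nonneg (xm - ym), norm_nonneg (xp - yp)]

theorem half_le_norm_midpoint {ρ : ℝ} {x y : Plane} (hx : ρ ≤ ‖x‖) (h : ‖y - x‖ ≤ ‖x‖ / 2) :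
    ρ / 2 ≤ ‖(1 / 2 : ℝ) • (x + y)‖ := by
  have hsplit : x = (1 / 2 : ℝ) • (x + y) - (1 / 2 : ℝ) • (y - x) := by module
  have htri := norm_sub_le ((1 / 2 : ℝ) • (x + y)) ((1 / 2 : ℝ) • (y - x))
  rw [← hsplit, norm_smul (1 / 2 : ℝ) (y - x), Real.norm_of_nonneg (by norm_num)] at htri
  linarith [norm_nonneg x]

theorem norm_midpoint_sub_le (p q p' q' : Plane) :
    ‖(1 / 2 : ℝ) • (p + q) - (1 / 2 : ℝ) • (p' + q')‖ ≤ 1 / 2 * (‖p - p'‖ + ‖q - q'‖) := by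
  rw [← smul_sub, add_sub_add_comm, norm_smul, Real.norm_of_nonneg (by norm_num)]
  gcongr
  exact norm_add_le _ _

theorem norm_force_midpoint_sub_le {ρ : ℝ} (hρ : 0 < ρ) {p q p' q' : Plane} (hp : ρ ≤ ‖p‖)
    (hq : ‖q - p‖ ≤ ‖p‖ / 2) (hp' : ρ ≤ ‖p'‖) (hq' : ‖q' - p'‖ ≤ ‖p'‖ / 2) :
    ‖force ((1 / 2 : ℝ) • (p + q)) - force ((1 / 2 : ℝ) • (p' + q'))‖ ≤
      4 / (ρ / 2) ^ 3 * (1 / 2 * (‖p - p'‖ + ‖q - q'‖)) :=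
  (norm_force_sub_le (by positivity) (half_le_norm_midpoint hp hq)
    (half_le_norm_midpoint hp' hq')).trans
      (mul_le_mul_of_nonneg_left (norm_midpoint_sub_le p q p' q') (by positivity))

theorem isBoundedMethod_midpointForce {ρ : ℝ} (hρ : 0 < ρ) :
    IsBoundedMethod midpointForce ρ (4 / (ρ / 2) ^ 3 + ((ρ / 2) ^ 2)⁻¹) where
  nonneg := by positivity
  norm_le := fun ⟨hxm, hx, hd, hd'⟩ => by
    refine (norm_add_le _ _).trans ?_
    rw [norm_smul, norm_smul, Real.norm_of_nonneg (by norm_num)]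
    have := norm_force_le (by positivity) (half_le_norm_midpoint hxm hd)
    have := norm_force_le (by positivity) (half_le_norm_midpoint hx hd')
    have : 0 ≤ 4 / (ρ / 2) ^ 3 := by positivity
    linarith
  norm_sub_le {xm x xp ym y yp} := fun ⟨hxm, hx, hd, hd'⟩ ⟨hym, hy, he, he'⟩ => by
    have hnext := norm_force_midpoint_sub_le hρ hx hd' hy he'
    have hprev := norm_force_midpoint_sub_le hρ hxm hd hym he
    rw [midpointForce, midpointForce, add_sub_add_comm, ← smul_sub, ← smul_sub]
    refine (norm_add_le _ _).trans ?_
    rw [norm_smul, norm_smul, Real.norm_of_nonneg (by norm_num)]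
    have hL : 0 ≤ 4 / (ρ / 2) ^ 3 := by positivity
    have hM : 0 ≤ ((ρ / 2) ^ 2)⁻¹ * (‖xm - ym‖ + ‖x - y‖ + ‖xp - yp‖) := by positivity
    nlinarith [mul_nonneg hL (norm_nonneg (xm - ym)), mul_nonneg hL (norm_nonneg (x - y)),
      mul_nonneg hL (norm_nonneg (xp - yp))]

end Method

section Stability

variable {Φ : Plane → Plane → Plane → Plane} {h T ρ δ Λ : ℝ} {X x : ℕ → Plane}

theorem le_norm_of_norm_sub_le {p q : Plane} (hp : 2 * ρ ≤ ‖p‖) (hpq : ‖q - p‖ ≤ ρ) :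
    ρ ≤ ‖q‖ := by
  have := norm_sub_norm_le p q
  rw [norm_sub_rev] at this
  linarith

theorem IsNumericalSolution.isStep (hx : IsNumericalSolution Φ h T x) (h0 : 0 < h) {k : ℕ}
    (hk : (k + 2) * h ≤ T) : IsStep Φ h (x k) (x (k + 1)) (x (k + 2)) := by
  refine ⟨?_, hx.2 (k + 1) (by push_cast; linarith)⟩
  rw [← hx.1 k hk, smul_smul, mul_inv_cancel₀ (by positivity), one_smul]

theorem isNumericalSolution_of_isStep (h0 : 0 < h) (h01 : h ≤ T → ‖x 1 - x 0‖ ≤ ‖x 0‖ / 2)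
    (hx : ∀ k : ℕ, (k + 2) * h ≤ T → IsStep Φ h (x k) (x (k + 1)) (x (k + 2))) :
    IsNumericalSolution Φ h T x := by
  refine ⟨fun k hk => ?_, fun k hk => ?_⟩
  · rw [(hx k hk).1, smul_smul, inv_mul_cancel₀ (by positivity), one_smul]
  · rcases k with _ | k
    · exact h01 (by simpa using hk)
    · exact (hx k (by push_cast at hk; linarith)).2

theorem IsApproxSolution.admissible (hX : IsApproxSolution Φ h T ρ δ X) (hρ : 0 < ρ) (h0 : 0 < h)
    {k : ℕ} (hk : (k + 2) * h ≤ T) : Admissible ρ (X k) (X (k + 1)) (X (k + 2)) := by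
  have hk0 := hX.le_norm k (by linarith)
  have hk1 := hX.le_norm (k + 1) (by push_cast; linarith)
  have hstep := hX.step_le k (by linarith)
  have hstep' := hX.step_le (k + 1) (by push_cast; linarith)
  exact ⟨by linarith, by linarith, by linarith, by linarith⟩

theorem IsApproxSolution.norm_sub_le (hX : IsApproxSolution Φ h T ρ δ X)
    (hΦ : IsBoundedMethod Φ ρ Λ) (hρ : 0 < ρ) (h0 : 0 < h) (h1 : h ≤ 1) (hΛ : h ^ 2 * Λ ≤ 1 / 2)
    (hδ : 0 ≤ δ) (hδρ : stabilityFactor Λ T * δ ≤ ρ) (hx : IsNumericalSolution Φ h T x)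
    (hx0 : x 0 = X 0) (hx1 : ‖x 1 - X 1‖ ≤ h * δ) {k : ℕ} (hk : k * h ≤ T) :
    ‖x k - X k‖ ≤ stabilityFactor Λ T * δ := by
  refine norm_le_of_second_difference_le (e := fun k => x k - X k) h0 h1 hΦ.nonneg hΛ hδ hδρ
    (sub_eq_zero.mpr hx0) hx1 (fun j hj hj0 hj1 => ?_) hk
  have hadm : Admissible ρ (x j) (x (j + 1)) (x (j + 2)) :=
    ⟨le_norm_of_norm_sub_le (hX.le_norm j (by linarith)) hj0,
      le_norm_of_norm_sub_le (hX.le_norm (j + 1) (by push_cast; linarith)) hj1,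
      hx.2 j (by linarith), hx.2 (j + 1) (by push_cast; linarith)⟩
  have hlip := hΦ.norm_sub_le hadm (hX.admissible hρ h0 hj)
  have hsplit : x (j + 2) - X (j + 2) - (2 : ℝ) • (x (j + 1) - X (j + 1)) + (x j - X j) =
      h ^ 2 • (Φ (x j) (x (j + 1)) (x (j + 2)) - Φ (X j) (X (j + 1)) (X (j + 2))) -
        (X (j + 2) - (2 : ℝ) • X (j + 1) + X j - h ^ 2 • Φ (X j) (X (j + 1)) (X (j + 2))) := by
    rw [smul_sub (h ^ 2), ← (hx.isStep h0 hj).1]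
    module
  rw [hsplit, mul_add]
  refine (_root_.norm_sub_le _ _).trans (add_le_add ?_ (hX.residual_le j hj))
  rw [norm_smul, Real.norm_of_nonneg (sq_nonneg h)]
  exact mul_le_mul_of_nonneg_left hlip (sq_nonneg h)

theorem exists_isStep (hΦ : IsBoundedMethod Φ ρ Λ) (hΛ : h ^ 2 * Λ ≤ 1 / 2)
    (hΛρ : h ^ 2 * Λ ≤ ρ / 4) {xm x : Plane} (hxm : ρ ≤ ‖xm‖) (hx : ρ ≤ ‖x‖)
    (hd : ‖x - xm‖ ≤ ‖xm‖ / 2) (hd' : ‖x - xm‖ ≤ ‖x‖ / 4) : ∃ xp, IsStep Φ h xm x xp := by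
  set B := closedBall x (‖x‖ / 2) with hB
  set g : Plane → Plane := fun p => (2 : ℝ) • x - xm + h ^ 2 • Φ xm x p with hg
  have hadm : ∀ p ∈ B, Admissible ρ xm x p := fun p hp =>
    ⟨hxm, hx, hd, mem_closedBall_iff_norm.mp hp⟩
  have hmaps : MapsTo g B B := by
    intro p hp
    have hsplit : g p - x = (x - xm) + h ^ 2 • Φ xm x p := by simp only [hg]; module
    rw [hB, mem_closedBall_iff_norm, hsplit]
    refine (norm_add_le _ _).trans ?_
    rw [norm_smul, Real.norm_of_nonneg (sq_nonneg h)]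
    linarith [mul_le_mul_of_nonneg_left (hΦ.norm_le (hadm p hp)) (sq_nonneg h)]
  have hcontr : ContractingWith (1 / 2) (hmaps.restrict g B B) := by
    refine ⟨by norm_num, LipschitzWith.of_dist_le_mul fun p q => ?_⟩
    rw [Subtype.dist_eq, Subtype.dist_eq, dist_eq_norm, dist_eq_norm, MapsTo.val_restrict_apply,
      MapsTo.val_restrict_apply]
    have hsplit : g p - g q = h ^ 2 • (Φ xm x p - Φ xm x q) := by simp only [hg]; module
    have hlip := hΦ.norm_sub_le (hadm p p.2) (hadm q q.2)
    rw [sub_self, sub_self, norm_zero, zero_add, zero_add] at hlip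
    rw [hsplit, norm_smul, Real.norm_of_nonneg (sq_nonneg h)]
    refine (mul_le_mul_of_nonneg_left hlip (sq_nonneg h)).trans ?_
    rw [← mul_assoc]
    exact mul_le_mul_of_nonneg_right (by simpa using hΛ) (norm_nonneg _)
  obtain ⟨p, hp, hfix, -⟩ := hcontr.exists_fixedPoint' isClosed_closedBall.isComplete hmaps
    (mem_closedBall_self (by positivity)) (edist_ne_top _ _)
  refine ⟨p, ?_, (hadm p hp).2.2.2⟩
  nth_rw 1 [← show g p = p from hfix]
  simp only [hg]
  module

theorem exists_seq_of_two_step {α : Type*} (r : α → α → α → Prop) (a b : α) :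
    ∃ x : ℕ → α, x 0 = a ∧ x 1 = b ∧
      ∀ n, (∃ c, r (x n) (x (n + 1)) c) → r (x n) (x (n + 1)) (x (n + 2)) := by
  have : Nonempty α := ⟨a⟩
  let pair : ℕ → α × α := fun n =>
    n.rec (a, b) fun _ p => (p.2, Classical.epsilon (r p.1 p.2))
  exact ⟨fun n => (pair n).1, rfl, rfl, fun n => Classical.epsilon_spec⟩

theorem IsApproxSolution.exists_isStep (hX : IsApproxSolution Φ h T ρ δ X)
    (hΦ : IsBoundedMethod Φ ρ Λ) (hΛ : h ^ 2 * Λ ≤ 1 / 2) (hΛρ : h ^ 2 * Λ ≤ ρ / 4) (hρ : 0 < ρ)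
    (h0 : 0 < h) {k : ℕ} (hk : (k + 1) * h ≤ T) (hk0 : ‖x k - X k‖ ≤ ρ / 16)
    (hk1 : ‖x (k + 1) - X (k + 1)‖ ≤ ρ / 16) :
    ∃ xp, IsStep Φ h (x k) (x (k + 1)) xp := by
  have hn0 : ρ ≤ ‖x k‖ := le_norm_of_norm_sub_le (hX.le_norm k (by linarith)) (by linarith)
  have hn1 : ρ ≤ ‖x (k + 1)‖ :=
    le_norm_of_norm_sub_le (hX.le_norm (k + 1) (by push_cast; linarith)) (by linarith)
  have hstep : ‖x (k + 1) - x k‖ ≤ ρ / 4 := by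
    have hsplit : x (k + 1) - x k =
        (x (k + 1) - X (k + 1)) + (X (k + 1) - X k) - (x k - X k) := by abel
    rw [hsplit]
    refine (_root_.norm_sub_le _ _).trans ?_
    linarith [norm_add_le (x (k + 1) - X (k + 1)) (X (k + 1) - X k), hX.step_le k hk]
  exact Kepler.exists_isStep hΦ hΛ hΛρ hn0 hn1 (by linarith) (by linarith)

theorem IsApproxSolution.mono {T' : ℝ} (hX : IsApproxSolution Φ h T ρ δ X) (hT : T' ≤ T) :
    IsApproxSolution Φ h T' ρ δ X :=
  ⟨fun k hk => hX.le_norm k (hk.trans hT), fun k hk => hX.step_le k (hk.trans hT),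
    fun k hk => hX.residual_le k (hk.trans hT)⟩

theorem IsApproxSolution.exists_isNumericalSolution (hX : IsApproxSolution Φ h T ρ δ X)
    (hΦ : IsBoundedMethod Φ ρ Λ) (hρ : 0 < ρ) (h0 : 0 < h) (h1 : h ≤ 1) (hΛ : h ^ 2 * Λ ≤ 1 / 2)
    (hΛρ : h ^ 2 * Λ ≤ ρ / 4) (hδ : 0 ≤ δ) (hδρ : stabilityFactor Λ T * δ ≤ ρ / 16) {x₁ : Plane}
    (hx₁ : ‖x₁ - X 1‖ ≤ h * δ) :
    ∃ x, IsNumericalSolution Φ h T x ∧ x 0 = X 0 ∧ x 1 = x₁ := by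
  obtain ⟨x, hx0, hx1, hx⟩ := exists_seq_of_two_step (IsStep Φ h) (X 0) x₁
  rw [← hx1] at hx₁
  have hfirst : h ≤ T → ‖x 1 - x 0‖ ≤ ‖x 0‖ / 2 := fun hT => by
    have hδ' : δ ≤ stabilityFactor Λ T * δ :=
      le_mul_of_one_le_left hδ (one_le_stabilityFactor hΦ.nonneg (h0.le.trans hT))
    have hstep := hX.step_le 0 (by simpa using hT)
    have hnorm := hX.le_norm 0 (by simpa using h0.le.trans hT)
    rw [zero_add] at hstep
    rw [hx0]
    linarith [norm_sub_le_norm_sub_add_norm_sub (x 1) (X 1) (X 0), mul_le_of_le_one_left hδ h1]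
  refine ⟨x, isNumericalSolution_of_isStep h0 hfirst fun n => ?_, hx0, hx1⟩
  induction n using Nat.strong_induction_on with
  | _ n ih =>
    intro hn
    have hT' : ((n + 1 : ℕ) : ℝ) * h ≤ T := by push_cast; linarith
    have hsol : IsNumericalSolution Φ h ((n + 1 : ℕ) * h) x :=
      isNumericalSolution_of_isStep h0 (fun hh => hfirst (hh.trans hT')) fun k hk =>
        have hkn : k + 2 ≤ n + 1 := by
          exact_mod_cast (mul_le_mul_iff_left₀ h0).mp hk
        ih k (by omega) (hk.trans hT')
    have hfactor : stabilityFactor Λ ((n + 1 : ℕ) * h) * δ ≤ ρ / 16 :=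
      (mul_le_mul_of_nonneg_right
        (stabilityFactor_le_stabilityFactor hΦ.nonneg (by positivity) hT') hδ).trans hδρ
    have hclose : ∀ k ≤ n + 1, ‖x k - X k‖ ≤ ρ / 16 := fun k hk =>
      ((hX.mono hT').norm_sub_le hΦ hρ h0 h1 hΛ hδ (hfactor.trans (by linarith)) hsol hx0 hx₁
        (by gcongr)).trans hfactor
    exact hx n (hX.exists_isStep hΦ hΛ hΛρ hρ h0 (by linarith) (hclose n (by omega))
      (hclose (n + 1) le_rfl))

end Stability

/-! ### Consistency of the methods with their modified equations -/

section LieDerivativeForce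

variable {S : Type*} [NormedAddCommGroup S] [NormedSpace ℝ S] {U : Set S} {W : S → S}
  {x v : S → Plane} {z : S}

theorem hasDerivWithinAt_comp_line {F : Type*} [NormedAddCommGroup F] [NormedSpace ℝ F]
    {u : S → F} (hu : DifferentiableAt ℝ u z) :
    HasDerivWithinAt (fun τ : ℝ => u (z + τ • W z)) (lieDeriv W u z) univ 0 :=
  (hu.hasFDerivAt.hasLineDerivAt (W z)).hasDerivWithinAt

theorem lieDeriv_force (hx : ContDiffAt ℝ ∞ x z) (h0 : x z ≠ 0) :
    lieDeriv W (fun y => force (x y)) z = -tidal (x z) (lieDeriv W x z) := by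
  refine lieDeriv_eq_of_hasDerivAt_line ((contDiffAt_force hx h0).differentiableAt (by simp)) ?_
  have := hasDerivWithinAt_force
    (hasDerivWithinAt_comp_line (W := W) (hx.differentiableAt (by simp))) (by simpa using h0)
  simpa using this

theorem lieDeriv_tidal (hx : ContDiffAt ℝ ∞ x z) (hv : ContDiffAt ℝ ∞ v z) (h0 : x z ≠ 0)
    (hxv : lieDeriv W x z = v z) :
    lieDeriv W (fun y => tidal (x y) (v y)) z =
      tidalDot (x z) (v z) + tidal (x z) (lieDeriv W v z) := by
  refine lieDeriv_eq_of_hasDerivAt_line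
    (((contDiffAt_tidal hx h0).clm_apply hv).differentiableAt (by simp)) ?_
  have hX := hasDerivWithinAt_comp_line (W := W) (hx.differentiableAt (by simp))
  have hV := hasDerivWithinAt_comp_line (W := W) (hv.differentiableAt (by simp))
  have := hasDerivWithinAt_tidal (X := fun τ : ℝ => x (z + τ • W z))
    (V := fun τ : ℝ => v (z + τ • W z)) (by simpa [hxv] using hX) hV (by simpa using h0)
  simpa using this

theorem lieDeriv_lieDeriv_force (hU : IsOpen U) (hx : ContDiffOn ℝ ∞ x U)
    (hv : ContDiffOn ℝ ∞ v U) (h0 : ∀ z ∈ U, x z ≠ 0) (hxv : EqOn (lieDeriv W x) v U) :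
    EqOn ((lieDeriv W)^[2] (fun y => force (x y)))
      (fun z => -(tidalDot (x z) (v z) + tidal (x z) (lieDeriv W v z))) U := fun z hz => by
  have hfirst : EqOn (lieDeriv W (fun y => force (x y))) (fun y => -tidal (x y) (v y)) U :=
    fun y hy => by
      simp only [lieDeriv_force (hx.contDiffAt (hU.mem_nhds hy)) (h0 y hy), hxv hy]
  have hneg : lieDeriv W (fun y => -tidal (x y) (v y)) z =
      -lieDeriv W (fun y => tidal (x y) (v y)) z := by
    simp only [lieDeriv, fderiv_fun_neg, _root_.neg_apply]
  refine (lieDeriv_eqOn hU hfirst hz).trans (hneg.trans ?_)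
  rw [lieDeriv_tidal (hx.contDiffAt (hU.mem_nhds hz)) (hv.contDiffAt (hU.mem_nhds hz)) (h0 z hz)
    (hxv hz)]

end LieDerivativeForce

section Consistency

variable {σ : ℝ} {K : Set State}

theorem lieDeriv_field_fst (σ : ℝ) (s : State) :
    lieDeriv (field σ) (fun s : State => s.1) s = 0 := by
  rw [lieDeriv, fderiv_fst]
  rfl

theorem lieDeriv_field_position (σ : ℝ) :
    lieDeriv (field σ) (fun s : State => s.2.1) = fun s => s.2.2 := by
  ext1 s
  rw [lieDeriv, fderiv.fst differentiableAt_snd, fderiv_snd]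
  rfl

theorem lieDeriv_field_velocity (σ : ℝ) :
    lieDeriv (field σ) (fun s : State => s.2.2) =
      fun s => acceleration σ s.1 s.2.1 s.2.2 := by
  ext1 s
  rw [lieDeriv, fderiv.snd differentiableAt_snd, fderiv_snd]
  rfl

theorem contDiffOn_force_position (σ : ℝ) :
    ContDiffOn ℝ ∞ (fun s : State => force s.2.1) (regular σ) := fun _ hs =>
  (contDiffAt_force contDiff_position.contDiffAt hs.1).contDiffWithinAt

theorem contDiffOn_tidal_perturbation (σ : ℝ) :
    ContDiffOn ℝ ∞ (fun s : State => tidal s.2.1 (perturbation σ s.1 s.2.1 s.2.2)) (regular σ) :=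
  ContDiffOn.clm_apply (fun _ hs =>
    (contDiffAt_tidal contDiff_position.contDiffAt hs.1).contDiffWithinAt)
    (contDiffOn_perturbation σ)

theorem iterate_four_lieDeriv_position (σ : ℝ) :
    EqOn ((lieDeriv (field σ))^[4] (fun s : State => s.2.1))
      (fun s => -(tidalDot s.2.1 s.2.2 + tidal s.2.1 (acceleration σ s.1 s.2.1 s.2.2)) +
        s.1 • (lieDeriv (field σ))^[2] (fun s => perturbation σ s.1 s.2.1 s.2.2) s)
      (regular σ) := by
  have hU := isOpen_regular σ
  have hW := contDiffOn_field σ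
  have hp := contDiffOn_perturbation σ
  have hforce := lieDeriv_lieDeriv_force (W := field σ) hU contDiff_position.contDiffOn
    contDiff_velocity.contDiffOn (fun _ hs => hs.1)
    fun s _ => congrFun (lieDeriv_field_position σ) s
  rw [lieDeriv_field_velocity] at hforce
  have hpert := iterate_lieDeriv_smul hU hW differentiable_fst
    (fun s _ => lieDeriv_field_fst σ s) hp 2
  have hsum := iterate_lieDeriv_add hU hW (contDiffOn_force_position σ)
    (contDiff_fst.contDiffOn.smul hp) 2
  rw [Function.iterate_succ_apply, Function.iterate_succ_apply, lieDeriv_field_position,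
    lieDeriv_field_velocity]
  exact fun s hs => (hsum hs).trans (congrArg₂ (· + ·) (hforce hs) (hpert hs))

theorem perturbation_eq_leadingPerturbation_sub {ε : ℝ} {x : Plane} (hM : IsUnit (mass σ ε x))
    (v : Plane) : perturbation σ ε x v =
      leadingPerturbation σ x v - (ε * σ / 12) • tidal x (perturbation σ ε x v) :=
  eq_sub_of_add_eq ((mass_apply ..).symm.trans (mass_perturbation hM v))

/-- `K`-valued solutions `s` of the modified equation around time `0`, with step size `h`. -/
structure IsLocalSolution (σ h : ℝ) (K : Set State) (s : ℝ → State) : Prop where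
  fst_zero : (s 0).1 = h ^ 2
  mem : ∀ τ ∈ Icc (-h) h, s τ ∈ K
  hasDerivAt : ∀ τ ∈ Icc (-h) h, HasDerivAt s (field σ (s τ)) τ

/-- The coefficient of `h ^ 6` in the Taylor polynomial of the second difference of the position. -/
def secondDifferenceRemainder (σ : ℝ) (s : State) : Plane :=
  (1 / 12 : ℝ) • (lieDeriv (field σ))^[2] (fun s => perturbation σ s.1 s.2.1 s.2.2) s -
    ((1 + σ) / 12) • tidal s.2.1 (perturbation σ s.1 s.2.1 s.2.2)

theorem continuousOn_secondDifferenceRemainder (σ : ℝ) :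
    ContinuousOn (secondDifferenceRemainder σ) (regular σ) := by
  have hpert := contDiffOn_iterate_lieDeriv (isOpen_regular σ) (contDiffOn_field σ)
    (contDiffOn_perturbation σ) 2
  exact (hpert.continuousOn.const_smul (1 / 12 : ℝ)).fun_sub
    ((contDiffOn_tidal_perturbation σ).continuousOn.const_smul ((1 + σ) / 12))

theorem two_smul_taylor_position_eq {h : ℝ} {s : State} (hs : s ∈ regular σ) (hε : s.1 = h ^ 2) :
    (2 : ℝ) • ∑ j ∈ Finset.range 3, (h ^ (2 * j) / (2 * j).factorial) •
        (lieDeriv (field σ))^[2 * j] (fun s : State => s.2.1) s =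
      (2 : ℝ) • s.2.1 + (h ^ 2 • force s.2.1 + h ^ 4 • (leadingPerturbation σ s.2.1 s.2.2 -
        (1 / 12 : ℝ) • (tidalDot s.2.1 s.2.2 + tidal s.2.1 (force s.2.1)))) +
      h ^ 6 • secondDifferenceRemainder σ s := by
  have hfourth := iterate_four_lieDeriv_position σ hs
  have hsecond : (lieDeriv (field σ))^[2] (fun s : State => s.2.1) s =
      force s.2.1 + h ^ 2 • perturbation σ s.1 s.2.1 s.2.2 := by
    simp only [Function.iterate_succ_apply, Function.iterate_zero, id, lieDeriv_field_position,
      lieDeriv_field_velocity, acceleration, hε]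
  have hpert := perturbation_eq_leadingPerturbation_sub hs.2.1 s.2.2
  simp only [acceleration, map_add, map_smul, hε] at hfourth hsecond hpert
  simp only [Finset.sum_range_succ, Finset.sum_range_zero, mul_zero, mul_one, Nat.reduceMul,
    hfourth, hsecond, secondDifferenceRemainder, hε, Function.iterate_zero, id, pow_zero,
    Nat.factorial]
  generalize tidal s.2.1 (perturbation σ (h ^ 2) s.2.1 s.2.2) = tP at hpert ⊢
  rw [hpert]
  push_cast
  module

theorem exists_second_difference_position_bound (hKU : K ⊆ regular σ) (hK : IsCompact K) :
    ∃ C > 0, ∀ h > 0, ∀ s, IsLocalSolution σ h K s →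
      ‖(s h).2.1 - (2 : ℝ) • (s 0).2.1 + (s (-h)).2.1 - (h ^ 2 • force (s 0).2.1 +
        h ^ 4 • (leadingPerturbation σ (s 0).2.1 (s 0).2.2 - (1 / 12 : ℝ) •
          (tidalDot (s 0).2.1 (s 0).2.2 + tidal (s 0).2.1 (force (s 0).2.1))))‖ ≤ C * h ^ 6 := by
  obtain ⟨C, hC, htaylor⟩ := exists_symm_taylor_bound (isOpen_regular σ) hK hKU
    (contDiffOn_field σ) contDiff_position.contDiffOn 3
  obtain ⟨R, hR, hrem⟩ := exists_norm_le_of_isCompact hK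
    ((continuousOn_secondDifferenceRemainder σ).mono hKU)
  refine ⟨C + R, by positivity, fun h hh s hs => ?_⟩
  have h0 := hs.mem 0 ⟨by linarith, hh.le⟩
  have hdiff := htaylor h hh.le s fun τ hτ => ⟨hs.mem τ hτ, hs.hasDerivAt τ hτ⟩
  rw [two_smul_taylor_position_eq (hKU h0) hs.fst_zero] at hdiff
  have hrem : ‖h ^ 6 • secondDifferenceRemainder σ (s 0)‖ ≤ R * h ^ 6 := by
    rw [norm_smul, Real.norm_of_nonneg (by positivity), mul_comm]
    gcongr
    exact hrem _ h0
  rw [add_mul]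
  refine (norm_add_le_of_le hdiff hrem).trans_eq' (congrArg _ ?_)
  module

/-- The solutions of the modified equation solve the difference equation of the method `Φ` up to
a residual of order `h ^ 6`. -/
def IsConsistent (σ : ℝ) (Φ : Plane → Plane → Plane → Plane) : Prop :=
  ∀ K ⊆ regular σ, IsCompact K → ∃ C > 0, ∃ h₁ > 0, ∀ h ∈ Ioo 0 h₁, ∀ s,
    IsLocalSolution σ h K s →
      ‖(s h).2.1 - (2 : ℝ) • (s 0).2.1 + (s (-h)).2.1 -
        h ^ 2 • Φ (s (-h)).2.1 (s 0).2.1 (s h).2.1‖ ≤ C * h ^ 6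

theorem isConsistent_verletForce : IsConsistent (-2) verletForce := by
  intro K hKU hK
  obtain ⟨C, hC, hdiff⟩ := exists_second_difference_position_bound hKU hK
  refine ⟨C, hC, 1, one_pos, fun h hh s hs => (hdiff h hh.1 s hs).trans_eq' (congrArg _ ?_)⟩
  rw [verletForce, leadingPerturbation]
  module

/-- The midpoint of the fixed point `z.1` and the position of the state `z.2`. -/
def halfway (z : Plane × State) : Plane := (1 / 2 : ℝ) • (z.1 + z.2.2.1)

/-- The vector field that moves the state `z.2` along the modified equation and fixes `z.1`. -/
def halfwayField (σ : ℝ) (z : Plane × State) : Plane × State := (0, field σ z.2)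

/-- The pairs of a point and a regular state whose midpoint is not the origin. -/
def halfwayRegular (σ : ℝ) : Set (Plane × State) := {z | z.2 ∈ regular σ ∧ halfway z ≠ 0}

theorem contDiff_halfway : ContDiff ℝ ∞ halfway := by
  unfold halfway
  fun_prop

theorem isOpen_halfwayRegular (σ : ℝ) : IsOpen (halfwayRegular σ) :=
  ((isOpen_regular σ).preimage continuous_snd).inter
    (isOpen_ne_fun contDiff_halfway.continuous continuous_const)

theorem contDiffOn_halfwayField (σ : ℝ) : ContDiffOn ℝ ∞ (halfwayField σ) (halfwayRegular σ) :=
  contDiffOn_const.prodMk ((contDiffOn_field σ).comp contDiffOn_snd fun _ hz => hz.1)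

theorem lieDeriv_halfwayField_halfway (σ : ℝ) :
    lieDeriv (halfwayField σ) halfway = fun z => (1 / 2 : ℝ) • z.2.2.2 := by
  ext1 z
  refine lieDeriv_eq_of_hasDerivAt_line (contDiff_halfway.differentiable (by simp) z) ?_
  have hline := ((hasDerivAt_id (0 : ℝ)).smul_const (z.2.2.2)).const_add z.2.2.1
  simpa [halfway, halfwayField, field] using (hline.const_add z.1).fun_const_smul (1 / 2 : ℝ)

theorem lieDeriv_halfwayField_half_velocity (σ : ℝ) :
    lieDeriv (halfwayField σ) (fun z => (1 / 2 : ℝ) • z.2.2.2) =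
      fun z => (1 / 2 : ℝ) • acceleration σ z.2.1 z.2.2.1 z.2.2.2 := by
  ext1 z
  refine lieDeriv_eq_of_hasDerivAt_line (by fun_prop) ?_
  have hline := ((hasDerivAt_id (0 : ℝ)).smul_const
    (acceleration σ z.2.1 z.2.2.1 z.2.2.2)).const_add z.2.2.2
  simpa [halfwayField, field] using hline.fun_const_smul (1 / 2 : ℝ)

theorem tidalDot_smul (x : Plane) (c : ℝ) (v : Plane) :
    tidalDot x (c • v) = c ^ 2 • tidalDot x v := by
  simp only [tidalDot, inner_smul_right, norm_smul, mul_pow, Real.norm_eq_abs, sq_abs]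
  module

theorem iterate_two_lieDeriv_force_halfway (σ : ℝ) :
    EqOn ((lieDeriv (halfwayField σ))^[2] (fun z => force (halfway z)))
      (fun z => -((1 / 4 : ℝ) • tidalDot (halfway z) z.2.2.2 +
        (1 / 2 : ℝ) • tidal (halfway z) (acceleration σ z.2.1 z.2.2.1 z.2.2.2)))
      (halfwayRegular σ) := by
  have hforce := lieDeriv_lieDeriv_force (W := halfwayField σ) (isOpen_halfwayRegular σ)
    contDiff_halfway.contDiffOn (v := fun z => (1 / 2 : ℝ) • z.2.2.2)
    (contDiff_velocity.comp contDiff_snd |>.const_smul _).contDiffOn (fun _ hz => hz.2)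
    fun z _ => congrFun (lieDeriv_halfwayField_halfway σ) z
  rw [lieDeriv_halfwayField_half_velocity] at hforce
  refine hforce.trans fun z _ => ?_
  simp only [tidalDot_smul, map_smul]
  norm_num

theorem IsLocalSolution.norm_position_sub_le {h M : ℝ} {s : ℝ → State}
    (hs : IsLocalSolution σ h K s) (hM : ∀ y ∈ K, ‖y.2.2‖ ≤ M) {τ : ℝ} (hτ : τ ∈ Icc (-h) h) :
    ‖(s 0).2.1 - (s τ).2.1‖ ≤ M * h := by
  have h0 : (0 : ℝ) ∈ Icc (-h) h := ⟨by linarith [hτ.1, hτ.2], by linarith [hτ.1, hτ.2]⟩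
  refine ((convex_Icc (-h) h).norm_image_sub_le_of_norm_hasDerivWithin_le
    (fun t ht => (hasDerivAt_components (hs.hasDerivAt t ht)).2.1.hasDerivWithinAt)
    (fun t ht => hM _ (hs.mem t ht)) hτ h0).trans ?_
  have hM0 : 0 ≤ M := (norm_nonneg _).trans (hM _ (hs.mem 0 h0))
  gcongr
  rw [zero_sub, norm_neg, Real.norm_eq_abs, abs_le]
  exact hτ

theorem norm_le_two_mul_norm_halfway {z : Plane × State} {d : ℝ} (hd : d ≤ ‖z.2.2.1‖)
    (hz : ‖z.1 - z.2.2.1‖ ≤ d) : d ≤ 2 * ‖halfway z‖ := by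
  have hpos : (2 : ℝ) • z.2.2.1 = (2 : ℝ) • halfway z - (z.1 - z.2.2.1) := by
    rw [halfway]
    module
  have hsub := norm_sub_le ((2 : ℝ) • halfway z) (z.1 - z.2.2.1)
  rw [← hpos, norm_smul, norm_smul, Real.norm_two] at hsub
  linarith

theorem exists_isCompact_halfwayRegular (hKU : K ⊆ regular σ) (hK : IsCompact K) :
    ∃ K' ⊆ halfwayRegular σ, IsCompact K' ∧ ∃ h₁ > 0, ∀ h ∈ Ioo 0 h₁, ∀ s,
      IsLocalSolution σ h K s → ∀ τ ∈ Icc (-h) h, ((s 0).2.1, s τ) ∈ K' := by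
  obtain ⟨d, hd0, hd⟩ := hK.exists_forall_le' (f := fun s : State => ‖s.2.1‖)
    contDiff_position.continuous.norm.continuousOn fun s hs => norm_pos_iff.mpr (hKU hs).1
  obtain ⟨M, hM, hMK⟩ := exists_norm_le_of_isCompact hK contDiff_velocity.continuous.continuousOn
  refine ⟨((fun s : State => s.2.1) '' K) ×ˢ K ∩ {z | ‖z.1 - z.2.2.1‖ ≤ d}, ?_, ?_, d / M,
    by positivity, fun h hh s hs τ hτ => ⟨⟨⟨s 0, hs.mem 0 ?_, rfl⟩, hs.mem τ hτ⟩, ?_⟩⟩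
  · rintro z ⟨⟨-, hzK⟩, hz⟩
    have := norm_le_two_mul_norm_halfway (hd _ hzK) hz
    exact ⟨hKU hzK, norm_pos_iff.mp (by linarith)⟩
  · exact ((hK.image contDiff_position.continuous).prod hK).inter_right
      (isClosed_le (by fun_prop) continuous_const)
  · exact ⟨by linarith [hh.1], hh.1.le⟩
  · have hMh := (lt_div_iff₀ hM).mp hh.2
    exact (hs.norm_position_sub_le hMK hτ).trans (by linarith)

theorem two_smul_taylor_force_halfway_eq {h : ℝ} {s : State} (hs : s ∈ regular σ)
    (hε : s.1 = h ^ 2) :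
    (2 : ℝ) • ∑ j ∈ Finset.range 2, (h ^ (2 * j) / (2 * j).factorial) •
        (lieDeriv (halfwayField σ))^[2 * j] (fun z => force (halfway z)) (s.2.1, s) =
      (2 : ℝ) • (force s.2.1 - h ^ 2 • ((1 / 8 : ℝ) • tidalDot s.2.1 s.2.2 +
        (1 / 4 : ℝ) • tidal s.2.1 (force s.2.1))) -
      h ^ 4 • (1 / 2 : ℝ) • tidal s.2.1 (perturbation σ s.1 s.2.1 s.2.2) := by
  have hhalf : halfway (s.2.1, s) = s.2.1 := by
    rw [halfway]
    module
  have hsecond := iterate_two_lieDeriv_force_halfway σ (x := (s.2.1, s))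
    ⟨hs, hhalf.symm ▸ hs.1⟩
  simp only [Finset.sum_range_succ, Finset.sum_range_zero, mul_zero, mul_one, hsecond,
    hhalf, acceleration, map_add, map_smul, hε, Function.iterate_zero, id, pow_zero, Nat.factorial]
  push_cast
  module

theorem exists_midpointForce_bound (hKU : K ⊆ regular σ) (hK : IsCompact K) :
    ∃ C > 0, ∃ h₁ > 0, ∀ h ∈ Ioo 0 h₁, ∀ s, IsLocalSolution σ h K s →
      ‖midpointForce (s (-h)).2.1 (s 0).2.1 (s h).2.1 - (force (s 0).2.1 -
        h ^ 2 • ((1 / 8 : ℝ) • tidalDot (s 0).2.1 (s 0).2.2 +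
          (1 / 4 : ℝ) • tidal (s 0).2.1 (force (s 0).2.1)))‖ ≤ C * h ^ 4 := by
  obtain ⟨K', hK'U, hK', h₁, hh₁, hmem⟩ := exists_isCompact_halfwayRegular hKU hK
  obtain ⟨C, hC, htaylor⟩ := exists_symm_taylor_bound (isOpen_halfwayRegular σ) hK' hK'U
    (contDiffOn_halfwayField σ) (u := fun z => force (halfway z)) (fun z hz =>
      (contDiffAt_force contDiff_halfway.contDiffAt hz.2).contDiffWithinAt) 2
  obtain ⟨R, hR, hrem⟩ := exists_norm_le_of_isCompact hK
    (((contDiffOn_tidal_perturbation σ).continuousOn.const_smul (1 / 2 : ℝ)).mono hKU)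
  refine ⟨C + R, by positivity, h₁, hh₁, fun h hh s hs => ?_⟩
  have h0 := hs.mem 0 ⟨by linarith [hh.1], hh.1.le⟩
  have hdiff := htaylor h hh.1.le (fun τ => ((s 0).2.1, s τ)) fun τ hτ =>
    ⟨hmem h hh s hs τ hτ, (hasDerivAt_const τ _).prodMk (hs.hasDerivAt τ hτ)⟩
  rw [two_smul_taylor_force_halfway_eq (hKU h0) hs.fst_zero] at hdiff
  have hrem : ‖h ^ 4 • (1 / 2 : ℝ) • tidal (s 0).2.1
      (perturbation σ (s 0).1 (s 0).2.1 (s 0).2.2)‖ ≤ R * h ^ 4 := by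
    rw [norm_smul, Real.norm_of_nonneg (by positivity), mul_comm]
    gcongr
    exact hrem _ h0
  refine (le_mul_of_one_le_left (norm_nonneg _) one_le_two).trans ?_
  rw [← Real.norm_two, ← norm_smul, add_mul]
  refine (norm_sub_le_of_le hdiff hrem).trans_eq' (congrArg _ ?_)
  rw [midpointForce, halfway, halfway, add_comm (s (-h)).2.1]
  module

theorem isConsistent_midpointForce : IsConsistent 1 midpointForce := by
  intro K hKU hK
  obtain ⟨C, hC, hdiff⟩ := exists_second_difference_position_bound hKU hK
  obtain ⟨C', hC', h₁, hh₁, hforce⟩ := exists_midpointForce_bound hKU hK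
  refine ⟨C + C', by positivity, h₁, hh₁, fun h hh s hs => ?_⟩
  have hscaled := mul_le_mul_of_nonneg_left (hforce h hh s hs) (sq_nonneg h)
  rw [← Real.norm_of_nonneg (sq_nonneg h), ← norm_smul, Real.norm_of_nonneg (sq_nonneg h)]
    at hscaled
  refine ((norm_sub_le_of_le (hdiff h hh.1 s hs) hscaled).trans_eq' (congrArg _ ?_)).trans_eq
    (by ring)
  rw [leadingPerturbation]
  module

end Consistency

/-! ### Numerical solutions near solutions of the modified equation -/

theorem eventually_mul_le (c : ℝ) {ε : ℝ} (hε : 0 < ε) : ∀ᶠ h in 𝓝[>] (0 : ℝ), c * h ≤ ε := by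
  have hlim : Tendsto (fun h : ℝ => c * h) (𝓝 0) (𝓝 0) := by
    simpa using (tendsto_id (x := 𝓝 (0 : ℝ))).const_mul c
  exact ((hlim.mono_left nhdsWithin_le_nhds).eventually_lt_const hε).mono fun _ h => h.le

theorem exists_pos_forall_Ioo {p : ℝ → Prop} (hp : ∀ᶠ h in 𝓝[>] (0 : ℝ), p h) :
    ∃ h₀ > 0, ∀ h ∈ Ioo 0 h₀, p h := by
  obtain ⟨h₀, hh₀, hsub⟩ := mem_nhdsGT_iff_exists_Ioo_subset.mp hp
  exact ⟨h₀, hh₀, fun h hh => hsub hh⟩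

section Newton

variable {E : Type*} [NormedAddCommGroup E] [NormedSpace ℝ E] {F : E → E} {w₀ y : E} {h B c : ℝ}

theorem norm_sub_newton_le (h0 : 0 < h) {w w' : E} (hw' : w' - w = h⁻¹ • (y - F w))
    (hF : ‖F w' - F w - h • (w' - w)‖ ≤ B * h ^ 2 * ‖w' - w‖) :
    ‖y - F w'‖ ≤ B * h * ‖y - F w‖ := by
  rw [hw', smul_inv_smul₀ h0.ne', norm_smul, norm_inv, Real.norm_of_nonneg h0.le] at hF
  calc ‖y - F w'‖ = ‖F w' - F w - (y - F w)‖ := by rw [sub_sub_sub_cancel_right, norm_sub_rev]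
    _ ≤ B * h ^ 2 * (h⁻¹ * ‖y - F w‖) := hF
    _ = B * h * ‖y - F w‖ := by field_simp

/-- Each step of the simplified Newton iteration `w ↦ w + h⁻¹ • (y - F w)` gains a factor `B * h`,
so two steps improve the residual from `h ^ 3` to `h ^ 5`. -/
theorem exists_shooting (h0 : 0 < h) (h1 : h ≤ 1) (hB : 0 ≤ B) (hc : 0 ≤ c)
    (hF : ∀ w w', ‖w - w₀‖ ≤ c * (1 + B) * h ^ 2 → ‖w' - w₀‖ ≤ c * (1 + B) * h ^ 2 →
      ‖F w - F w' - h • (w - w')‖ ≤ B * h ^ 2 * ‖w - w'‖) (hy : ‖y - F w₀‖ ≤ c * h ^ 3) :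
    ∃ w, ‖w - w₀‖ ≤ c * (1 + B) * h ^ 2 ∧ ‖y - F w‖ ≤ B ^ 2 * c * h ^ 5 := by
  have hstep : ∀ {w r}, ‖y - F w‖ ≤ h * r → ‖w + h⁻¹ • (y - F w) - w‖ ≤ r := fun hr => by
    rw [add_sub_cancel_left, norm_smul, norm_inv, Real.norm_of_nonneg h0.le]
    exact (inv_mul_le_iff₀ h0).mpr hr
  have hcB : 0 ≤ B * c * h ^ 2 := by positivity
  set w₁ := w₀ + h⁻¹ • (y - F w₀)
  set w₂ := w₁ + h⁻¹ • (y - F w₁)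
  have hw₁ : ‖w₁ - w₀‖ ≤ c * h ^ 2 := hstep (hy.trans_eq (by ring))
  have hball₀ : ‖w₀ - w₀‖ ≤ c * (1 + B) * h ^ 2 := by
    rw [sub_self, norm_zero]
    positivity
  have hball₁ : ‖w₁ - w₀‖ ≤ c * (1 + B) * h ^ 2 := by linarith
  have hres₁ : ‖y - F w₁‖ ≤ B * c * h ^ 4 :=
    calc ‖y - F w₁‖ ≤ B * h * ‖y - F w₀‖ :=
          norm_sub_newton_le h0 (add_sub_cancel_left _ _) (hF _ _ hball₁ hball₀)
      _ ≤ B * h * (c * h ^ 3) := by gcongr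
      _ = B * c * h ^ 4 := by ring
  have hw₂ : ‖w₂ - w₁‖ ≤ B * c * h ^ 2 := hstep <|
    calc ‖y - F w₁‖ ≤ h ^ 3 * (B * c * h) := hres₁.trans_eq (by ring)
      _ ≤ h ^ 2 * (B * c * h) := by
        gcongr ?_ * _
        exact pow_le_pow_of_le_one h0.le h1 (by norm_num)
      _ = h * (B * c * h ^ 2) := by ring
  have hball₂ : ‖w₂ - w₀‖ ≤ c * (1 + B) * h ^ 2 := by
    linarith [norm_sub_le_norm_sub_add_norm_sub w₂ w₁ w₀]
  refine ⟨w₂, hball₂, ?_⟩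
  calc ‖y - F w₂‖ ≤ B * h * ‖y - F w₁‖ :=
        norm_sub_newton_le h0 (add_sub_cancel_left _ _) (hF _ _ hball₂ hball₁)
    _ ≤ B * h * (B * c * h ^ 4) := by gcongr
    _ = B ^ 2 * c * h ^ 5 := by ring

end Newton

section Shadowing

variable {σ T h ρ C M c : ℝ} {Φ : Plane → Plane → Plane → Plane} {K : Set State} {s : ℝ → State}

theorem isLocalSolution_shift (h0 : 0 ≤ h)
    (hs : ∀ t ∈ Icc 0 T, s t ∈ K ∧ HasDerivAt s (field σ (s t)) t) (hs0 : (s 0).1 = h ^ 2) {t : ℝ}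
    (ht : Icc (t - h) (t + h) ⊆ Icc 0 T) : IsLocalSolution σ h K fun τ => s (t + τ) := by
  have hmem : ∀ τ ∈ Icc (-h) h, t + τ ∈ Icc 0 T := fun τ hτ =>
    ht ⟨by linarith [hτ.1], by linarith [hτ.2]⟩
  refine ⟨?_, fun τ hτ => (hs _ (hmem τ hτ)).1, fun τ hτ =>
    (hs _ (hmem τ hτ)).2.comp_const_add _ _⟩
  exact (fst_eq_of_hasDerivAt_field (fun t ht => (hs t ht).2) _
    (hmem 0 ⟨by linarith, h0⟩)).trans hs0

theorem norm_position_sub_le_of_hasDerivAt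
    (hs : ∀ t ∈ Icc 0 T, s t ∈ K ∧ HasDerivAt s (field σ (s t)) t) (hM : ∀ x ∈ K, ‖x.2.2‖ ≤ M)
    {t t' : ℝ} (ht : t ∈ Icc 0 T) (ht' : t' ∈ Icc 0 T) :
    ‖(s t').2.1 - (s t).2.1‖ ≤ M * ‖t' - t‖ :=
  Convex.norm_image_sub_le_of_norm_hasDerivWithin_le (f := fun t => (s t).2.1)
    (fun t ht => (hasDerivAt_components (hs t ht).2).2.1.hasDerivWithinAt)
    (fun t ht => hM _ (hs t ht).1) (convex_Icc 0 T) ht ht'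

theorem isApproxSolution_of_hasDerivAt_field (h0 : 0 ≤ h)
    (hs : ∀ t ∈ Icc 0 T, s t ∈ K ∧ HasDerivAt s (field σ (s t)) t) (hs0 : (s 0).1 = h ^ 2)
    (hρ : ∀ x ∈ K, 2 * ρ ≤ ‖x.2.1‖) (hM : ∀ x ∈ K, ‖x.2.2‖ ≤ M) (hMh : M * h ≤ ρ / 8)
    (hres : ∀ s, IsLocalSolution σ h K s → ‖(s h).2.1 - (2 : ℝ) • (s 0).2.1 + (s (-h)).2.1 -
      h ^ 2 • Φ (s (-h)).2.1 (s 0).2.1 (s h).2.1‖ ≤ C * h ^ 6) :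
    IsApproxSolution Φ h T ρ (C * h ^ 4) fun k => (s (k * h)).2.1 := by
  have hmem : ∀ k : ℕ, k * h ≤ T → k * h ∈ Icc 0 T := fun k hk => ⟨by positivity, hk⟩
  refine ⟨fun k hk => hρ _ (hs _ (hmem k hk)).1, fun k hk => ?_, fun k hk => ?_⟩
  · refine (norm_position_sub_le_of_hasDerivAt hs hM (hmem k (by linarith))
      (hmem (k + 1) (by exact_mod_cast hk))).trans ?_
    rwa [← sub_mul, Nat.cast_add_one, add_sub_cancel_left, one_mul, Real.norm_of_nonneg h0]
  · have hk0 : 0 ≤ k * h := by positivity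
    have hlocal := hres _ (isLocalSolution_shift h0 hs hs0 (t := (k + 1 : ℕ) * h)
      (Icc_subset_Icc (by push_cast; linarith) (by push_cast; linarith)))
    have hnext : ((k + 1 : ℕ) : ℝ) * h + h = (k + 2 : ℕ) * h := by push_cast; ring
    have hprev : ((k + 1 : ℕ) : ℝ) * h + -h = k * h := by push_cast; ring
    rw [hnext, hprev, add_zero] at hlocal
    exact hlocal.trans_eq (by ring)

theorem IsConsistent.exists_isApproxSolution (hΦ : IsConsistent σ Φ) (hKU : K ⊆ regular σ)
    (hK : IsCompact K) (T c : ℝ) :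
    ∃ ρ > 0, ∃ C > c, ∀ᶠ h in 𝓝[>] (0 : ℝ), ∀ s : ℝ → State, (s 0).1 = h ^ 2 →
      (∀ t ∈ Icc 0 T, s t ∈ K ∧ HasDerivAt s (field σ (s t)) t) →
      IsApproxSolution Φ h T ρ (C * h ^ 4) fun k => (s (k * h)).2.1 := by
  obtain ⟨d, hd, hdK⟩ := hK.exists_forall_le' (f := fun x : State => ‖x.2.1‖)
    contDiff_position.continuous.norm.continuousOn fun x hx => norm_pos_iff.mpr (hKU hx).1
  obtain ⟨M, -, hM⟩ := exists_norm_le_of_isCompact hK contDiff_velocity.continuous.continuousOn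
  obtain ⟨C, -, h₁, hh₁, hres⟩ := hΦ K hKU hK
  refine ⟨d / 2, half_pos hd, max C (c + 1), lt_max_of_lt_right (lt_add_one c), ?_⟩
  filter_upwards [Ioo_mem_nhdsGT hh₁, eventually_mul_le M (by positivity : 0 < d / 2 / 8)]
    with h hh hMh s hs0 hs
  have h0 : 0 ≤ h := hh.1.le
  refine isApproxSolution_of_hasDerivAt_field h0 hs hs0
    (fun x hx => (mul_div_cancel₀ d two_ne_zero).trans_le (hdK x hx)) hM hMh
    fun s hs => (hres h hh s hs).trans ?_
  gcongr
  exact le_max_left _ _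

theorem IsConsistent.exists_shadow (hΦ : IsConsistent σ Φ)
    (hbd : ∀ ρ > 0, ∃ Λ, IsBoundedMethod Φ ρ Λ) (hKU : K ⊆ regular σ) (hK : IsCompact K)
    (hT : 0 ≤ T) (hc : 0 ≤ c) :
    ∃ E > 0, ∀ᶠ h in 𝓝[>] (0 : ℝ), ∀ s : ℝ → State, (s 0).1 = h ^ 2 →
      (∀ t ∈ Icc 0 T, s t ∈ K ∧ HasDerivAt s (field σ (s t)) t) →
      ∀ x₁, ‖x₁ - (s h).2.1‖ ≤ c * h ^ 5 →
        (∃ x, IsNumericalSolution Φ h T x ∧ x 0 = (s 0).2.1 ∧ x 1 = x₁) ∧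
        ∀ x, IsNumericalSolution Φ h T x → x 0 = (s 0).2.1 → x 1 = x₁ →
          ∀ k : ℕ, k * h ≤ T → ‖x k - (s (k * h)).2.1‖ ≤ E * h ^ 4 := by
  obtain ⟨ρ, hρ, C, hcC, happrox⟩ := hΦ.exists_isApproxSolution hKU hK T c
  obtain ⟨Λ, hΛ⟩ := hbd ρ hρ
  have hC : 0 < C := hc.trans_lt hcC
  have hS : 0 < stabilityFactor Λ T := one_pos.trans_le (one_le_stabilityFactor hΛ.nonneg hT)
  refine ⟨stabilityFactor Λ T * C, by positivity, ?_⟩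
  filter_upwards [Ioo_mem_nhdsGT one_pos, happrox, eventually_mul_le Λ (half_pos one_pos),
    eventually_mul_le Λ (by positivity : 0 < ρ / 4),
    eventually_mul_le (stabilityFactor Λ T * C) (by positivity : 0 < ρ / 16)]
    with h hh happrox hΛh hΛρ hSρ s hs0 hs x₁ hx₁
  obtain ⟨h0, h1⟩ := hh
  have hX := happrox s hs0 hs
  have hsq : h ^ 2 * Λ ≤ Λ * h := by
    rw [mul_comm]
    exact mul_le_mul_of_nonneg_left (pow_le_of_le_one h0.le h1.le two_ne_zero) hΛ.nonneg
  have hfactor : stabilityFactor Λ T * (C * h ^ 4) ≤ ρ / 16 := by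
    rw [← mul_assoc]
    refine (mul_le_mul_of_nonneg_left ?_ (by positivity)).trans hSρ
    exact pow_le_of_le_one h0.le h1.le four_ne_zero
  have hfirst : ‖x₁ - (s ((1 : ℕ) * h)).2.1‖ ≤ h * (C * h ^ 4) := by
    rw [Nat.cast_one, one_mul]
    exact hx₁.trans (by nlinarith [pow_pos h0 5])
  refine ⟨?_, fun x hx hx0 hx1 k hk => ?_⟩
  · simpa using hX.exists_isNumericalSolution hΛ hρ h0 h1.le (hsq.trans hΛh) (hsq.trans hΛρ)
      (by positivity) hfactor hfirst
  · rw [mul_assoc]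
    exact hX.norm_sub_le hΛ hρ h0 h1.le (hsq.trans hΛh) (by positivity) (by linarith) hx
      (by simpa using hx0) (by rwa [hx1]) hk

end Shadowing

/-! ### The modified Lagrangians describe the methods -/

section Shooting

variable {γ γ' : ℝ → Plane} {σ T δ A M R h κ : ℝ} {K : Set State} {Φ : State → ℝ → State}

theorem norm_position_sub_sub_smul_le {c : ℝ → State} (hΦ : IsFlowAlong (field σ) c T K δ A Φ)
    (hM0 : 0 ≤ M) (hM : ∀ x ∈ K, ∀ y ∈ K, ‖field σ x - field σ y‖ ≤ M * ‖x - y‖)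
    (hh : h ∈ Icc 0 T) {ε : ℝ} {y w w' : Plane} (hw : A * dist (ε, y, w) (c 0) ≤ δ)
    (hw' : A * dist (ε, y, w') (c 0) ≤ δ) :
    ‖(Φ (ε, y, w) h).2.1 - (Φ (ε, y, w') h).2.1 - h • (w - w')‖ ≤ M * A * h ^ 2 * ‖w - w'‖ := by
  set z : State := (ε, y, w)
  set z' : State := (ε, y, w')
  have hsub : ∀ t ∈ Icc 0 h, t ∈ Icc 0 T := fun t ht => ⟨ht.1, ht.2.trans hh.2⟩
  have hz := fun t ht => hasDerivAt_components (hΦ.hasDerivAt z hw t (hsub t ht))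
  have hz' := fun t ht => hasDerivAt_components (hΦ.hasDerivAt z' hw' t (hsub t ht))
  have hdist : dist z z' = ‖w - w'‖ := by simp [z, z', dist_eq_norm]
  have hbound := norm_le_of_deriv2_le (C := M * (A * ‖w - w'‖))
    (φ := fun t => (Φ z t).2.1 - (Φ z' t).2.1 - t • (w - w'))
    (φ' := fun t => (Φ z t).2.2 - (Φ z' t).2.2 - (w - w'))
    (fun t ht => (((hz t ht).2.1.sub (hz' t ht).2.1).sub
      ((hasDerivAt_id t).smul_const (w - w'))).congr_deriv (by rw [one_smul]; rfl))
    (fun t ht => ((hz t ht).2.2.sub (hz' t ht).2.2).sub_const _)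
    (by simp [hΦ.apply_zero, z, z']) (by simp [hΦ.apply_zero, z, z']) (fun t ht => ?_)
    h ⟨hh.1, le_rfl⟩
  · exact hbound.trans_eq (by ring)
  · refine ((norm_snd_le _).trans (norm_snd_le _)).trans
      ((hM _ (hΦ.mem hw (hsub t ht)) _ (hΦ.mem hw' (hsub t ht))).trans ?_)
    gcongr
    rw [← dist_eq_norm, ← hdist]
    exact hΦ.dist_le z z' t (hsub t ht)

theorem dist_sq_state (γ γ' : ℝ → Plane) (h : ℝ) :
    dist ((h ^ 2, γ 0, γ' 0) : State) (0, γ 0, γ' 0) = h ^ 2 := by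
  simp [dist_eq_norm, sq_nonneg]

theorem mul_dist_state_le (hA : 0 ≤ A) (hR : 0 < R) (hδ : A * ((R + 1) * h ^ 2) ≤ δ) {w : Plane}
    (hw : ‖w - γ' 0‖ ≤ R * h ^ 2) :
    A * dist ((h ^ 2, γ 0, w) : State) (0, γ 0, γ' 0) ≤ δ := by
  have hy : ‖γ 0 - γ 0‖ ≤ R * h ^ 2 := by
    rw [sub_self, norm_zero]
    positivity
  exact (mul_le_mul_of_nonneg_left (dist_state_le hR hy hw) hA).trans hδ

theorem IsKepler.norm_sub_position_le (hγ : IsKepler γ γ')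
    (hΦ : IsFlowAlong (field σ) (fun t => (0, γ t, γ' t)) T K δ A Φ) (hh : h ∈ Icc 0 T)
    (hδ : A * h ^ 2 ≤ δ) : ‖γ h - (Φ (h ^ 2, γ 0, γ' 0) h).2.1‖ ≤ A * h ^ 3 := by
  have hsub : ∀ t ∈ Icc 0 h, t ∈ Icc 0 T := fun t ht => ⟨ht.1, ht.2.trans hh.2⟩
  have hdist := dist_sq_state γ γ' h
  set z : State := (h ^ 2, γ 0, γ' 0)
  have hbound := norm_le_of_deriv_le (C := A * h ^ 2) (φ := fun t => γ t - (Φ z t).2.1)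
    (fun t ht => (hγ t).2.1.sub
      (hasDerivAt_components (hΦ.hasDerivAt z (hdist.symm ▸ hδ) t (hsub t ht))).2.1)
    (by simp [hΦ.apply_zero, z]) (fun t ht => ?_) h ⟨hh.1, le_rfl⟩
  · exact hbound.trans_eq (by ring)
  · rw [norm_sub_rev, ← hdist]
    exact ((norm_snd_le _).trans (norm_snd_le _)).trans
      ((dist_eq_norm _ _).symm.trans_le (hΦ.dist_curve_le z t (hsub t ht)))

theorem IsKepler.exists_velocity (hγ : IsKepler γ γ')
    (hΦ : IsFlowAlong (field σ) (fun t => (0, γ t, γ' t)) T K δ A Φ) (hA : 0 < A) (hM0 : 0 ≤ M)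
    (hM : ∀ x ∈ K, ∀ y ∈ K, ‖field σ x - field σ y‖ ≤ M * ‖x - y‖) (hκ : 0 < κ)
    (h0 : 0 < h) (h1 : h ≤ 1) (hhT : h ≤ T)
    (hδ : A * (((κ + A) * (1 + M * A) + 1) * h ^ 2) ≤ δ) {x₁ : Plane}
    (hx₁ : ‖x₁ - γ h‖ ≤ κ * h ^ 3) :
    ∃ w, ‖w - γ' 0‖ ≤ (κ + A) * (1 + M * A) * h ^ 2 ∧
      ‖x₁ - (Φ (h ^ 2, γ 0, w) h).2.1‖ ≤ (M * A) ^ 2 * (κ + A) * h ^ 5 := by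
  have hh : h ∈ Icc 0 T := ⟨h0.le, hhT⟩
  have hR : 0 < (κ + A) * (1 + M * A) := by positivity
  refine exists_shooting (F := fun w => (Φ (h ^ 2, γ 0, w) h).2.1) h0 h1 (by positivity)
    (by positivity)
    (fun w w' hw hw' => norm_position_sub_sub_smul_le hΦ hM0 hM hh
      (mul_dist_state_le hA.le hR hδ hw) (mul_dist_state_le hA.le hR hδ hw')) ?_
  have hbase := hγ.norm_sub_position_le hΦ hh ((mul_le_mul_of_nonneg_left
    (le_mul_of_one_le_left (sq_nonneg h) (by linarith)) hA.le).trans hδ)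
  linarith [norm_sub_le_norm_sub_add_norm_sub x₁ (γ h) (Φ (h ^ 2, γ 0, γ' 0) h).2.1]

theorem IsKepler.exists_solution_through (hγ : IsKepler γ γ') (hA : lrl (γ 0) (γ' 0) ≠ 0)
    (hT : 0 < T) (σ : ℝ) (hκ : 0 < κ) :
    ∃ K ⊆ regular σ, IsCompact K ∧ ∃ R > 0, ∃ c ≥ 0, ∀ᶠ h in 𝓝[>] (0 : ℝ),
      ∀ x₁, ‖x₁ - γ h‖ ≤ κ * h ^ 3 → ∃ w, ∃ s : ℝ → State, s 0 = (h ^ 2, γ 0, w) ∧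
        (∀ t ∈ Icc 0 T, s t ∈ K ∧ HasDerivAt s (field σ (s t)) t) ∧
        ‖w - γ' 0‖ ≤ R * h ^ 2 ∧ ‖x₁ - (s h).2.1‖ ≤ c * h ^ 5 := by
  obtain ⟨K, hKU, hK, δ, hδ, A, hA1, Φ, hΦ⟩ := hγ.exists_isFlowAlong hA hT.le σ
  obtain ⟨M, hM0, hM⟩ := exists_norm_sub_le_of_isCompact (isOpen_regular σ) hK hKU
    ((contDiffOn_field σ).of_le (by simp))
  have hA0 : 0 < A := by linarith
  set R := (κ + A) * (1 + M * A)
  have hR : 0 < R := by positivity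
  refine ⟨K, hKU, hK, R, hR, (M * A) ^ 2 * (κ + A), by positivity, ?_⟩
  filter_upwards [Ioo_mem_nhdsGT one_pos, Ioo_mem_nhdsGT hT, eventually_mul_le (A * (R + 1)) hδ]
    with h ⟨h0, h1⟩ hhT hAR x₁ hx₁
  have hball : A * ((R + 1) * h ^ 2) ≤ δ := by
    rw [← mul_assoc]
    refine (mul_le_mul_of_nonneg_left ?_ (by positivity)).trans hAR
    exact pow_le_of_le_one h0.le h1.le two_ne_zero
  obtain ⟨w, hw, hwx⟩ := hγ.exists_velocity hΦ hA0 hM0.le hM hκ h0 h1.le hhT.2.le hball hx₁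
  have hdist := mul_dist_state_le (γ := γ) hA0.le hR hball hw
  exact ⟨w, Φ (h ^ 2, γ 0, w), hΦ.apply_zero _,
    fun t ht => ⟨hΦ.mem hdist ht, hΦ.hasDerivAt _ hdist t ht⟩, hw, hwx⟩

end Shooting

section NumericalPrecession

variable {γ γ' : ℝ → Plane} {σ T : ℝ} {Φ : Plane → Plane → Plane → Plane}

theorem IsKepler.isModifiedLagrangian (hγ : IsKepler γ γ') (hA : lrl (γ 0) (γ' 0) ≠ 0)
    (hT : 0 < T) (hΦ : IsConsistent σ Φ) (hbd : ∀ ρ > 0, ∃ Λ, IsBoundedMethod Φ ρ Λ) :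
    IsModifiedLagrangian Φ (modLagrangian σ) γ γ' T := by
  intro κ hκ
  obtain ⟨K, hKU, hK, R, hR, c, hc, hthrough⟩ := hγ.exists_solution_through hA hT σ hκ
  obtain ⟨E, hE, hshadow⟩ := hΦ.exists_shadow hbd hKU hK hT.le hc
  refine ⟨E + R, by positivity, exists_pos_forall_Ioo ?_⟩
  filter_upwards [hthrough, hshadow] with h hthrough hshadow
  refine ⟨fun x₁ hx₁ => ?_, fun x hx hx0 hx₁ => ?_⟩
  · obtain ⟨w, s, hs0, hs, -, hsx⟩ := hthrough x₁ hx₁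
    simpa only [hs0] using (hshadow s (by rw [hs0]) hs x₁ hsx).1
  · obtain ⟨w, s, hs0, hs, hw, hsx⟩ := hthrough (x 1) hx₁
    refine ⟨_, _, isMotion_of_hasDerivAt_field (fun t ht => ⟨hKU (hs t ht).1, (hs t ht).2⟩)
      (by rw [hs0]), ?_, ?_, fun k hk => ?_⟩
    · rw [hs0, sub_self, norm_zero]
      positivity
    · rw [hs0]
      exact hw.trans (by gcongr; linarith)
    · exact ((hshadow s (by rw [hs0]) hs (x 1) hsx).2 x hx (by rw [hs0, hx0]) rfl k hk).trans
        (by gcongr; linarith)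

theorem precession_coefficient_eq {a b l e : ℝ} (ha : 0 < a) (hb : 0 < b)
    (hl : a * l ^ 2 = b ^ 2) (he : a ^ 2 * e ^ 2 = a ^ 2 - b ^ 2) :
    (4 + e ^ 2) / (8 * l ^ 6) = 1 / 24 * (15 * (a ^ 3 / b ^ 6) - 3 * (a / b ^ 4)) := by
  have hl6 : l ^ 6 = b ^ 6 / a ^ 3 := by
    rw [eq_div_iff (by positivity)]
    linear_combination (a ^ 2 * l ^ 4 + a * l ^ 2 * b ^ 2 + b ^ 4) * hl
  have he2 : e ^ 2 = (a ^ 2 - b ^ 2) / a ^ 2 := by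
    rw [eq_div_iff (by positivity)]
    linarith
  rw [hl6, he2]
  field_simp
  ring

theorem IsKepler.hasNumericalPrecessionRate (hγ : IsKepler γ γ') {F : Plane} {a b : ℝ}
    (hab : IsEllipse (range γ) 0 F a b) (hba : b < a) (hT : IsPeriod γ T)
    (hΦ : IsConsistent σ Φ) (hbd : ∀ ρ > 0, ∃ Λ, IsBoundedMethod Φ ρ Λ) :
    HasNumericalPrecessionRate Φ (modLagrangian σ) γ γ' T
      (Real.sign (angularMomentum (γ 0) (γ' 0)) * (Real.pi / 24) * (1 + σ) *
        (15 * (a ^ 3 / b ^ 6) - 3 * (a / b ^ 4))) := by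
  have ha : 0 < a := hab.1
  have hb : 0 < b := hab.2.1
  have hl := hγ.mul_angularMomentum_sq_of_isEllipse hab
  have he := hγ.sq_mul_norm_lrl_sq_of_isEllipse hab
  have hl0 : angularMomentum (γ 0) (γ' 0) ≠ 0 := by
    intro h0
    rw [h0, zero_pow two_ne_zero, mul_zero] at hl
    exact (pow_pos hb 2).ne hl
  have hA : lrl (γ 0) (γ' 0) ≠ 0 := by
    intro h0
    rw [h0, norm_zero] at he
    nlinarith
  refine ⟨hγ.isModifiedLagrangian hA hT.1.1 hΦ hbd, ?_⟩
  convert hγ.hasPrecessionRate hl0 hA hT σ using 1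
  rw [mul_div_assoc, precession_coefficient_eq ha hb hl he]
  ring

end NumericalPrecession

end Kepler

end

theorem mainTheorem2 (γ γ' : ℝ → Kepler.Plane) (a b T : ℝ)
    (hγ : Kepler.IsMotion Kepler.lagrangian Set.univ γ γ')
    (hab : ∃ F : Kepler.Plane, Kepler.IsEllipse (Set.range γ) 0 F a b)
    (hecc : b < a)
    (hT : Kepler.IsPeriod γ T) :
    ∃ ρ ρSV : ℝ,
      Kepler.HasNumericalPrecessionRate Kepler.midpointForce Kepler.midpointLagrangian γ γ' T ρ ∧
      ρ = Real.sign (Kepler.angularMomentum (γ 0) (γ' 0)) * (Real.pi / 12) *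
        (15 * (a ^ 3 / b ^ 6) - 3 * (a / b ^ 4)) ∧
      Kepler.HasNumericalPrecessionRate Kepler.verletForce Kepler.verletLagrangian γ γ' T ρSV ∧
      ρ = -2 * ρSV := by
  obtain ⟨F, hF⟩ := hab
  rw [Kepler.midpointLagrangian_eq_modLagrangian, Kepler.verletLagrangian_eq_modLagrangian]
  have hmidpoint := hγ.isKepler.hasNumericalPrecessionRate hF hecc hT
    Kepler.isConsistent_midpointForce fun ρ hρ => ⟨_, Kepler.isBoundedMethod_midpointForce hρ⟩
  have hverlet := hγ.isKepler.hasNumericalPrecessionRate hF hecc hT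
    Kepler.isConsistent_verletForce fun ρ hρ => ⟨_, Kepler.isBoundedMethod_verletForce hρ⟩
  exact ⟨_, _, hmidpoint, by ring, hverlet, by ring⟩
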